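/- A \emph{knot} is an oriented knot in $\mathbb{R}^3$, given by an injective continuous parametrization of the circle; two knots are \emph{isotopic} if an ambient isotopy of $\mathbb{R}^3$ carries one to the other preserving orientations, and a \emph{knot type} is an isotopy class of knots. A \emph{petal diagram} with $2n+1$ petals of a knot $K$ is a vertical projection of $K$ to the plane with a single multiple point, through which $2n+1$ strands pass transversally, the strands being regular $C^1$ curves near this point, such that the rest of the diagram consists of $2n+1$ simple loops (petals) based at this point, none of which is nested inside another; it is oriented so that the petals are traversed counterclockwise. (If $n=0$, the projection is a simple closed curve with a marked point, near which it is a regular $C^1$ curve.) Label the strands at the multiple point by $0,1,\dots,2n$ from top to bottom. The cyclic sequence $\sigma=(p_0p_1\cdots p_{2n})$ of the labels met when traversing the diagram once is the \emph{petal permutation} of the diagram. A cyclic ordering $\sigma$ of $\{0,\dots,2n\}$ \emph{represents} a knot type $T$ if some knot of type $T$ has a petal diagram with petal permutation $\sigma$. For an integer $m$ let $g_m(a)=a$ if $a<m$ and $g_m(a)=a+2$ if $a\ge m$. Let $n\ge 0$, and let $\sigma=(p_0p_1\cdots p_{2n})$ and $\sigma'$ be cyclic orderings of $\{0,\dots,2n\}$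 and $\{0,\dots,2n+2\}$. Then $\sigma'$ is obtained from $\sigma$ by a \emph{trivial petal addition} (and $\sigma$ from $\sigma'$ by a \emph{trivial petal deletion}) if for some $0\le j\le 2n$ and some $m$ $$\sigma'=(g_m(p_0)\cdots g_m(p_j)\;m\;(m+1)\;g_m(p_{j+1})\cdots g_m(p_{2n}))$$ or $$\sigma'=(g_m(p_0)\cdots g_m(p_j)\;(m+1)\;m\;g_m(p_{j+1})\cdots g_m(p_{2n})).$$ \textbf{Corollary.} If $\sigma'$ is obtained from $\sigma$ by a trivial petal addition, then $\sigma$ and $\sigma'$ represent the same knot type: there is a knot type $T$ such that $T$ is the one and only knot type represented by $\sigma$, and also the one and only knot type represented by $\sigma'$. Hence trivial petal additions and deletions do not change the knot type represented by a petal permutation. -/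

import Mathlib

open Topology

/-- Euclidean three-space, written as (horizontal plane) × (height).  The vertical projection is
`Prod.fst` and the height is `Prod.snd`; the plane is viewed from above. -/
abbrev Space : Type := ℂ × ℝ

/-- An oriented knot in three-space: a continuous injective closed curve, given as a map on `ℝ` of
period `1` that is injective modulo the period. -/
structure Knot where
  toFun : ℝ → Space
  continuous_toFun : Continuous toFun
  periodic : ∀ t, toFun (t + 1) = toFun t
  injective : ∀ s t, toFun s = toFun t → ∃ k : ℤ, t = s + k

instance : CoeFun Knot (fun _ => ℝ → Space) := ⟨Knot.toFun⟩

/-- An orientation preserving change of parameter of the circle `ℝ / ℤ`, lifted to `ℝ`. -/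
def IsReparametrization (φ : ℝ → ℝ) : Prop :=
  Continuous φ ∧ StrictMono φ ∧ ∀ t, φ (t + 1) = φ t + 1

/-- An ambient isotopy of three-space: a continuous family of homeomorphisms starting at the
identity. -/
structure AmbientIsotopy where
  toHomeo : unitInterval → Space ≃ₜ Space
  continuous_uncurry : Continuous fun p : unitInterval × Space => toHomeo p.1 p.2
  map_zero : ∀ x, toHomeo 0 x = x

/-- Two oriented knots are isotopic if an ambient isotopy carries the first onto the second,
respecting orientations. -/
def Knot.Isotopic (K K' : Knot) : Prop :=
  ∃ (H : AmbientIsotopy) (φ : ℝ → ℝ),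
    IsReparametrization φ ∧ ∀ t, H.toHomeo 1 (K t) = K' (φ t)

theorem IsReparametrization.exists_inverse {φ : ℝ → ℝ} (h : IsReparametrization φ) :
    ∃ ψ : ℝ → ℝ, IsReparametrization ψ ∧ ∀ t, φ (ψ t) = t := by
  obtain ⟨hc, hm, hp⟩ := h
  have hn : ∀ (k : ℕ), φ k = φ 0 + k := by
    intro k
    induction k with
    | zero => simp
    | succ k ih => push_cast; rw [hp, ih]; ring
  have hneg : ∀ (k : ℕ), φ (-k) = φ 0 - k := by
    intro k
    induction k with
    | zero => simp
    | succ k ih =>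
      have h1 := hp (-((k : ℝ) + 1))
      have h2 : -((k : ℝ) + 1) + 1 = -k := by ring
      rw [h2, ih] at h1
      push_cast
      linarith
  have hs : Function.Surjective φ := by
    intro y
    obtain ⟨k, hk⟩ := exists_nat_ge |y - φ 0|
    have hk' := abs_le.mp hk
    have h0 : (-(k : ℝ)) ≤ k := by linarith [k.cast_nonneg (α := ℝ)]
    obtain ⟨x, -, hx⟩ := intermediate_value_Icc h0 hc.continuousOn
      (show y ∈ Set.Icc (φ (-k)) (φ k) by
        rw [hn, hneg]; constructor <;> linarith)
    exact ⟨x, hx⟩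
  let e := hm.orderIsoOfSurjective φ hs
  have he : ∀ t, φ (e.symm t) = t := fun t => e.apply_symm_apply t
  refine ⟨e.symm, ⟨e.symm.continuous, e.symm.strictMono, fun t => ?_⟩, he⟩
  apply hm.injective
  rw [he, hp, he]

theorem Knot.isotopic_refl (K : Knot) : K.Isotopic K :=
  ⟨⟨fun _ => Homeomorph.refl _, continuous_snd, fun _ => rfl⟩, id,
    ⟨continuous_id, strictMono_id, fun _ => rfl⟩, fun _ => rfl⟩

theorem Knot.Isotopic.symm {K K' : Knot} (h : K.Isotopic K') : K'.Isotopic K := by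
  obtain ⟨H, φ, hφ, h⟩ := h
  obtain ⟨ψ, hψ, hφψ⟩ := hφ.exists_inverse
  refine ⟨⟨fun s => (H.toHomeo 1).symm.trans (H.toHomeo (unitInterval.symm s)), ?_, ?_⟩,
    ψ, hψ, ?_⟩
  · exact H.continuous_uncurry.comp
      ((unitInterval.continuous_symm.comp continuous_fst).prodMk
        ((H.toHomeo 1).symm.continuous.comp continuous_snd))
  · intro x
    simp
  · intro t
    have h1 := h (ψ t)
    rw [hφψ] at h1
    simp [← h1, H.map_zero]

theorem Knot.Isotopic.trans {K K' K'' : Knot} (h : K.Isotopic K') (h' : K'.Isotopic K'') :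
    K.Isotopic K'' := by
  obtain ⟨H, φ, hφ, h⟩ := h
  obtain ⟨H', φ', hφ', h'⟩ := h'
  refine ⟨⟨fun s => (H.toHomeo s).trans (H'.toHomeo s), ?_, ?_⟩, φ' ∘ φ,
    ⟨hφ'.1.comp hφ.1, hφ'.2.1.comp hφ.2.1, fun t => ?_⟩, fun t => ?_⟩
  · exact H'.continuous_uncurry.comp (continuous_fst.prodMk H.continuous_uncurry)
  · intro x
    simp [H.map_zero, H'.map_zero]
  · simp [hφ.2.2, hφ'.2.2]
  · simp [h, h']

instance Knot.setoid : Setoid Knot where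
  r := Knot.Isotopic
  iseqv := ⟨Knot.isotopic_refl, Knot.Isotopic.symm, Knot.Isotopic.trans⟩

/-- A knot type: an isotopy class of oriented knots. -/
abbrev KnotType : Type := Quotient Knot.setoid

/-- The vertical projection of a knot to the plane. -/
def Knot.proj (K : Knot) (t : ℝ) : ℂ := (K t).1

/-- The height of a point of a knot above the plane. -/
def Knot.height (K : Knot) (t : ℝ) : ℝ := (K t).2

/-- The vertical projection of `K` is a petal diagram with `2 n + 1` petals, oriented
counterclockwise.  Strands and petals are indexed by `ℤ` in the order in which the knot runs
through them, periodically with period `2 n + 1`; petal `k` is the loop between the strands `k`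
and `k + 1`. -/
structure PetalDiagram (K : Knot) (n : ℕ) where
  /-- The multicrossing point. -/
  center : ℂ
  /-- The time at which the knot passes the crossing point along strand `k`. -/
  time : ℤ → ℝ
  time_strictMono : StrictMono time
  time_periodic : ∀ k, time (k + (2 * n + 1)) = time k + 1
  proj_eq_center_iff : ∀ t, K.proj t = center ↔ ∃ k, t = time k
  /-- Away from the crossing point the projection has no multiple points. -/
  proj_injective : ∀ s t, K.proj s = K.proj t → K.proj s ≠ center → ∃ k : ℤ, t = s + k
  /-- The angle of the tangent line of strand `k` at the crossing point.  The tangent lines are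
  distinct, and turn counterclockwise by a total angle `π` in one run through the diagram. -/
  angle : ℤ → ℝ
  angle_strictMono : StrictMono angle
  angle_periodic : ∀ k, angle (k + (2 * n + 1)) = angle k + Real.pi
  /-- The strands are regular curves near the crossing point.  The exit direction is alternately
  that of `angle k` and its opposite, so that petal `k` leaves and returns along neighbouring
  rays. -/
  contDiffAt_proj : ∀ k, ContDiffAt ℝ 1 K.proj (time k)
  hasDerivAt_proj : ∀ k, ∃ r : ℝ, 0 < r ∧
    HasDerivAt K.proj (r * ((-1) ^ k * Complex.exp (angle k * Complex.I))) (time k)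
  /-- No petal is nested in another one: each point of petal `k` other than the crossing point
  lies in an unbounded component of the complement of petal `j`. -/
  not_nested : ∀ j k : ℤ, ¬ (j ≡ k [ZMOD (2 * n + 1)]) →
    ∀ t ∈ Set.Ioo (time k) (time (k + 1)),
      ¬ Bornology.IsBounded
        (connectedComponentIn (K.proj '' Set.Icc (time j) (time (j + 1)))ᶜ (K.proj t))
  /-- The label of strand `k`.  The labels order the strands at the crossing point from top to
  bottom. -/
  label : ℤ → ℕ
  label_lt_iff : ∀ j k, label j < label k ↔ K.height (time k) < K.height (time j)

/-- The cyclic sequence of strand labels met in one run through a petal diagram. -/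
def PetalDiagram.labels {K : Knot} {n : ℕ} (D : PetalDiagram K n) : Cycle ℕ :=
  ((List.range (2 * n + 1)).map fun k : ℕ => D.label k : List ℕ)

/-- A petal permutation `(p₀ p₁ ⋯ p₂ₙ)`: a cyclic ordering of the labels `0, 1, …, 2 n`. -/
structure PetalPermutation (n : ℕ) where
  cycle : Cycle ℕ
  toMultiset_cycle : cycle.toMultiset = Multiset.range (2 * n + 1)

/-- `σ` represents the knot type `T` if some knot of type `T` has a petal diagram with petal
permutation `σ`. -/
def PetalPermutation.Represents {n : ℕ} (σ : PetalPermutation n) (T : KnotType) : Prop :=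
  ∃ K : Knot, (∃ D : PetalDiagram K n, D.labels = σ.cycle) ∧ (⟦K⟧ : KnotType) = T

/-- The shift of labels that makes room for the new labels `m` and `m + 1`. -/
def labelShift (m a : ℕ) : ℕ := if a < m then a else a + 2

/-- `σ'` is obtained from `σ = (u v)` by inserting `m (m + 1)` or `(m + 1) m` between the nonempty
word `u` and the possibly empty word `v`, and shifting the other labels. -/
def IsTrivialPetalAddition {n : ℕ} (σ : PetalPermutation n) (σ' : PetalPermutation (n + 1)) :
    Prop :=
  ∃ (m : ℕ) (u v : List ℕ), u ≠ [] ∧ σ.cycle = ((u ++ v : List ℕ) : Cycle ℕ) ∧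
    (σ'.cycle = ((u.map (labelShift m) ++ [m, m + 1] ++ v.map (labelShift m) : List ℕ) :
        Cycle ℕ) ∨
      σ'.cycle = ((u.map (labelShift m) ++ [m + 1, m] ++ v.map (labelShift m) : List ℕ) :
        Cycle ℕ))

/-!
Every petal permutation represents exactly one knot type, and this type does not change under a
trivial petal addition.

*Existence and invariance.*  For a function `r` with `r (t + 1) = -r t`, the closed curve with
projection `r t * exp (π t I)` has the origin as its only multiple point, since different times in
`[0, 1)` lie on different lines through the origin.  With suitable heights it is therefore a knot
with a petal diagram (`exists_petalDiagram_polarKnot`), whose strands correspond to the zeros of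
`r`.  Let `r` have `N + 2` zeros in a period, two of which are neighbours
in time with neighbouring heights.  A small perturbation of `r` removes these two zeros, and the
knot of the perturbed function is isotopic to that of `r`: the small petal between the two strands
is pushed across the origin at heights that no other strand occupies
(`exists_isotopic_of_finger`).  The labels of the two knots are those after and before a trivial
petal addition (`IsTrivialPetalAddition.exists_isotopic`).

*Uniqueness.*  A knot with a petal diagram is first brought into a normal form
(`PetalDiagram.exists_isNormal`): near the crossing point the strands become the diameters of the
unit disc at equal angles, at the heights given by the labels.  Here the `C¹` condition makes the
distance to the crossing point monotone and the polar angle continuous along each strand, so that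
circles about the crossing point can be turned into themselves to straighten the strands.  Outside
the unit disc two such knots with the same labels may still look different.  Instead of comparing
the petals in the plane, which would take the Schoenflies theorem, the petals are removed one at a
time (`Knot.exists_straighten`): as the projection is injective away from the origin, the outer part
of a petal can be lifted above the rest of the knot by a vertical shear, and there it is
pulled into a standard position inside the disc by homeomorphisms that act on each horizontal plane
as an affine map.  At the end nothing outside the disc is left, and the knots agree
(`Knot.IsNormal.isotopic`).  The knot type thus depends only on the labels, as a function of the
index of the strand, and a shift of the index does not matter
(`PetalDiagram.isotopic_of_labels_eq`).
-/

/-! ### Ambient isotopies -/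

/-- A self-map of space that is the final map of an ambient isotopy. -/
def IsotopicToId (f : Space → Space) : Prop :=
  ∃ H : AmbientIsotopy, ∀ x, H.toHomeo 1 x = f x

theorem Knot.exists_map (K : Knot) {f : Space → Space} (hf : IsotopicToId f) :
    ∃ K' : Knot, K.Isotopic K' ∧ ∀ t, K' t = f (K t) := by
  obtain ⟨H, hH⟩ := hf
  refine ⟨⟨fun t => H.toHomeo 1 (K t), (H.toHomeo 1).continuous.comp K.continuous_toFun,
    fun t => by rw [K.periodic], fun s t h => K.injective s t ((H.toHomeo 1).injective h)⟩,
    ⟨H, id, ⟨continuous_id, strictMono_id, fun _ => rfl⟩, fun _ => rfl⟩, fun t => hH _⟩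

theorem Knot.periodic_int (K : Knot) (t : ℝ) (k : ℤ) : K (t + k) = K t := by
  have h : Function.Periodic K.toFun 1 := K.periodic
  simpa using h.int_mul k t

theorem IsReparametrization.map_int_add {φ : ℝ → ℝ} (h : IsReparametrization φ) (t : ℝ) (k : ℤ) :
    φ (t + k) = φ t + k := by
  have h1 : Function.Periodic (fun t => φ t - t) 1 := fun t => by
    simp only [h.2.2]; ring
  have := h1.int_mul k t
  simp only [mul_one] at this
  linarith

theorem Knot.exists_reparam (K : Knot) {φ : ℝ → ℝ} (h : IsReparametrization φ) :
    ∃ K' : Knot, K.Isotopic K' ∧ ∀ t, K' t = K (φ t) := by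
  let K' : Knot :=
    ⟨fun t => K (φ t), K.continuous_toFun.comp h.1, fun t => by rw [h.2.2, K.periodic],
      fun s t hst => by
        obtain ⟨k, hk⟩ := K.injective _ _ hst
        rw [← h.map_int_add] at hk
        exact ⟨k, h.2.1.injective hk⟩⟩
  refine ⟨K', Knot.Isotopic.symm ?_, fun t => rfl⟩
  exact ⟨⟨fun _ => Homeomorph.refl _, continuous_snd, fun _ => rfl⟩, φ, h, fun _ => rfl⟩

theorem IsotopicToId.of_family (F : unitInterval → Space → Space)
    (hc : Continuous fun p : unitInterval × Space => F p.1 p.2) (h0 : ∀ x, F 0 x = x)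
    (he : ∀ s, ∃ e : Space ≃ₜ Space, ∀ x, e x = F s x) : IsotopicToId (F 1) := by
  choose e he using he
  exact ⟨⟨e, by simpa only [he] using hc, fun x => by rw [he, h0]⟩, fun x => he 1 x⟩

/-- A continuous bijection of space that does not bring far points close to the origin is a
homeomorphism, because it is proper. -/
theorem exists_homeomorph_of_bijective {f : Space → Space} (hc : Continuous f)
    (hb : Function.Bijective f) (C : ℝ) (hC : ∀ x, ‖x‖ ≤ ‖f x‖ + C) :
    ∃ e : Space ≃ₜ Space, ∀ x, e x = f x := by
  have hp : IsProperMap f := by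
    rw [isProperMap_iff_tendsto_cocompact]
    refine ⟨hc, ?_⟩
    rw [← Metric.cobounded_eq_cocompact, ← tendsto_norm_atTop_iff_cobounded]
    have h1 : Filter.Tendsto (fun x : Space => ‖x‖ - C) (Bornology.cobounded Space)
        Filter.atTop :=
      Filter.tendsto_atTop_add_const_right _ (-C) tendsto_norm_cobounded_atTop
    exact Filter.tendsto_atTop_mono (fun x => by linarith [hC x]) h1
  exact ⟨(Equiv.ofBijective f hb).toHomeomorphOfContinuousClosed hc hp.isClosedMap, fun _ => rfl⟩

/-- Changing the height by a function of the horizontal position. -/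
theorem isotopicToId_shear {f : ℂ → ℝ} (hf : Continuous f) :
    IsotopicToId fun x => (x.1, x.2 + f x.1) := by
  have := IsotopicToId.of_family (fun s x => (x.1, x.2 + (s : ℝ) * f x.1)) (by fun_prop)
    (fun x => by simp) (fun s => ⟨⟨⟨fun x => (x.1, x.2 + (s : ℝ) * f x.1),
      fun x => (x.1, x.2 - (s : ℝ) * f x.1), fun x => by simp, fun x => by simp⟩,
      by fun_prop, by fun_prop⟩, fun x => rfl⟩)
  simpa using this

/-- Moving each horizontal plane by a complex affine map, the planes below some level being
fixed. -/
theorem isotopicToId_levelAffine {A B : ℝ → ℂ} (hA : Continuous A) (hB : Continuous B)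
    (hA0 : ∀ x, A x ≠ 0) (a b : ℝ) (ha : ∀ x ≤ a, A x = 1 ∧ B x = 0)
    (hb : ∀ x, b ≤ x → A x = A b ∧ B x = B b) :
    IsotopicToId fun x => (A x.2 * x.1 + B x.2, x.2) := by
  have := IsotopicToId.of_family
    (fun s x => (A (min x.2 (a + (s : ℝ) * (b - a))) * x.1 + B (min x.2 (a + (s : ℝ) * (b - a))),
      x.2)) (by fun_prop)
    (fun x => by
      obtain ⟨h1, h2⟩ := ha (min x.2 (a + ((0 : unitInterval) : ℝ) * (b - a))) (by simp)
      simp only [h1, h2]; simp)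
    (fun s => by
      set u : ℝ → ℝ := fun x => min x (a + (s : ℝ) * (b - a)) with hu
      have huc : Continuous u := by fun_prop
      refine ⟨⟨⟨fun x => (A (u x.2) * x.1 + B (u x.2), x.2),
        fun x => ((A (u x.2))⁻¹ * (x.1 - B (u x.2)), x.2), fun x => ?_, fun x => ?_⟩, ?_, ?_⟩,
        fun x => rfl⟩
      · ext1
        · simp [hA0]
        · rfl
      · ext1
        · simp [hA0]
        · rfl
      · fun_prop
      · have : Continuous fun x : Space => (A (u x.2))⁻¹ :=
          Continuous.inv₀ (by fun_prop) (fun x => hA0 _)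
        fun_prop)
  convert this using 2 with x
  simp only [Set.Icc.coe_one, one_mul, add_sub_cancel]
  rcases le_total x.2 b with h | h
  · rw [min_eq_left h]
  · rw [min_eq_right h, (hb _ h).1, (hb _ h).2]

/-- Scaling and translating all horizontal planes in the same way. -/
theorem isotopicToId_planar (c : ℂ) {l : ℝ} (hl : 0 < l) :
    IsotopicToId fun x => (l * (x.1 - c), x.2) := by
  have hpos : ∀ s : unitInterval, (0 : ℝ) < 1 + (s : ℝ) * (l - 1) := fun s => by
    have h0 := s.2.1
    have h1 := s.2.2
    nlinarith [mul_nonneg h0 hl.le]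
  have := IsotopicToId.of_family
    (fun s x => (((1 + (s : ℝ) * (l - 1) : ℝ) : ℂ) * (x.1 - (s : ℝ) * c), x.2)) (by fun_prop)
    (fun x => by simp)
    (fun s => by
      have hne : (((1 + (s : ℝ) * (l - 1) : ℝ)) : ℂ) ≠ 0 := by
        exact_mod_cast (hpos s).ne'
      refine ⟨⟨⟨fun x => (((1 + (s : ℝ) * (l - 1) : ℝ) : ℂ) * (x.1 - (s : ℝ) * c), x.2),
        fun x => ((((1 + (s : ℝ) * (l - 1) : ℝ)) : ℂ)⁻¹ * x.1 + (s : ℝ) * c, x.2),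
        fun x => ?_, fun x => ?_⟩, ?_, ?_⟩, fun x => rfl⟩
      · ext1
        · simp only [inv_mul_cancel_left₀ hne]; ring
        · rfl
      · ext1
        · simp only [add_sub_cancel_right, mul_inv_cancel_left₀ hne]
        · rfl
      · fun_prop
      · fun_prop)
  simpa using this

/-- Changing the height by an increasing function of the height. -/
theorem isotopicToId_height (ψ : ℝ ≃o ℝ) : IsotopicToId fun x => (x.1, ψ x.2) := by
  have hψ : Continuous ψ := ψ.continuous
  have := IsotopicToId.of_family
    (fun s x => (x.1, (1 - (s : ℝ)) * x.2 + (s : ℝ) * ψ x.2)) (by fun_prop)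
    (fun x => by simp)
    (fun s => by
      set f : ℝ → ℝ := fun x => (1 - (s : ℝ)) * x + (s : ℝ) * ψ x with hf
      have hfc : Continuous f := by fun_prop
      have h0 := s.2.1
      have h1 := s.2.2
      have hmono : StrictMono f := by
        intro x y hxy
        have hy := ψ.strictMono hxy
        simp only [hf]
        rcases h0.eq_or_lt with h | h
        · rw [← h]; linarith
        · nlinarith [mul_pos h (sub_pos.2 hy), mul_nonneg (sub_nonneg.2 h1) (sub_pos.2 hxy).le]
      have hsurj : Function.Surjective f := by
        intro y
        set p := min y (ψ.symm y)
        set q := max y (ψ.symm y)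
        have hp1 : ψ p ≤ y := by
          exact (ψ.monotone (min_le_right _ _)).trans_eq (ψ.apply_symm_apply y)
        have hq1 : y ≤ ψ q := by
          exact (ψ.apply_symm_apply y).symm.trans_le (ψ.monotone (le_max_right _ _))
        have hp2 : p ≤ y := min_le_left _ _
        have hq2 : y ≤ q := le_max_left _ _
        obtain ⟨x, -, hx⟩ := intermediate_value_Icc (hp2.trans hq2) hfc.continuousOn
          (show y ∈ Set.Icc (f p) (f q) by
            constructor
            · simp only [hf]
              nlinarith [mul_nonneg h0 (sub_nonneg.2 hp1),
                mul_nonneg (sub_nonneg.2 h1) (sub_nonneg.2 hp2)]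
            · simp only [hf]
              nlinarith [mul_nonneg h0 (sub_nonneg.2 hq1),
                mul_nonneg (sub_nonneg.2 h1) (sub_nonneg.2 hq2)])
        exact ⟨x, hx⟩
      exact ⟨(Homeomorph.refl ℂ).prodCongr (hmono.orderIsoOfSurjective f hsurj).toHomeomorph,
        fun x => rfl⟩)
  simpa using this

/-- In each horizontal plane, pushing the point `c` along the vector `v`, the points at distance
at least `R` from `c` being fixed. -/
theorem isotopicToId_push {c v : ℝ → ℂ} (hc : Continuous c) (hv : Continuous v) {R : ℝ}
    (hR : 0 < R) {q : ℝ} (hq : q < 1) (hvR : ∀ x, ‖v x‖ ≤ q * R) :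
    IsotopicToId fun x => (x.1 + (max 0 (1 - ‖x.1 - c x.2‖ / R) : ℝ) * v x.2, x.2) := by
  have hq0 : 0 ≤ q := nonneg_of_mul_nonneg_left ((norm_nonneg _).trans (hvR 0)) hR
  set g : Space → ℝ := fun x => max 0 (1 - ‖x.1 - c x.2‖ / R) with hg
  have hgc : Continuous g := by fun_prop
  have hg0 : ∀ x, 0 ≤ g x := fun x => le_max_left _ _
  have hg1 : ∀ x, g x ≤ 1 := fun x => by
    simp only [hg]
    exact max_le zero_le_one (by linarith [div_nonneg (norm_nonneg (x.1 - c x.2)) hR.le])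
  have hgl : ∀ z w h, |g (z, h) - g (w, h)| ≤ ‖z - w‖ / R := by
    intro z w h
    simp only [hg]
    refine (abs_max_sub_max_le_max _ _ _ _).trans ?_
    rw [sub_self, abs_zero, max_eq_right (abs_nonneg _)]
    have : (1 - ‖z - c h‖ / R) - (1 - ‖w - c h‖ / R) = (‖w - c h‖ - ‖z - c h‖) / R := by ring
    rw [this, abs_div, abs_of_pos hR]
    gcongr
    refine (abs_norm_sub_norm_le _ _).trans ?_
    rw [norm_sub_rev z w]
    simp
  -- the displacement is a contraction in each horizontal plane
  have hcontr : ∀ (s : unitInterval) z w h,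
      ‖((s : ℝ) * g (z, h) : ℂ) * v h - ((s : ℝ) * g (w, h) : ℂ) * v h‖ ≤ q * ‖z - w‖ := by
    intro s z w h
    have e : ((s : ℝ) * g (z, h) : ℂ) * v h - ((s : ℝ) * g (w, h) : ℂ) * v h
        = ((s * (g (z, h) - g (w, h)) : ℝ) : ℂ) * v h := by push_cast; ring
    rw [e, norm_mul, Complex.norm_real, Real.norm_eq_abs, abs_mul, abs_of_nonneg s.2.1]
    calc (s : ℝ) * |g (z, h) - g (w, h)| * ‖v h‖ ≤ 1 * (‖z - w‖ / R) * (q * R) := by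
          gcongr
          · exact s.2.2
          · exact hgl z w h
          · exact hvR h
      _ = q * ‖z - w‖ := by field_simp
  have := IsotopicToId.of_family
    (fun s x => (x.1 + ((s : ℝ) * g x : ℂ) * v x.2, x.2)) (by fun_prop) (fun x => by simp)
    (fun s => by
      refine exists_homeomorph_of_bijective (by fun_prop) ⟨?_, ?_⟩ (q * R) ?_
      · rintro ⟨z, h⟩ ⟨w, h'⟩ hzw
        simp only [Prod.mk.injEq] at hzw
        obtain ⟨h1, rfl⟩ := hzw
        have h2 := hcontr s z w h
        have h3 : ((s : ℝ) * g (z, h) : ℂ) * v h - ((s : ℝ) * g (w, h) : ℂ) * v h = w - z := by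
          linear_combination h1
        rw [h3, norm_sub_rev] at h2
        have h4 : ‖z - w‖ = 0 := by nlinarith [norm_nonneg (z - w)]
        rw [norm_eq_zero, sub_eq_zero] at h4
        rw [h4]
      · rintro ⟨y, h⟩
        have hK : ContractingWith ⟨q, hq0⟩ (fun z => y - ((s : ℝ) * g (z, h) : ℂ) * v h) := by
          refine ⟨by exact_mod_cast hq, LipschitzWith.of_dist_le_mul fun z w => ?_⟩
          rw [dist_eq_norm, dist_eq_norm, sub_sub_sub_cancel_left, norm_sub_rev]
          exact hcontr s z w h
        refine ⟨(hK.fixedPoint, h), ?_⟩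
        have := hK.fixedPoint_isFixedPt
        simp only [Function.IsFixedPt] at this
        ext1
        · linear_combination -this
        · rfl
      · intro x
        have e : x = (x.1 + ((s : ℝ) * g x : ℂ) * v x.2, x.2)
            - ((((s * g x : ℝ)) : ℂ) * v x.2, 0) := by
          ext1 <;> simp
        have h1 : ‖(((((s * g x : ℝ)) : ℂ) * v x.2, 0) : Space)‖ ≤ q * R := by
          rw [Prod.norm_def, norm_zero, max_eq_left (norm_nonneg _), norm_mul, Complex.norm_real,
            Real.norm_eq_abs, abs_of_nonneg (mul_nonneg s.2.1 (hg0 x))]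
          calc (s : ℝ) * g x * ‖v x.2‖ ≤ 1 * 1 * (q * R) := by
                have hs := s.2.2
                gcongr
                · exact hg1 x
                · exact hvR _
            _ = q * R := by ring
        calc ‖x‖ ≤ ‖((x.1 + ((s : ℝ) * g x : ℂ) * v x.2, x.2) : Space)‖
              + ‖(((((s * g x : ℝ)) : ℂ) * v x.2, 0) : Space)‖ := by
              conv_lhs => rw [e]
              exact norm_sub_le _ _
          _ ≤ _ := by gcongr)
  simpa using this

/-- The heights of a knot may be changed by any continuous function of the time that takes equal
values at times with the same projection: by the Tietze extension theorem, such a change is a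
shear of space. -/
theorem Knot.exists_shear (K : Knot) {d : ℝ → ℝ} (hd : Continuous d)
    (h : ∀ s t, (K s).1 = (K t).1 → d s = d t) :
    ∃ K' : Knot, K.Isotopic K' ∧ ∀ t, K' t = ((K t).1, (K t).2 + d t) := by
  let I := Set.Icc (0 : ℝ) 1
  let P : Set ℂ := Set.range fun t : I => (K t).1
  let π : I → P := fun t => ⟨(K t).1, t, rfl⟩
  have hKc : Continuous fun t => K t := K.continuous_toFun
  have hπc : Continuous π := by
    apply Continuous.subtype_mk
    fun_prop
  have hπs : Function.Surjective π := by
    rintro ⟨_, t, rfl⟩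
    exact ⟨t, rfl⟩
  have hq : IsQuotientMap π := hπc.isClosedMap.isQuotientMap hπc hπs
  have hPc : IsClosed P := by
    apply IsCompact.isClosed
    apply isCompact_range
    fun_prop
  choose τ hτ using hπs
  have hfτ : ∀ t : I, d (τ (π t)) = d t := fun t => by
    apply h
    have := congrArg Subtype.val (hτ (π t))
    exact this
  have hfc : Continuous fun p : P => d (τ p) := by
    rw [hq.continuous_iff]
    have : (fun p : P => d (τ p)) ∘ π = fun t : I => d t := by
      ext t
      exact hfτ t
    rw [this]
    fun_prop
  obtain ⟨f, hf⟩ := ContinuousMap.exists_restrict_eq hPc (⟨_, hfc⟩ : C(P, ℝ))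
  have hf1 : ∀ t : I, f (K t).1 = d t := fun t => by
    have := DFunLike.congr_fun hf (π t)
    simp only [ContinuousMap.restrict_apply, ContinuousMap.coe_mk, hfτ] at this
    exact this
  have hf2 : ∀ t, f (K t).1 = d t := fun t => by
    have e : K (Int.fract t) = K t := by
      have := K.periodic_int (Int.fract t) ⌊t⌋
      rw [Int.fract_add_floor] at this
      exact this.symm
    rw [← e, hf1 ⟨Int.fract t, Int.fract_nonneg t, (Int.fract_lt_one t).le⟩]
    exact h _ _ (by rw [e])
  obtain ⟨K', h1, h2⟩ := K.exists_map (isotopicToId_shear f.continuous)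
  exact ⟨K', h1, fun t => by rw [h2, hf2]⟩

theorem IsotopicToId.exists_inverse {f : Space → Space} (hf : IsotopicToId f) :
    ∃ g, IsotopicToId g ∧ (∀ x, g (f x) = x) ∧ ∀ x, f (g x) = x := by
  obtain ⟨H, hH⟩ := hf
  refine ⟨(H.toHomeo 1).symm,
    ⟨⟨fun s => (H.toHomeo 1).symm.trans (H.toHomeo (unitInterval.symm s)), ?_, ?_⟩, ?_⟩, ?_, ?_⟩
  · exact H.continuous_uncurry.comp
      ((unitInterval.continuous_symm.comp continuous_fst).prodMk
        ((H.toHomeo 1).symm.continuous.comp continuous_snd))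
  · intro x
    simp
  · intro x
    simp [H.map_zero]
  · intro x
    simp [← hH]
  · intro x
    simp [← hH]

/-! ### Gluing functions on consecutive intervals -/

theorem exists_mem_Ico_of_periodic {x : ℤ → ℝ} (hx : StrictMono x) {M : ℤ}
    (hM : ∀ k, x (k + M) = x k + 1) (t : ℝ) : ∃ k, t ∈ Set.Ico (x k) (x (k + 1)) := by
  have hp : Function.Periodic (fun q : ℤ => x (q * M) - q) 1 := fun q => by
    have := hM (q * M)
    simp only [add_mul, one_mul, this]
    push_cast
    ring
  have hq : ∀ q : ℤ, x (q * M) = x 0 + q := fun q => by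
    have := hp.int_mul q 0
    simp only [mul_one, zero_add, zero_mul, Int.cast_zero, sub_zero, Int.cast_id] at this
    linarith
  obtain ⟨k, hk1, hk2⟩ := Int.exists_greatest_of_bdd (P := fun k => x k ≤ t)
    ⟨⌈t - x 0⌉ * M, fun k hk => by
      apply hx.le_iff_le.1
      rw [hq]
      linarith [Int.le_ceil (t - x 0)]⟩
    ⟨⌊t - x 0⌋ * M, by
      rw [hq]
      linarith [Int.floor_le (t - x 0)]⟩
  refine ⟨k, hk1, ?_⟩
  by_contra h
  have := hk2 (k + 1) (not_lt.1 h)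
  omega

theorem exists_mem_Ico_intCast (t : ℝ) : ∃ k : ℤ, t ∈ Set.Ico (k : ℝ) ((k + 1 : ℤ) : ℝ) :=
  ⟨⌊t⌋, Int.floor_le t, by push_cast; exact Int.lt_floor_add_one t⟩

/-- Continuous functions on consecutive intervals that agree at the common endpoints combine to a
continuous function, also in dependence on a parameter. -/
theorem exists_glue {X : Type*} [TopologicalSpace X] {x : ℤ → ℝ} (hx : StrictMono x)
    (hcov : ∀ t, ∃ k, t ∈ Set.Ico (x k) (x (k + 1))) (f : ℤ → X → ℝ → ℝ)
    (hf : ∀ k, Continuous (Function.uncurry (f k)))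
    (hm : ∀ k p, f k p (x (k + 1)) = f (k + 1) p (x (k + 1))) :
    ∃ g : X → ℝ → ℝ, Continuous (Function.uncurry g) ∧
      ∀ k p, ∀ t ∈ Set.Icc (x k) (x (k + 1)), g p t = f k p t := by
  choose κ hκ using hcov
  have key : ∀ k p, ∀ t ∈ Set.Icc (x k) (x (k + 1)), f (κ t) p t = f k p t := by
    intro k p t ht
    obtain ⟨h1, h2⟩ := hκ t
    have h3 : κ t < k + 2 := by
      by_contra h
      have h4 : x (k + 1) < x (κ t) := hx (by omega)
      linarith [ht.2]
    have h5 : k < κ t + 1 := hx.lt_iff_lt.1 (ht.1.trans_lt h2)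
    rcases (by omega : κ t = k ∨ κ t = k + 1) with h | h
    · rw [h]
    · rw [h] at h1 ⊢
      have : t = x (k + 1) := le_antisymm ht.2 h1
      rw [this, hm]
  refine ⟨fun p t => f (κ t) p t, ?_, key⟩
  let S : ℤ → Set (X × ℝ) := fun k => Prod.snd ⁻¹' Set.Icc (x k) (x (k + 1))
  have hS : LocallyFinite S := by
    apply LocallyFinite.preimage_continuous _ continuous_snd
    intro t
    obtain ⟨h1, h2⟩ := hκ t
    refine ⟨Set.Ioo (x (κ t - 1)) (x (κ t + 1)),
      Ioo_mem_nhds ((hx (by omega)).trans_le h1) h2,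
      (Set.finite_Icc (κ t - 1) (κ t + 1)).subset ?_⟩
    rintro k ⟨u, hu1, hu2⟩
    have h3 := hx.lt_iff_lt.1 (hu1.1.trans_lt hu2.2)
    have h4 := hx.lt_iff_lt.1 (hu2.1.trans_le hu1.2)
    constructor <;> omega
  refine hS.continuous ?_ (fun k => isClosed_Icc.preimage continuous_snd) ?_
  · ext p
    simp only [Set.mem_iUnion, Set.mem_univ, iff_true]
    exact ⟨κ p.2, Set.Ico_subset_Icc_self (hκ p.2)⟩
  · intro k
    exact (hf k).continuousOn.congr fun p hp => key k p.1 p.2 hp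

theorem strictMono_of_strictMonoOn_Icc {x : ℤ → ℝ} (hx : StrictMono x)
    (hcov : ∀ t, ∃ k, t ∈ Set.Ico (x k) (x (k + 1))) {g : ℝ → ℝ}
    (hg : ∀ k, StrictMonoOn g (Set.Icc (x k) (x (k + 1)))) : StrictMono g := by
  have hgx : StrictMono fun k => g (x k) := strictMono_int_of_lt_succ fun k =>
    hg k (Set.left_mem_Icc.2 (hx (by omega)).le) (Set.right_mem_Icc.2 (hx (by omega)).le)
      (hx (by omega))
  intro s t hst
  obtain ⟨k, hk⟩ := hcov s
  obtain ⟨l, hl⟩ := hcov t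
  have hkl : k < l + 1 := hx.lt_iff_lt.1 ((hk.1.trans hst.le).trans_lt hl.2)
  rcases (by omega : k = l ∨ k + 1 ≤ l) with rfl | h
  · exact hg k (Set.Ico_subset_Icc_self hk) (Set.Ico_subset_Icc_self hl) hst
  · calc g s < g (x (k + 1)) := hg k (Set.Ico_subset_Icc_self hk)
          (Set.right_mem_Icc.2 (hx (by omega)).le) hk.2
      _ ≤ g (x l) := hgx.monotone h
      _ ≤ g t := (hg l).monotoneOn (Set.left_mem_Icc.2 (hx (by omega)).le)
          (Set.Ico_subset_Icc_self hl) hl.1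

/-! ### Homeomorphisms of the plane that preserve the distance to the origin -/

theorem map_add_int_mul_two_pi {f : ℝ → ℝ} (hf : ∀ x, f (x + 2 * Real.pi) = f x + 2 * Real.pi)
    (x : ℝ) (k : ℤ) : f (x + k * (2 * Real.pi)) = f x + k * (2 * Real.pi) := by
  have hp : Function.Periodic (fun y => f y - y) (2 * Real.pi) := fun y => by
    simp only [hf]; ring
  have : f (x + k * (2 * Real.pi)) - (x + k * (2 * Real.pi)) = f x - x := hp.int_mul k x
  linarith

theorem exp_mul_I_eq_iff {x y : ℝ} : Complex.exp (x * Complex.I) = Complex.exp (y * Complex.I) ↔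
    ∃ k : ℤ, x = y + k * (2 * Real.pi) := by
  rw [Complex.exp_eq_exp_iff_exists_int]
  refine exists_congr fun k => ⟨fun hk => ?_, fun hk => ?_⟩
  · have : (x : ℂ) = y + k * (2 * Real.pi) := by
      apply mul_right_cancel₀ Complex.I_ne_zero
      rw [hk]; ring
    exact_mod_cast this
  · rw [hk]; push_cast; ring

/-- The self-map of the plane with `ρ * exp (i x) ↦ ρ * exp (i * L ρ x)`. -/
noncomputable def polarMap (L : ℝ → ℝ → ℝ) (z : ℂ) : ℂ :=
  ‖z‖ * Complex.exp (L ‖z‖ z.arg * Complex.I)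

theorem norm_polarMap (L : ℝ → ℝ → ℝ) (z : ℂ) : ‖polarMap L z‖ = ‖z‖ := by
  simp [polarMap, Complex.norm_exp_ofReal_mul_I]

theorem polarMap_polar {L : ℝ → ℝ → ℝ} (hL : ∀ ρ x, L ρ (x + 2 * Real.pi) = L ρ x + 2 * Real.pi)
    {ρ : ℝ} (hρ : 0 ≤ ρ) (x : ℝ) :
    polarMap L (ρ * Complex.exp (x * Complex.I)) = ρ * Complex.exp (L ρ x * Complex.I) := by
  have hn : ‖(ρ * Complex.exp (x * Complex.I) : ℂ)‖ = ρ := by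
    simp [Complex.norm_exp_ofReal_mul_I, abs_of_nonneg hρ]
  rcases hρ.eq_or_lt with rfl | hρ
  · simp [polarMap]
  rw [polarMap, hn]
  set z : ℂ := ρ * Complex.exp (x * Complex.I) with hz
  have h1 : (ρ : ℂ) * Complex.exp (z.arg * Complex.I) = ρ * Complex.exp (x * Complex.I) := by
    have := Complex.norm_mul_exp_arg_mul_I z
    rwa [hn] at this
  have h2 := mul_left_cancel₀ (by exact_mod_cast hρ.ne') h1
  obtain ⟨k, hk⟩ := exp_mul_I_eq_iff.1 h2
  rw [exp_mul_I_eq_iff.2 ⟨k, ?_⟩]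
  rw [hk, map_add_int_mul_two_pi (hL ρ)]

theorem continuous_polarMap {X : Type*} [TopologicalSpace X] {L : X → ℝ → ℝ → ℝ}
    (hc : Continuous fun p : X × ℝ × ℝ => L p.1 p.2.1 p.2.2)
    (hL : ∀ p ρ x, L p ρ (x + 2 * Real.pi) = L p ρ x + 2 * Real.pi) :
    Continuous fun p : X × ℂ => polarMap (L p.1) p.2 := by
  rw [continuous_iff_continuousAt]
  rintro ⟨p, z⟩
  have hslit : ∀ z : ℂ, z ∈ Complex.slitPlane →
      ContinuousAt (fun q : X × ℂ => polarMap (L q.1) q.2) (p, z) := by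
    intro z hz
    have harg : ContinuousAt (fun q : X × ℂ => q.2.arg) (p, z) :=
      ContinuousAt.comp (g := Complex.arg) (Complex.continuousAt_arg hz) continuousAt_snd
    have h1 : ContinuousAt (fun q : X × ℂ => L q.1 ‖q.2‖ q.2.arg) (p, z) :=
      hc.continuousAt.comp (f := fun q : X × ℂ => (q.1, ‖q.2‖, q.2.arg))
        (continuousAt_fst.prodMk ((continuous_norm.continuousAt.comp continuousAt_snd).prodMk
          harg))
    unfold polarMap
    have h2 : ContinuousAt (fun q : X × ℂ => Complex.exp (L q.1 ‖q.2‖ q.2.arg * Complex.I))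
        (p, z) := by fun_prop
    have h3 : ContinuousAt (fun q : X × ℂ => ((‖q.2‖ : ℝ) : ℂ)) (p, z) := by fun_prop
    exact h3.mul h2
  have hslit' : ∀ z : ℂ, -z ∈ Complex.slitPlane →
      ContinuousAt (fun q : X × ℂ => polarMap (L q.1) q.2) (p, z) := by
    intro z hz
    -- off the positive axis, the argument of `-z` serves
    have e : (fun q : X × ℂ => polarMap (L q.1) q.2) = fun q =>
        ‖q.2‖ * Complex.exp (L q.1 ‖q.2‖ ((-q.2).arg + Real.pi) * Complex.I) := by
      ext q
      rw [← polarMap_polar (hL q.1) (norm_nonneg _)]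
      congr 1
      have := Complex.norm_mul_exp_arg_mul_I (-q.2)
      push_cast
      rw [add_mul, Complex.exp_add, Complex.exp_pi_mul_I]
      rw [norm_neg] at this
      linear_combination this
    rw [e]
    have harg : ContinuousAt (fun q : X × ℂ => (-q.2).arg + Real.pi) (p, z) := by
      have : ContinuousAt (fun q : X × ℂ => -q.2) (p, z) := by fun_prop
      exact (ContinuousAt.comp (g := Complex.arg) (f := fun q : X × ℂ => -q.2)
        (Complex.continuousAt_arg hz) this).add continuousAt_const
    have h1 : ContinuousAt (fun q : X × ℂ => L q.1 ‖q.2‖ ((-q.2).arg + Real.pi)) (p, z) :=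
      hc.continuousAt.comp (f := fun q : X × ℂ => (q.1, ‖q.2‖, ((-q.2).arg + Real.pi)))
        (continuousAt_fst.prodMk ((continuous_norm.continuousAt.comp continuousAt_snd).prodMk
          harg))
    have h3 : ContinuousAt (fun q : X × ℂ => ((‖q.2‖ : ℝ) : ℂ)) (p, z) := by fun_prop
    have h2 : ContinuousAt (fun q : X × ℂ =>
        Complex.exp (L q.1 ‖q.2‖ ((-q.2).arg + Real.pi) * Complex.I)) (p, z) := by fun_prop
    exact h3.mul h2
  by_cases h0 : z = 0
  · subst h0
    have h1 : polarMap (L p) 0 = 0 := by simp [polarMap]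
    rw [ContinuousAt, h1, tendsto_zero_iff_norm_tendsto_zero]
    simp only [norm_polarMap]
    have : ContinuousAt (fun q : X × ℂ => ‖q.2‖) (p, 0) := by fun_prop
    simpa [ContinuousAt] using this
  · by_cases hz : z ∈ Complex.slitPlane
    · exact hslit z hz
    · refine hslit' z ?_
      rw [Complex.mem_slitPlane_iff] at hz ⊢
      push Not at hz
      left
      rw [Complex.neg_re, neg_pos]
      refine lt_of_le_of_ne hz.1 fun h => h0 (Complex.ext h hz.2)

/-- A continuous family of increasing reparametrizations of concentric circles is a homeomorphism
of the plane; it is isotopic to the identity because increasing functions form a convex set. -/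
theorem isotopicToId_polarMap {L : ℝ → ℝ → ℝ} (hc : Continuous (Function.uncurry L))
    (hmono : ∀ ρ, StrictMono (L ρ))
    (hL : ∀ ρ x, L ρ (x + 2 * Real.pi) = L ρ x + 2 * Real.pi) :
    IsotopicToId fun x => (polarMap L x.1, x.2) := by
  let E : unitInterval → ℝ → ℝ → ℝ := fun s ρ x => (1 - (s : ℝ)) * x + (s : ℝ) * L ρ x
  have hLc : Continuous fun p : ℝ × ℝ => L p.1 p.2 := hc
  have hEc : Continuous fun p : unitInterval × ℝ × ℝ => E p.1 p.2.1 p.2.2 := by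
    have : Continuous fun p : unitInterval × ℝ × ℝ => L p.2.1 p.2.2 := hLc.comp continuous_snd
    fun_prop
  have hE : ∀ s ρ x, E s ρ (x + 2 * Real.pi) = E s ρ x + 2 * Real.pi := fun s ρ x => by
    simp only [E, hL]; ring
  have hEm : ∀ s ρ, StrictMono (E s ρ) := by
    intro s ρ x y hxy
    have h0 := s.2.1
    have h1 := s.2.2
    have hy := hmono ρ hxy
    simp only [E]
    rcases h0.eq_or_lt with h | h
    · rw [← h]; linarith
    · nlinarith [mul_pos h (sub_pos.2 hy), mul_nonneg (sub_nonneg.2 h1) (sub_pos.2 hxy).le]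
  have hcont := continuous_polarMap hEc hE
  have := IsotopicToId.of_family (fun s x => (polarMap (E s) x.1, x.2))
    ((hcont.comp (continuous_fst.prodMk (continuous_fst.comp continuous_snd))).prodMk
      (continuous_snd.comp continuous_snd))
    (fun x => by
      ext1
      · simp [polarMap, E, Complex.norm_mul_exp_arg_mul_I]
      · rfl)
    (fun s => by
      refine exists_homeomorph_of_bijective ?_ ⟨?_, ?_⟩ 0 ?_
      · exact (hcont.comp (continuous_const.prodMk continuous_fst)).prodMk continuous_snd
      · rintro ⟨z, h⟩ ⟨w, h'⟩ hzw
        simp only [Prod.mk.injEq] at hzw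
        obtain ⟨h1, rfl⟩ := hzw
        have hn : ‖z‖ = ‖w‖ := by rw [← norm_polarMap (E s) z, h1, norm_polarMap]
        congr 1
        by_cases hz : ‖z‖ = 0
        · rw [norm_eq_zero.1 hz, norm_eq_zero.1 (hn.symm.trans hz)]
        simp only [polarMap, ← hn] at h1
        have h2 := mul_left_cancel₀ (by exact_mod_cast hz) h1
        obtain ⟨k, hk⟩ := exp_mul_I_eq_iff.1 h2
        rw [← map_add_int_mul_two_pi (hE s ‖z‖)] at hk
        have h5 := (hEm s ‖z‖).injective hk
        rw [← Complex.norm_mul_exp_arg_mul_I z, ← Complex.norm_mul_exp_arg_mul_I w, ← hn,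
          exp_mul_I_eq_iff.2 ⟨k, h5⟩]
      · rintro ⟨y, h⟩
        have hper := map_add_int_mul_two_pi (hE s ‖y‖)
        obtain ⟨x, hx⟩ : ∃ x, E s ‖y‖ x = y.arg := by
          set d := (y.arg - E s ‖y‖ 0) / (2 * Real.pi) with hd
          have hd' : y.arg = E s ‖y‖ 0 + d * (2 * Real.pi) := by
            rw [hd]; field_simp; ring
          have e1 := hper 0 ⌊d⌋
          have e2 := hper 0 (⌊d⌋ + 1)
          have hEc' : Continuous (E s ‖y‖) :=
            hEc.comp (f := fun x => (s, ‖y‖, x)) (by fun_prop)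
          have hpi := Real.two_pi_pos
          obtain ⟨x, -, hx⟩ := intermediate_value_Icc
            (show 0 + (⌊d⌋ : ℝ) * (2 * Real.pi) ≤ 0 + ((⌊d⌋ + 1 : ℤ) : ℝ) * (2 * Real.pi) by
              push_cast; nlinarith) hEc'.continuousOn
            (show y.arg ∈ Set.Icc _ _ by
              rw [e1, e2, hd']
              have := Int.floor_le d
              have := Int.lt_floor_add_one d
              push_cast
              constructor <;> nlinarith)
          exact ⟨x, hx⟩
        refine ⟨(‖y‖ * Complex.exp (x * Complex.I), h), ?_⟩
        simp only [polarMap_polar (hE s) (norm_nonneg _), hx, Complex.norm_mul_exp_arg_mul_I]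
      · intro x
        rw [add_zero, Prod.norm_def, Prod.norm_def, norm_polarMap])
  simpa [E] using this

/-! ### Polar knots -/

theorem exp_pi_mul_add_int (t : ℝ) (k : ℤ) :
    Complex.exp (((Real.pi * (t + k) : ℝ) : ℂ) * Complex.I)
      = (-1) ^ k * Complex.exp (((Real.pi * t : ℝ) : ℂ) * Complex.I) := by
  push_cast
  rw [mul_add, add_mul, Complex.exp_add, mul_comm]
  congr 1
  rw [← Complex.exp_pi_mul_I, ← Complex.exp_int_mul]
  ring_nf

theorem eq_add_int_mul_of_antiperiodic {r : ℝ → ℝ} (hr : ∀ t, r (t + 1) = -r t) (t : ℝ) (k : ℤ) :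
    r (t + k) = (-1) ^ k * r t := by
  induction k with
  | zero => simp
  | succ k ih =>
    push_cast at ih ⊢
    rw [← add_assoc, hr, ih, zpow_add₀ (by norm_num)]
    ring
  | pred k ih =>
    have h := hr (t + ((-(k : ℤ) - 1 : ℤ) : ℝ))
    have e : t + ((-(k : ℤ) - 1 : ℤ) : ℝ) + 1 = t + ((-(k : ℤ) : ℤ) : ℝ) := by push_cast; ring
    rw [e, ih] at h
    rw [zpow_sub₀ (by norm_num), zpow_one, div_neg, div_one, neg_mul, h, neg_neg]

/-- If `r` changes sign after one period, then a nonzero point of the polar curve `r` determines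
the time up to an integer, even up to real multiples. -/
theorem exists_int_of_polar_eq {a b s t : ℝ} (ha : a ≠ 0)
    (h : (a : ℂ) * Complex.exp (((Real.pi * s : ℝ) : ℂ) * Complex.I)
      = b * Complex.exp (((Real.pi * t : ℝ) : ℂ) * Complex.I)) : ∃ k : ℤ, t = s + k := by
  have h1 : (a : ℂ) = b * Complex.exp (((Real.pi * (t - s) : ℝ) : ℂ) * Complex.I) := by
    have e : (((Real.pi * (t - s) : ℝ) : ℂ) * Complex.I)
      = ((Real.pi * t : ℝ) : ℂ) * Complex.I - ((Real.pi * s : ℝ) : ℂ) * Complex.I := by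
      push_cast; ring
    rw [e, Complex.exp_sub, mul_div_assoc', ← h, mul_div_cancel_right₀ _ (Complex.exp_ne_zero _)]
  have h2 := congrArg Complex.im h1
  rw [Complex.ofReal_im, Complex.im_ofReal_mul, Complex.exp_ofReal_mul_I_im] at h2
  have hb : b ≠ 0 := by
    rintro rfl
    simp [ha] at h1
  obtain ⟨k, hk⟩ := Real.sin_eq_zero_iff.1 ((mul_eq_zero.1 h2.symm).resolve_left hb)
  refine ⟨k, ?_⟩
  have := mul_right_cancel₀ Real.pi_ne_zero (hk.trans (mul_comm _ _))
  linarith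

/-- The polar curve with the signed radius `r`, in which half a turn takes one unit of time. -/
noncomputable def polarCurve (r : ℝ → ℝ) (t : ℝ) : ℂ :=
  r t * Complex.exp (((Real.pi * t : ℝ) : ℂ) * Complex.I)

theorem norm_polarCurve (r : ℝ → ℝ) (t : ℝ) : ‖polarCurve r t‖ = |r t| := by
  rw [polarCurve, norm_mul, Complex.norm_exp_ofReal_mul_I, mul_one, Complex.norm_real,
    Real.norm_eq_abs]

theorem polarCurve_eq_zero_iff {r : ℝ → ℝ} {t : ℝ} : polarCurve r t = 0 ↔ r t = 0 := by
  rw [← norm_eq_zero, norm_polarCurve, abs_eq_zero]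

/-- The knot with projection `polarCurve r` and height `h`. -/
noncomputable def polarKnot (r h : ℝ → ℝ) (hrc : Continuous r) (hhc : Continuous h)
    (hr : ∀ t, r (t + 1) = -r t) (hh : ∀ t, h (t + 1) = h t)
    (hinj : ∀ s t, r s = 0 → r t = 0 → h s = h t → ∃ k : ℤ, t = s + k) : Knot where
  toFun t := (polarCurve r t, h t)
  continuous_toFun := by
    unfold polarCurve
    fun_prop
  periodic t := by
    have h1 := exp_pi_mul_add_int t 1
    rw [Int.cast_one] at h1
    rw [polarCurve, polarCurve, hr, hh, h1]
    simp
  injective s t hst := by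
    rw [Prod.mk.injEq] at hst
    by_cases h0 : r s = 0
    · refine hinj s t h0 ?_ hst.2
      rwa [← polarCurve_eq_zero_iff, ← hst.1, polarCurve_eq_zero_iff]
    · exact exists_int_of_polar_eq h0 hst.1

/-- A polar knot has a petal diagram if the zeros of the radius are simple.  The petals are not
nested, because the ray from a point of a petal away from the origin meets no other petal. -/
theorem exists_petalDiagram_polarKnot {r h : ℝ → ℝ} (hrc : Continuous r) (hhc : Continuous h)
    (hr : ∀ t, r (t + 1) = -r t) (hh : ∀ t, h (t + 1) = h t)
    (hinj : ∀ s t, r s = 0 → r t = 0 → h s = h t → ∃ k : ℤ, t = s + k) {n : ℕ}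
    {time : ℤ → ℝ} (htime : StrictMono time) (hper : ∀ k, time (k + (2 * n + 1)) = time k + 1)
    (hzero : ∀ t, r t = 0 ↔ ∃ k, t = time k) (hC : ∀ k, ContDiffAt ℝ 1 r (time k))
    (hderiv : ∀ k, ∃ d : ℝ, 0 < d ∧ HasDerivAt r (-((-1) ^ k * d)) (time k)) {label : ℤ → ℕ}
    (hlabel : ∀ j k, label j < label k ↔ h (time k) < h (time j)) :
    ∃ D : PetalDiagram (polarKnot r h hrc hhc hr hh hinj) n, D.label = label := by
  have hproj : (polarKnot r h hrc hhc hr hh hinj).proj = polarCurve r := rfl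
  have htp : ∀ (q k : ℤ), time (k + q * (2 * n + 1)) = time k + q := by
    intro q k
    have hp : Function.Periodic (fun q : ℤ => time (k + q * (2 * n + 1)) - q) 1 := fun q => by
      have := hper (k + q * (2 * n + 1))
      have e : k + (q + 1) * (2 * n + 1) = k + q * (2 * n + 1) + (2 * n + 1 : ℤ) := by ring
      simp only [e, this]
      push_cast
      ring
    have := hp.int_mul q 0
    simp only [mul_one, zero_add, zero_mul, Int.cast_zero, sub_zero, Int.cast_id, add_zero] at this
    linarith
  refine ⟨{ center := 0
            time := time
            time_strictMono := htime
            time_periodic := hper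
            proj_eq_center_iff := fun t => ?_
            proj_injective := fun s t hst h0 => ?_
            angle := fun k => Real.pi * time k + Real.pi
            angle_strictMono := fun j k hjk => ?_
            angle_periodic := fun k => ?_
            contDiffAt_proj := fun k => ?_
            hasDerivAt_proj := fun k => ?_
            not_nested := fun j k hjk t ht hb => ?_
            label := label
            label_lt_iff := hlabel }, rfl⟩
  · rw [hproj, polarCurve_eq_zero_iff, hzero]
  · rw [hproj] at hst h0
    exact exists_int_of_polar_eq (mt polarCurve_eq_zero_iff.2 h0) hst
  · have := htime hjk
    have := Real.pi_pos
    simp only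
    gcongr
  · rw [hper]; ring
  · rw [hproj]
    have := hC k
    have h1 : ContDiffAt ℝ 1 (fun t => ((r t : ℝ) : ℂ)) (time k) :=
      Complex.ofRealCLM.contDiff.contDiffAt.comp (time k) this
    have h2 : ContDiff ℝ 1 (fun t : ℝ => ((Real.pi * t : ℝ) : ℂ) * Complex.I) :=
      (Complex.ofRealCLM.contDiff.comp (contDiff_const.mul contDiff_id)).mul contDiff_const
    exact h1.mul h2.cexp.contDiffAt
  · obtain ⟨d, hd, hder⟩ := hderiv k
    refine ⟨d, hd, ?_⟩
    rw [hproj]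
    have hz : r (time k) = 0 := (hzero _).2 ⟨k, rfl⟩
    have h1 : HasDerivAt (fun t : ℝ => ((Real.pi * t : ℝ) : ℂ) * Complex.I)
        ((Real.pi : ℂ) * Complex.I) (time k) := by
      have := ((hasDerivAt_id (time k)).const_mul Real.pi).ofReal_comp.mul_const Complex.I
      simpa using this
    have h2 := hder.ofReal_comp.mul h1.cexp
    refine HasDerivAt.congr_deriv h2 ?_
    rw [hz]
    push_cast
    rw [add_mul _ _ Complex.I, Complex.exp_add, Complex.exp_pi_mul_I]
    ring
  · rw [hproj] at hb
    have ht0 : r t ≠ 0 := by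
      intro h0
      obtain ⟨i, rfl⟩ := (hzero t).1 h0
      have h1 := htime.lt_iff_lt.1 ht.1
      have h2 := htime.lt_iff_lt.1 ht.2
      omega
    have hp0 : polarCurve r t ≠ 0 := mt polarCurve_eq_zero_iff.1 ht0
    let ray : Set ℂ := (fun l : ℝ => (l : ℂ) * polarCurve r t) '' Set.Ici 1
    have hray : IsPreconnected ray :=
      isPreconnected_Ici.image _ (by fun_prop)
    have hsub : ray ⊆ (polarCurve r '' Set.Icc (time j) (time (j + 1)))ᶜ := by
      rintro _ ⟨l, hl, rfl⟩ ⟨s, hs, hst⟩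
      have hl0 : l * r t ≠ 0 :=
        mul_ne_zero (zero_lt_one.trans_le hl).ne' ht0
      obtain ⟨q, hq⟩ := exists_int_of_polar_eq (b := r s) (t := s) hl0
        (by simp only [polarCurve] at hst; rw [hst]; push_cast; ring)
      have e1 := htp q k
      have e2 := htp q (k + 1)
      rw [hq] at hs
      have h1 : time (k + q * (2 * n + 1)) < time (j + 1) := by
        rw [e1]; linarith [ht.1, hs.2]
      have h2 : time j < time (k + 1 + q * (2 * n + 1)) := by
        rw [e2]; linarith [ht.2, hs.1]
      have h3 := htime.lt_iff_lt.1 h1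
      have h4 := htime.lt_iff_lt.1 h2
      have h5 : j = k + q * (2 * n + 1) := by omega
      apply hjk
      rw [h5]
      exact (Int.modEq_iff_dvd.2 ⟨-q, by ring⟩)
    have hmem : polarCurve r t ∈ ray := ⟨1, Set.self_mem_Ici, by simp⟩
    have hbd := hb.subset (hray.subset_connectedComponentIn hmem hsub)
    obtain ⟨C, hC⟩ := hbd.exists_norm_le
    have hpos := norm_pos_iff.2 hp0
    have h1 := hC _ ⟨max 1 ((|C| + 1) / ‖polarCurve r t‖), Set.mem_Ici.2 (le_max_left _ _), rfl⟩
    rw [norm_mul, Complex.norm_real, Real.norm_eq_abs] at h1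
    have h2 : |C| + 1 ≤ |max 1 ((|C| + 1) / ‖polarCurve r t‖)| * ‖polarCurve r t‖ := by
      rw [← div_le_iff₀ hpos]
      exact (le_max_right _ _).trans (le_abs_self _)
    linarith [le_abs_self C]

/-! ### Straightening one petal -/

/-- The piecewise linear function that rises from `0` at `a` to `1` at `b`. -/
noncomputable def ramp (a b t : ℝ) : ℝ := max 0 (min 1 ((t - a) / (b - a)))

theorem continuous_ramp (a b : ℝ) : Continuous (ramp a b) := by
  unfold ramp
  fun_prop

theorem ramp_of_le {a b t : ℝ} (hab : a < b) (ht : t ≤ a) : ramp a b t = 0 := by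
  have h1 : (t - a) / (b - a) ≤ 0 := div_nonpos_of_nonpos_of_nonneg (by linarith) (by linarith)
  rw [ramp, min_eq_right (by linarith), max_eq_left h1]

theorem ramp_of_ge {a b t : ℝ} (hab : a < b) (ht : b ≤ t) : ramp a b t = 1 := by
  have h1 : 1 ≤ (t - a) / (b - a) := by rw [le_div_iff₀ (by linarith)]; linarith
  rw [ramp, min_eq_left h1, max_eq_right zero_le_one]

theorem ramp_of_mem {a b t : ℝ} (hab : a < b) (ht : t ∈ Set.Icc a b) :
    ramp a b t = (t - a) / (b - a) := by
  have h1 : (t - a) / (b - a) ≤ 1 := by rw [div_le_iff₀ (by linarith)]; linarith [ht.2]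
  have h2 : 0 ≤ (t - a) / (b - a) := div_nonneg (by linarith [ht.1]) (by linarith)
  rw [ramp, min_eq_right h1, max_eq_right h2]

theorem ramp_nonneg (a b t : ℝ) : 0 ≤ ramp a b t := le_max_left _ _

theorem ramp_le_one (a b t : ℝ) : ramp a b t ≤ 1 := max_le zero_le_one (min_le_left _ _)

theorem Knot.apply_fract (K : Knot) (t : ℝ) : K (Int.fract t) = K t := by
  have := K.periodic_int (Int.fract t) ⌊t⌋
  rw [Int.fract_add_floor] at this
  exact this.symm

/-- The heights of a straightened petal: it rises from the height `y` to the height `M + 1`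
between the times `a` and `a'`, on to its top at the time `c`, and comes down in the same way. -/
noncomputable def tentHeight (a a' c b' b y M y' t : ℝ) : ℝ :=
  y + (M + 1 - y) * ramp a a' t + ramp a' c t - ramp c b' t - (M + 1 - y') * ramp b' b t

/-- Replacing the part of a knot between the times `a` and `b`, whose projection is simple and
disjoint from the rest, by a standard path.  The part is first lifted above the rest of the knot,
so that each level above the rest contains two points of it, which move apart from their common
top.  The complex affine maps that bring these two points to `p` and `q` straighten the part; the
top itself is straight because `K` is straight between the times `c₀` and `b'`, and there the
affine map is kept constant. -/
theorem Knot.exists_straighten (K : Knot) {a a' c₀ b' b M : ℝ} (h0 : 0 ≤ a) (h1 : a < a')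
    (h2 : a' < c₀) (h3 : c₀ < b') (h4 : b' < b) (h5 : b ≤ 1)
    (hinj : ∀ t ∈ Set.Ioo a b, ∀ s ∈ Set.Icc (0 : ℝ) 1, (K s).1 = (K t).1 → s = t)
    (hstr : ∀ t ∈ Set.Icc c₀ b',
      (K t).1 = (K c₀).1 + ((t - c₀) / (b' - c₀) : ℝ) * ((K b').1 - (K c₀).1))
    (hM : ∀ t, (K t).2 ≤ M) {p q : ℂ} (hp : (K a').1 = p) (hq : (K b').1 = q) {c d : ℝ}
    (hc : c = (c₀ + b') / 2) (hd : d = b' - (c₀ - a') / (c - a') * (b' - c)) :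
    ∃ K' : Knot, K.Isotopic K' ∧ (∀ t ∈ Set.Icc (0 : ℝ) 1, t ∉ Set.Icc a b → K' t = K t) ∧
      (∀ t, t ∈ Set.Icc a a' ∨ t ∈ Set.Icc b' b →
        K' t = ((K t).1, tentHeight a a' c b' b (K a).2 M (K b).2 t)) ∧
      (∀ t ∈ Set.Icc a' b',
        K' t = (p + (ramp c₀ d t : ℝ) * (q - p), tentHeight a a' c b' b (K a).2 M (K b).2 t)) := by
  set η := tentHeight a a' c b' b (K a).2 M (K b).2 with hη
  have hKc : Continuous fun t => K t := K.continuous_toFun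
  have hc1 : c₀ < c := by linarith
  have hc2 : c < b' := by linarith
  have hηc : Continuous η := by
    have := continuous_ramp
    rw [hη]
    unfold tentHeight
    exact ((((continuous_const.add (continuous_const.mul (this _ _))).add (this _ _)).sub
      (this _ _)).sub (continuous_const.mul (this _ _)))
  -- the values of the height function on the four intervals
  have hη1 : ∀ t ≤ a', η t = (K a).2 + (M + 1 - (K a).2) * ramp a a' t := fun t ht => by
    rw [hη, tentHeight, ramp_of_le (b := c) (by linarith) ht, ramp_of_le hc2 (by linarith),
      ramp_of_le h4 (by linarith)]
    ring
  have hη2 : ∀ t ∈ Set.Icc a' c, η t = M + 1 + (t - a') / (c - a') := fun t ht => by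
    rw [hη, tentHeight, ramp_of_ge h1 ht.1, ramp_of_mem (by linarith) ht, ramp_of_le hc2 ht.2,
      ramp_of_le h4 (by linarith [ht.2])]
    ring
  have hη3 : ∀ t ∈ Set.Icc c b', η t = M + 1 + (b' - t) / (b' - c) := fun t ht => by
    rw [hη, tentHeight, ramp_of_ge h1 (by linarith [ht.1]), ramp_of_ge (by linarith) ht.1,
      ramp_of_mem hc2 ht, ramp_of_le h4 ht.2]
    field_simp [show b' - c ≠ 0 by linarith]
    ring
  have hη4 : ∀ t, b' ≤ t → η t = M + 1 - (M + 1 - (K b).2) * ramp b' b t := fun t ht => by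
    rw [hη, tentHeight, ramp_of_ge h1 (by linarith), ramp_of_ge (by linarith) (by linarith),
      ramp_of_ge hc2 ht]
    ring
  have hηa : η a = (K a).2 := by rw [hη1 _ h1.le, ramp_of_le h1 le_rfl]; ring
  have hηb : η b = (K b).2 := by rw [hη4 _ h4.le, ramp_of_ge h4 le_rfl]; ring
  -- the lift
  let e₀ : ℝ → ℝ := fun t => η (max a (min b t)) - (K (max a (min b t))).2
  have he₀c : Continuous e₀ := by
    have : Continuous fun t => max a (min b t) := by fun_prop
    exact (hηc.comp this).sub (continuous_snd.comp (hKc.comp this))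
  have hab : a < b := by linarith
  have he₀1 : ∀ t ≤ a, e₀ t = 0 := fun t ht => by
    simp only [e₀]
    rw [min_eq_right (by linarith), max_eq_left ht, hηa, sub_self]
  have he₀2 : ∀ t, b ≤ t → e₀ t = 0 := fun t ht => by
    simp only [e₀]
    rw [min_eq_left ht, max_eq_right hab.le, hηb, sub_self]
  have he₀3 : ∀ t ∈ Set.Icc a b, e₀ t = η t - (K t).2 := fun t ht => by
    simp only [e₀]
    rw [min_eq_right ht.2, max_eq_right ht.1]
  have hfr : ∀ t : ℝ, Int.fract t ∈ Set.Icc (0 : ℝ) 1 := fun t =>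
    ⟨Int.fract_nonneg t, (Int.fract_lt_one t).le⟩
  obtain ⟨K₁, hK₁, hK₁t⟩ := K.exists_shear (d := fun t => e₀ (Int.fract t))
    (ContinuousOn.comp_fract'' he₀c.continuousOn (by rw [he₀1 _ h0, he₀2 _ h5]))
    (fun s t hst => by
      rw [← K.apply_fract s, ← K.apply_fract t] at hst
      by_cases hs : Int.fract s ∈ Set.Ioo a b
      · rw [hinj _ hs _ (hfr t) hst.symm]
      by_cases ht : Int.fract t ∈ Set.Ioo a b
      · rw [hinj _ ht _ (hfr s) hst]
      have hz : ∀ u, u ∉ Set.Ioo a b → e₀ u = 0 := fun u hu => by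
        rcases le_or_gt u a with h | h
        · exact he₀1 _ h
        · exact he₀2 _ (not_lt.1 fun h' => hu ⟨h, h'⟩)
      rw [hz _ hs, hz _ ht])
  have hK₁t' : ∀ t ∈ Set.Icc (0 : ℝ) 1, K₁ t = ((K t).1, (K t).2 + e₀ t) := by
    intro t ht
    rw [hK₁t]
    rcases ht.2.eq_or_lt with rfl | h
    · rw [Int.fract_one, he₀1 _ h0, he₀2 _ h5]
    · rw [Int.fract_eq_self.2 ⟨ht.1, h⟩]
  have hI : ∀ t ∈ Set.Icc a b, t ∈ Set.Icc (0 : ℝ) 1 := fun t ht =>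
    ⟨h0.trans ht.1, ht.2.trans h5⟩
  have hK₁in : ∀ t ∈ Set.Icc a b, K₁ t = ((K t).1, η t) := fun t ht => by
    rw [hK₁t' t (hI t ht), he₀3 t ht, add_sub_cancel]
  have hK₁out : ∀ t ∈ Set.Icc (0 : ℝ) 1, t ∉ Set.Icc a b → K₁ t = K t := fun t ht ht' => by
    have : e₀ t = 0 := by
      rcases le_or_gt t a with h | h
      · exact he₀1 _ h
      · exact he₀2 _ (le_of_not_ge fun h' => ht' ⟨h.le, h'⟩)
    rw [hK₁t' t ht, this, add_zero]
  -- the two points of the lifted part at the level `M + 1 + s`, for `s ≤ s₁`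
  set s₁ := (c₀ - a') / (c - a') with hs₁
  have hca : 0 < c - a' := by linarith
  have hbc : 0 < b' - c := by linarith
  have hs₁0 : 0 < s₁ := div_pos (by linarith) hca
  have hs₁1 : s₁ < 1 := by rw [hs₁, div_lt_one hca]; linarith
  let lev : ℝ → ℝ := fun x => max 0 (min s₁ (x - (M + 1)))
  have hlev0 : ∀ x, 0 ≤ lev x := fun x => le_max_left _ _
  have hlev1 : ∀ x, lev x ≤ s₁ := fun x => max_le hs₁0.le (min_le_left _ _)
  have hlevc : Continuous lev := by fun_prop
  let P : ℝ → ℂ := fun x => (K (a' + lev x * (c - a'))).1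
  let Q : ℝ → ℂ := fun x => (K (b' - lev x * (b' - c))).1
  have hPc : Continuous P := by fun_prop
  have hQc : Continuous Q := by fun_prop
  have hPQ : ∀ x, Q x - P x ≠ 0 := by
    intro x h
    have hl0 := hlev0 x
    have hl1 := hlev1 x
    have i1 : a' + lev x * (c - a') < c := by nlinarith
    have i2 : c < b' - lev x * (b' - c) := by nlinarith
    have i3 : 0 ≤ lev x * (c - a') := by positivity
    have i4 : 0 ≤ lev x * (b' - c) := by positivity
    have := hinj (b' - lev x * (b' - c)) ⟨by linarith, by linarith⟩ (a' + lev x * (c - a'))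
      ⟨by linarith, by linarith⟩ (sub_eq_zero.1 h).symm
    linarith
  have hpq : q - p ≠ 0 := by
    have := hPQ (M + 1)
    simpa [P, Q, lev, hs₁0.le, hp, hq] using this
  let A : ℝ → ℂ := fun x => (q - p) / (Q x - P x)
  let B : ℝ → ℂ := fun x => p - A x * P x
  have hAc : Continuous A := continuous_const.div (hQc.sub hPc) hPQ
  have hBc : Continuous B := continuous_const.sub (hAc.mul hPc)
  have hlow : ∀ x ≤ M + 1, A x = 1 ∧ B x = 0 := by
    intro x hx
    have : lev x = 0 := by
      simp only [lev]
      rw [min_eq_right (by linarith), max_eq_left (by linarith)]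
    have hP : P x = p := by simp only [P, this, zero_mul, add_zero, hp]
    have hQ : Q x = q := by simp only [Q, this, zero_mul, sub_zero, hq]
    have hA : A x = 1 := by simp only [A, hP, hQ, div_self hpq]
    exact ⟨hA, by simp only [B, hA, hP]; ring⟩
  have hhigh : ∀ x, M + 1 + s₁ ≤ x → A x = A (M + 1 + s₁) ∧ B x = B (M + 1 + s₁) := by
    intro x hx
    have : ∀ x, M + 1 + s₁ ≤ x → lev x = s₁ := fun x hx => by
      simp only [lev]
      rw [min_eq_left (by linarith), max_eq_right hs₁0.le]
    simp only [A, B, P, Q, this x hx, this _ le_rfl, and_self]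
  obtain ⟨K₂, hK₂, hK₂t⟩ := K₁.exists_map (isotopicToId_levelAffine hAc hBc
    (fun x => div_ne_zero hpq (hPQ x)) (M + 1) (M + 1 + s₁) hlow hhigh)
  have hfix : ∀ t, (K₁ t).2 ≤ M + 1 → K₂ t = K₁ t := fun t ht => by
    rw [hK₂t, (hlow _ ht).1, (hlow _ ht).2, one_mul, add_zero]
  refine ⟨K₂, hK₁.trans hK₂, fun t ht ht' => ?_, fun t ht => ?_, fun t ht => ?_⟩
  · have e := hK₁out t ht ht'
    rw [hfix, e]
    rw [e]
    linarith [hM t]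
  · have htab : t ∈ Set.Icc a b := by
      rcases ht with ht | ht
      · exact ⟨ht.1, by linarith [ht.2]⟩
      · exact ⟨by linarith [ht.1], ht.2⟩
    have e := hK₁in t htab
    rw [hfix, e]
    rw [e]
    simp only
    rcases ht with ht | ht
    · rw [hη1 t ht.2]
      nlinarith [ramp_nonneg a a' t, ramp_le_one a a' t, hM a]
    · rw [hη4 t ht.1]
      nlinarith [ramp_nonneg b' b t, ramp_le_one b' b t, hM b]
  · have e := hK₁in t ⟨by linarith [ht.1], by linarith [ht.2]⟩
    rw [hK₂t, e]
    ext1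
    swap
    · rfl
    simp only
    have hd1 : c < d := by rw [hd]; nlinarith
    have hd2 : d < b' := by rw [hd]; nlinarith
    have hAB : ∀ x z, A x * z + B x = p + (z - P x) / (Q x - P x) * (q - p) := fun x z => by
      simp only [B, A]
      field_simp [hPQ x]
      ring
    rw [hAB]
    congr 2
    rcases le_total t c₀ with ht1 | ht1
    · -- the left point of its level
      have hl : lev (η t) = (t - a') / (c - a') := by
        have i1 : (t - a') / (c - a') ≤ s₁ := by rw [hs₁]; gcongr
        have i2 : 0 ≤ (t - a') / (c - a') := div_nonneg (by linarith [ht.1]) hca.le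
        simp only [lev]
        rw [hη2 t ⟨ht.1, by linarith⟩, add_sub_cancel_left, min_eq_right i1, max_eq_right i2]
      have hP : P (η t) = (K t).1 := by
        simp only [P, hl, div_mul_cancel₀ _ hca.ne', add_sub_cancel]
      rw [hP, sub_self, zero_div, ramp_of_le (hc1.trans hd1) ht1, Complex.ofReal_zero]
    rcases le_total d t with ht2 | ht2
    · -- the right point of its level
      have hl : lev (η t) = (b' - t) / (b' - c) := by
        have i1 : (b' - t) / (b' - c) ≤ s₁ := by
          rw [div_le_iff₀ hbc]; linarith
        have i2 : 0 ≤ (b' - t) / (b' - c) := div_nonneg (by linarith [ht.2]) hbc.le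
        simp only [lev]
        rw [hη3 t ⟨by linarith, ht.2⟩, add_sub_cancel_left, min_eq_right i1, max_eq_right i2]
      have hQ : Q (η t) = (K t).1 := by
        simp only [Q, hl, div_mul_cancel₀ _ hbc.ne', sub_sub_cancel]
      have := hPQ (η t)
      rw [hQ] at this ⊢
      rw [div_self this, ramp_of_ge (hc1.trans hd1) ht2, Complex.ofReal_one]
    · -- the straight top
      have hl : lev (η t) = s₁ := by
        have : M + 1 + s₁ ≤ η t := by
          rcases le_total t c with h | h
          · rw [hη2 t ⟨ht.1, h⟩, hs₁]
            gcongr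
          · rw [hη3 t ⟨h, ht.2⟩]
            gcongr
            rw [le_div_iff₀ hbc]
            linarith
        simp only [lev]
        rw [min_eq_left (by linarith), max_eq_right hs₁0.le]
      have hP : P (η t) = (K c₀).1 := by
        simp only [P, hl, hs₁, div_mul_cancel₀ _ hca.ne', add_sub_cancel]
      have hQ : Q (η t) = (K d).1 := by
        simp only [Q, hl, ← hd]
      have hne := hPQ (η t)
      rw [hP, hQ, hstr d ⟨by linarith, by linarith⟩] at hne ⊢
      rw [hstr t ⟨ht1, by linarith⟩, ramp_of_mem (hc1.trans hd1) ⟨ht1, ht2⟩]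
      rw [add_sub_cancel_left] at hne ⊢
      rw [add_sub_cancel_left]
      have n1 := right_ne_zero_of_mul hne
      have n2 : ((b' - c₀ : ℝ) : ℂ) ≠ 0 := by
        exact_mod_cast (by linarith : b' - c₀ ≠ 0)
      have n3 : ((d - c₀ : ℝ) : ℂ) ≠ 0 := by
        have : 0 < d - c₀ := by linarith
        exact_mod_cast this.ne'
      rw [mul_div_mul_right _ _ n1]
      rw [Complex.ofReal_div, Complex.ofReal_div, Complex.ofReal_div,
        div_div_div_cancel_right₀ n2]

/-! ### Normal knots -/

/-- The time at which a normal knot with `N` petals leaves the disc of radius `r` at the beginning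
of petal `k`. -/
noncomputable def outTime (N k r : ℝ) : ℝ := (k + r / 4) / N

/-- The time at which a normal knot with `N` petals enters the disc of radius `r` at the end of
petal `k`. -/
noncomputable def inTime (N k r : ℝ) : ℝ := (k + 1 - r / 4) / N

/-- A knot is normal with `N` petals if its projection passes the origin at the multiples of
`1 / N`, runs along radii of the unit disc with constant speed for a quarter of the time before and
after that, and is simple otherwise. -/
structure Knot.IsNormal (K : Knot) (N : ℕ) : Prop where
  out_ray : ∀ (k : ℤ), ∀ r ∈ Set.Icc (0 : ℝ) 1,
    (K (outTime N k r)).1 = r * (K (outTime N k 1)).1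
  in_ray : ∀ (k : ℤ), ∀ r ∈ Set.Icc (0 : ℝ) 1, (K (inTime N k r)).1 = r * (K (inTime N k 1)).1
  norm_out : ∀ k : ℤ, ‖(K (outTime N k 1)).1‖ = 1
  norm_in : ∀ k : ℤ, ‖(K (inTime N k 1)).1‖ = 1
  outside : ∀ (k : ℤ), ∀ t ∈ Set.Ioo (outTime N k 1) (inTime N k 1), 1 < ‖(K t).1‖
  injective_proj : ∀ s t, (K s).1 = (K t).1 → (K s).1 ≠ 0 → ∃ k : ℤ, t = s + k

theorem Knot.ext_of_Icc {K K' : Knot} (h : ∀ t ∈ Set.Icc (0 : ℝ) 1, K t = K' t) : K = K' := by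
  have : K.toFun = K'.toFun := by
    ext1 t
    rw [← K.apply_fract, ← K'.apply_fract]
    exact h _ ⟨Int.fract_nonneg t, (Int.fract_lt_one t).le⟩
  cases K
  cases K'
  congr

section times

variable {N : ℕ}

theorem outTime_lt_outTime (hN : 0 < N) (k : ℝ) {r r' : ℝ} (h : r < r') :
    outTime N k r < outTime N k r' := by
  have : (0 : ℝ) < N := by exact_mod_cast hN
  unfold outTime
  gcongr

theorem inTime_lt_inTime (hN : 0 < N) (k : ℝ) {r r' : ℝ} (h : r < r') :
    inTime N k r' < inTime N k r := by
  have : (0 : ℝ) < N := by exact_mod_cast hN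
  unfold inTime
  gcongr

theorem outTime_lt_inTime (hN : 0 < N) (k : ℝ) {r r' : ℝ} (h : r ≤ 1) (h' : r' ≤ 1) :
    outTime N k r < inTime N k r' := by
  have : (0 : ℝ) < N := by exact_mod_cast hN
  unfold outTime inTime
  gcongr
  linarith

theorem inTime_le_outTime (hN : 0 < N) {j k : ℝ} (hjk : j + 1 ≤ k) {r r' : ℝ} (h : 0 ≤ r)
    (h' : 0 ≤ r') : inTime N j r ≤ outTime N k r' := by
  have : (0 : ℝ) < N := by exact_mod_cast hN
  unfold outTime inTime
  gcongr
  linarith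

theorem outTime_pos (hN : 0 < N) (k : ℕ) {r : ℝ} (h : 0 < r) : 0 < outTime N k r := by
  have : (0 : ℝ) < N := by exact_mod_cast hN
  unfold outTime
  positivity

theorem inTime_lt_one {k : ℕ} (hk : k < N) {r : ℝ} (h : 0 < r) : inTime N k r < 1 := by
  have h1 : (0 : ℝ) < N := by exact_mod_cast (by omega : 0 < N)
  have h2 : (k + 1 : ℝ) ≤ N := by exact_mod_cast hk
  unfold inTime
  rw [div_lt_one h1]
  linarith

theorem exists_eq_outTime (hN : 0 < N) (k : ℝ) {r r' t : ℝ}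
    (ht : t ∈ Set.Icc (outTime N k r) (outTime N k r')) :
    ∃ u ∈ Set.Icc r r', t = outTime N k u := by
  have h1 : (0 : ℝ) < N := by exact_mod_cast hN
  unfold outTime at *
  obtain ⟨h2, h3⟩ := ht
  rw [div_le_iff₀ h1] at h2
  rw [le_div_iff₀ h1] at h3
  refine ⟨4 * (t * N - k), ⟨by linarith, by linarith⟩, ?_⟩
  field_simp
  ring

theorem exists_eq_inTime (hN : 0 < N) (k : ℝ) {r r' t : ℝ}
    (ht : t ∈ Set.Icc (inTime N k r') (inTime N k r)) :
    ∃ u ∈ Set.Icc r r', t = inTime N k u := by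
  have h1 : (0 : ℝ) < N := by exact_mod_cast hN
  unfold inTime at *
  obtain ⟨h2, h3⟩ := ht
  rw [div_le_iff₀ h1] at h2
  rw [le_div_iff₀ h1] at h3
  refine ⟨4 * (k + 1 - t * N), ⟨by linarith, by linarith⟩, ?_⟩
  field_simp
  ring

/-- A time that lies in no petal belongs to one of the radii. -/
theorem exists_radius (hN : 0 < N) {t r : ℝ} (ht : t ∈ Set.Icc (0 : ℝ) 1)
    (h : ∀ k < N, t ∉ Set.Ioo (outTime N k r) (inTime N k r)) :
    ∃ k < N, ∃ u ∈ Set.Icc 0 r, t = outTime N k u ∨ t = inTime N k u := by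
  have h1 : (0 : ℝ) < N := by exact_mod_cast hN
  obtain ⟨k, hk, hk1, hk2⟩ : ∃ k < N, (k : ℝ) ≤ t * N ∧ t * N ≤ k + 1 := by
    rcases ht.2.eq_or_lt with rfl | h'
    · refine ⟨N - 1, by omega, ?_⟩
      rw [Nat.cast_sub hN]
      push_cast
      constructor <;> linarith
    · have h0 : 0 ≤ t * N := mul_nonneg ht.1 h1.le
      refine ⟨⌊t * N⌋₊, ?_, Nat.floor_le h0, (Nat.lt_floor_add_one _).le⟩
      rw [Nat.floor_lt h0]
      nlinarith
  refine ⟨k, hk, ?_⟩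
  have e1 : outTime N k 0 ≤ t := by unfold outTime; rw [div_le_iff₀ h1]; linarith
  have e2 : t ≤ inTime N k 0 := by unfold inTime; rw [le_div_iff₀ h1]; linarith
  rcases le_or_gt t (outTime N k r) with h2 | h2
  · obtain ⟨u, hu, rfl⟩ := exists_eq_outTime hN k ⟨e1, h2⟩
    exact ⟨u, hu, Or.inl rfl⟩
  · obtain ⟨u, hu, rfl⟩ := exists_eq_inTime hN k ⟨le_of_not_gt fun h3 => h k hk ⟨h2, h3⟩, e2⟩
    exact ⟨u, hu, Or.inr rfl⟩

end times

theorem Knot.exists_height_le (K : Knot) : ∃ M, ∀ t, (K t).2 ≤ M := by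
  have hc : Continuous fun t => (K t).2 := continuous_snd.comp K.continuous_toFun
  obtain ⟨M, hM⟩ := (isCompact_Icc (a := (0 : ℝ)) (b := 1)).exists_bound_of_continuousOn
    hc.continuousOn
  refine ⟨M, fun t => ?_⟩
  rw [← K.apply_fract]
  exact (le_abs_self _).trans (hM _ ⟨Int.fract_nonneg t, (Int.fract_lt_one t).le⟩)

/-- `L` is obtained from the normal knot `K` by replacing its first `j` petals by arcs over the
disc of radius `r`. -/
structure Knot.IsPartlyStraight (L K : Knot) (N j : ℕ) (r : ℝ) : Prop where
  isotopic : K.Isotopic L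
  eq_of_mem : ∀ k, j ≤ k → k < N → ∀ t ∈ Set.Icc (outTime N k r) (inTime N k r), L t = K t
  norm_le : ∀ t ∈ Set.Icc (0 : ℝ) 1,
    (∀ k, j ≤ k → k < N → t ∉ Set.Ioo (outTime N k r) (inTime N k r)) → ‖(L t).1‖ ≤ r

/-- The projection of a normal knot at a time in a petal lies outside the disc of radius `r`. -/
theorem Knot.IsNormal.lt_norm {K : Knot} {N : ℕ} (hK : K.IsNormal N) (hN : 0 < N) (k : ℕ) {r : ℝ}
    (hr0 : 0 < r) (hr : r < 1) {t : ℝ} (ht : t ∈ Set.Ioo (outTime N k r) (inTime N k r)) :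
    r < ‖(K t).1‖ := by
  rcases le_or_gt t (outTime N k 1) with h1 | h1
  · obtain ⟨u, hu, rfl⟩ := exists_eq_outTime hN k ⟨ht.1.le, h1⟩
    have hu' : r < u := by
      refine lt_of_le_of_ne hu.1 ?_
      rintro rfl
      exact lt_irrefl _ ht.1
    have e1 := hK.out_ray k u ⟨by linarith, hu.2⟩
    have e2 := hK.norm_out k
    push_cast at e1 e2
    rw [e1, norm_mul, e2, mul_one, Complex.norm_real]
    exact hu'.trans_le (le_abs_self _)
  rcases le_or_gt (inTime N k 1) t with h2 | h2
  · obtain ⟨u, hu, rfl⟩ := exists_eq_inTime hN k ⟨h2, ht.2.le⟩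
    have hu' : r < u := by
      refine lt_of_le_of_ne hu.1 ?_
      rintro rfl
      exact lt_irrefl _ ht.2
    have e1 := hK.in_ray k u ⟨by linarith, hu.2⟩
    have e2 := hK.norm_in k
    push_cast at e1 e2
    rw [e1, norm_mul, e2, mul_one, Complex.norm_real]
    exact hu'.trans_le (le_abs_self _)
  · exact hr.trans (hK.outside k t (by push_cast; exact ⟨h1, h2⟩))

/-- Straightening the next petal.  The result on this petal depends only on the data listed as
hypotheses, which are the same for two knots that agree on the radii. -/
theorem Knot.IsPartlyStraight.exists_step {L K : Knot} {N j : ℕ} {r r' : ℝ}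
    (hL : L.IsPartlyStraight K N j r) (hK : K.IsNormal N) (hj : j < N) (hr : 0 < r) (hrr : r < r')
    (hr' : r' < 1) {M : ℝ} (hM : ∀ t, (L t).2 ≤ M) {a a' c₀ b' b c d : ℝ}
    (ha : a = outTime N j r) (ha' : a' = outTime N j r') (hc₀ : c₀ = inTime N j 1)
    (hb' : b' = inTime N j r') (hb : b = inTime N j r) (hc : c = (c₀ + b') / 2)
    (hd : d = b' - (c₀ - a') / (c - a') * (b' - c)) :
    ∃ L' : Knot, L'.IsPartlyStraight K N (j + 1) r' ∧
      (∀ t ∈ Set.Icc (0 : ℝ) 1, t ∉ Set.Icc a b → L' t = L t) ∧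
      (∀ t, t ∈ Set.Icc a a' ∨ t ∈ Set.Icc b' b →
        L' t = ((K t).1, tentHeight a a' c b' b (K a).2 M (K b).2 t)) ∧
      (∀ t ∈ Set.Icc a' b', L' t = ((K a').1 + (ramp c₀ d t : ℝ) * ((K b').1 - (K a').1),
        tentHeight a a' c b' b (K a).2 M (K b).2 t)) := by
  have hN : 0 < N := by omega
  have hr1 : r < 1 := by linarith
  have h0 : 0 < a := ha ▸ outTime_pos hN j hr
  have h1 : a < a' := ha ▸ ha' ▸ outTime_lt_outTime hN j hrr
  have h2 : a' < c₀ := ha' ▸ hc₀ ▸ outTime_lt_inTime hN j hr'.le le_rfl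
  have h3 : c₀ < b' := hc₀ ▸ hb' ▸ inTime_lt_inTime hN j hr'
  have h4 : b' < b := hb' ▸ hb ▸ inTime_lt_inTime hN j hrr
  have h5 : b < 1 := hb ▸ inTime_lt_one hj hr
  have hLK : ∀ t ∈ Set.Icc a b, L t = K t := by
    rw [ha, hb]
    exact hL.eq_of_mem j le_rfl hj
  have hinj : ∀ t ∈ Set.Ioo a b, ∀ s ∈ Set.Icc (0 : ℝ) 1, (L s).1 = (L t).1 → s = t := by
    intro t ht s hs hst
    have hlt : r < ‖(K t).1‖ := hK.lt_norm hN j hr hr1 (by rwa [← ha, ← hb])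
    rw [hLK t (Set.Ioo_subset_Icc_self ht)] at hst
    by_cases h : ∀ k, j ≤ k → k < N → s ∉ Set.Ioo (outTime N k r) (inTime N k r)
    · have := hL.norm_le s hs h
      rw [hst] at this
      linarith
    · push Not at h
      obtain ⟨k, hk1, hk2, hk3⟩ := h
      rw [hL.eq_of_mem k hk1 hk2 s (Set.Ioo_subset_Icc_self hk3)] at hst
      have hs0 : 0 < s := (outTime_pos hN k hr).trans hk3.1
      have hs1 : s < 1 := hk3.2.trans (inTime_lt_one hk2 hr)
      obtain ⟨m, hm⟩ := hK.injective_proj s t hst (by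
        rw [hst, ← norm_pos_iff]; linarith)
      have m1 : (m : ℝ) < 1 := by linarith [ht.2]
      have m2 : (-1 : ℝ) < m := by linarith [ht.1]
      have m3 : m < 1 := by exact_mod_cast m1
      have m4 : -1 < m := by exact_mod_cast m2
      obtain rfl : m = 0 := by omega
      rw [hm, Int.cast_zero, add_zero]
  have hstr : ∀ t ∈ Set.Icc c₀ b',
      (L t).1 = (L c₀).1 + ((t - c₀) / (b' - c₀) : ℝ) * ((L b').1 - (L c₀).1) := by
    intro t ht
    rw [hLK t ⟨by linarith [ht.1], by linarith [ht.2]⟩, hLK c₀ ⟨by linarith, by linarith⟩,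
      hLK b' ⟨by linarith, by linarith⟩]
    rw [hc₀, hb'] at ht
    obtain ⟨u, hu, rfl⟩ := exists_eq_inTime hN j ht
    have e1 := hK.in_ray j u ⟨by linarith [hu.1], hu.2⟩
    have e2 := hK.in_ray j r' ⟨by linarith, hr'.le⟩
    push_cast at e1 e2
    rw [hc₀, hb', e1, e2]
    have e3 : (inTime N j u - inTime N j 1) / (inTime N j r' - inTime N j 1)
        = (1 - u) / (1 - r') := by
      have : (0 : ℝ) < N := by exact_mod_cast hN
      have : 1 - r' ≠ 0 := by linarith
      unfold inTime
      rw [← sub_div, ← sub_div, div_div_div_cancel_right₀ (by positivity)]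
      rw [div_eq_div_iff (by intro h; apply this; linarith) this]
      ring
    rw [e3]
    have : ((1 : ℂ) - r') ≠ 0 := by
      exact_mod_cast (by linarith : 1 - r' ≠ 0)
    push_cast
    field_simp
    ring
  obtain ⟨L', i1, i2, i3, i4⟩ := L.exists_straighten h0.le h1 h2 h3 h4 h5.le hinj hstr hM
    (p := (K a').1) (q := (K b').1) (by rw [hLK a' ⟨by linarith, by linarith⟩])
    (by rw [hLK b' ⟨by linarith, by linarith⟩]) hc hd
  rw [hLK a ⟨le_rfl, by linarith⟩, hLK b ⟨by linarith, le_rfl⟩] at i3 i4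
  have i3' : ∀ t, t ∈ Set.Icc a a' ∨ t ∈ Set.Icc b' b →
        L' t = ((K t).1, tentHeight a a' c b' b (K a).2 M (K b).2 t) := fun t ht => by
    rw [i3 t ht, hLK t]
    rcases ht with ht | ht
    · exact ⟨ht.1, by linarith [ht.2]⟩
    · exact ⟨by linarith [ht.1], ht.2⟩
  have hout : ∀ (k : ℤ) (u : ℝ), u ∈ Set.Icc 0 r' → ‖(K (outTime N k u)).1‖ ≤ r' :=
    fun k u hu => by
      rw [hK.out_ray k u ⟨hu.1, by linarith [hu.2]⟩, norm_mul, hK.norm_out, mul_one,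
        Complex.norm_real, Real.norm_of_nonneg hu.1]
      exact hu.2
  have hin : ∀ (k : ℤ) (u : ℝ), u ∈ Set.Icc 0 r' → ‖(K (inTime N k u)).1‖ ≤ r' :=
    fun k u hu => by
      rw [hK.in_ray k u ⟨hu.1, by linarith [hu.2]⟩, norm_mul, hK.norm_in, mul_one,
        Complex.norm_real, Real.norm_of_nonneg hu.1]
      exact hu.2
  refine ⟨L', ⟨hL.isotopic.trans i1, fun k hk1 hk2 t ht => ?_, fun t ht h => ?_⟩, i2, i3', i4⟩
  · have e1 := outTime_lt_outTime hN k hrr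
    have e2 := inTime_lt_inTime hN k hrr
    have e3 : inTime N j r ≤ outTime N k r :=
      inTime_le_outTime hN (by exact_mod_cast hk1) hr.le hr.le
    rw [i2 t ⟨h0.le.trans (by linarith [ht.1]), ?_⟩ (fun h => ?_)]
    · exact hL.eq_of_mem k (by omega) hk2 t ⟨by linarith [ht.1], by linarith [ht.2]⟩
    · have := inTime_lt_one hk2 (hr.trans hrr)
      linarith [ht.2]
    · linarith [ht.1, h.2]
  · by_cases htab : t ∈ Set.Icc a b
    · rcases le_or_gt t a' with g1 | g1
      · rw [i3' t (Or.inl ⟨htab.1, g1⟩)]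
        obtain ⟨u, hu, rfl⟩ := exists_eq_outTime hN j ⟨ha ▸ htab.1, ha' ▸ g1⟩
        exact hout j u ⟨hr.le.trans hu.1, hu.2⟩
      rcases le_or_gt b' t with g2 | g2
      · rw [i3' t (Or.inr ⟨g2, htab.2⟩)]
        obtain ⟨u, hu, rfl⟩ := exists_eq_inTime hN j ⟨hb' ▸ g2, hb ▸ htab.2⟩
        exact hin j u ⟨hr.le.trans hu.1, hu.2⟩
      · rw [i4 t ⟨g1.le, g2.le⟩]
        have n1 : ‖(K a').1‖ ≤ r' := by
          rw [ha']
          exact hout j r' ⟨by linarith, le_rfl⟩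
        have n2 : ‖(K b').1‖ ≤ r' := by
          rw [hb']
          exact hin j r' ⟨by linarith, le_rfl⟩
        set w := ramp c₀ d t
        have w0 : 0 ≤ w := ramp_nonneg _ _ _
        have w1 : w ≤ 1 := ramp_le_one _ _ _
        have e : (K a').1 + (w : ℂ) * ((K b').1 - (K a').1)
            = ((1 - w : ℝ) : ℂ) * (K a').1 + (w : ℂ) * (K b').1 := by push_cast; ring
        simp only
        rw [e]
        refine (norm_add_le _ _).trans ?_
        rw [norm_mul, norm_mul, Complex.norm_real, Complex.norm_real,
          Real.norm_of_nonneg w0, Real.norm_of_nonneg (by linarith)]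
        nlinarith
    · rw [i2 t ht htab]
      by_cases h' : ∀ k, j ≤ k → k < N → t ∉ Set.Ioo (outTime N k r) (inTime N k r)
      · exact (hL.norm_le t ht h').trans hrr.le
      · push Not at h'
        obtain ⟨k, hk1, hk2, hk3⟩ := h'
        have hkj : j + 1 ≤ k := by
          by_contra hkj
          obtain rfl : k = j := by omega
          exact htab ⟨by rw [ha]; exact hk3.1.le, by rw [hb]; exact hk3.2.le⟩
        rw [hL.eq_of_mem k hk1 hk2 t (Set.Ioo_subset_Icc_self hk3)]
        rcases le_or_gt t (outTime N k r') with g1 | g1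
        · obtain ⟨u, hu, rfl⟩ := exists_eq_outTime hN k ⟨hk3.1.le, g1⟩
          exact hout k u ⟨hr.le.trans hu.1, hu.2⟩
        · have g2 : inTime N k r' ≤ t :=
            le_of_not_gt fun g2 => h k hkj hk2 ⟨g1, g2⟩
          obtain ⟨u, hu, rfl⟩ := exists_eq_inTime hN k ⟨g2, hk3.2.le⟩
          exact hin k u ⟨hr.le.trans hu.1, hu.2⟩

/-- Two normal knots that agree on the radii are isotopic, since their petals are straightened to
the same arcs. -/
theorem Knot.IsNormal.isotopic {K₁ K₂ : Knot} {N : ℕ} (hN : 0 < N) (h₁ : K₁.IsNormal N)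
    (h₂ : K₂.IsNormal N)
    (hout : ∀ (k : ℤ), ∀ r ∈ Set.Icc (0 : ℝ) 1, K₁ (outTime N k r) = K₂ (outTime N k r))
    (hin : ∀ (k : ℤ), ∀ r ∈ Set.Icc (0 : ℝ) 1, K₁ (inTime N k r) = K₂ (inTime N k r)) :
    K₁.Isotopic K₂ := by
  -- The petal `j` is pulled into the disc of radius `R (j + 1)`; these radii increase, so that the
  -- petals already treated stay away from the part of the next one that is lifted.
  set R : ℕ → ℝ := fun j => (j + 1 : ℝ) / (N + 2) with hR
  have hN0 : (0 : ℝ) < N + 2 := by positivity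
  have hR0 : ∀ j, 0 < R j := fun j => by simp only [hR]; positivity
  have hR1 : ∀ j, j ≤ N → R j < 1 := fun j hj => by
    simp only [hR]
    rw [div_lt_one hN0]
    have : (j : ℝ) ≤ N := by exact_mod_cast hj
    linarith
  have hRR : ∀ j, R j < R (j + 1) := fun j => by
    simp only [hR]
    gcongr
    linarith
  have hbase : ∀ K : Knot, K.IsNormal N → K.IsPartlyStraight K N 0 (R 0) := by
    intro K hK
    refine ⟨K.isotopic_refl, fun _ _ _ _ _ => rfl, fun t ht h => ?_⟩
    obtain ⟨k, hk, u, hu, hut⟩ := exists_radius hN ht (fun k hk => h k (by omega) hk)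
    have hu1 : u ∈ Set.Icc (0 : ℝ) 1 := ⟨hu.1, hu.2.trans (hR1 0 (by omega)).le⟩
    have e1 := hK.out_ray k u hu1
    have e2 := hK.in_ray k u hu1
    have e3 := hK.norm_out k
    have e4 := hK.norm_in k
    push_cast at e1 e2 e3 e4
    rcases hut with rfl | rfl
    · rw [e1, norm_mul, e3, mul_one, Complex.norm_real, Real.norm_of_nonneg hu.1]
      exact hu.2
    · rw [e2, norm_mul, e4, mul_one, Complex.norm_real, Real.norm_of_nonneg hu.1]
      exact hu.2
  have hind : ∀ j ≤ N, ∃ L₁ L₂ : Knot, L₁.IsPartlyStraight K₁ N j (R j) ∧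
      L₂.IsPartlyStraight K₂ N j (R j) ∧ ∀ t ∈ Set.Icc (0 : ℝ) 1,
        (∀ k, j ≤ k → k < N → t ∉ Set.Ioo (outTime N k 1) (inTime N k 1)) → L₁ t = L₂ t := by
    intro j
    induction j with
    | zero =>
      refine fun _ => ⟨K₁, K₂, hbase K₁ h₁, hbase K₂ h₂, fun t ht h => ?_⟩
      obtain ⟨k, hk, u, hu, hut⟩ := exists_radius hN ht (fun k hk => h k (by omega) hk)
      rcases hut with rfl | rfl
      · exact_mod_cast hout k u hu
      · exact_mod_cast hin k u hu
    | succ j ih =>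
      intro hj
      obtain ⟨L₁, L₂, hL₁, hL₂, hL⟩ := ih (by omega)
      obtain ⟨M₁, hM₁⟩ := L₁.exists_height_le
      obtain ⟨M₂, hM₂⟩ := L₂.exists_height_le
      obtain ⟨L₁', i1, i2, i3, i4⟩ := hL₁.exists_step h₁ (by omega) (hR0 j) (hRR j)
        (hR1 _ hj) (M := max M₁ M₂) (fun t => (hM₁ t).trans (le_max_left _ _))
        rfl rfl rfl rfl rfl rfl rfl
      obtain ⟨L₂', j1, j2, j3, j4⟩ := hL₂.exists_step h₂ (by omega) (hR0 j) (hRR j)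
        (hR1 _ hj) (M := max M₁ M₂) (fun t => (hM₂ t).trans (le_max_right _ _))
        rfl rfl rfl rfl rfl rfl rfl
      have hRj : ∀ u ∈ Set.Icc (R j) (R (j + 1)), u ∈ Set.Icc (0 : ℝ) 1 := fun u hu =>
        ⟨(hR0 j).le.trans hu.1, hu.2.trans (hR1 _ hj).le⟩
      have l0 : R j ∈ Set.Icc (R j) (R (j + 1)) := ⟨le_rfl, (hRR j).le⟩
      have l1 : R (j + 1) ∈ Set.Icc (R j) (R (j + 1)) := ⟨(hRR j).le, le_rfl⟩
      have ho : ∀ u ∈ Set.Icc (R j) (R (j + 1)), K₁ (outTime N j u) = K₂ (outTime N j u) :=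
        fun u hu => by exact_mod_cast hout j u (hRj u hu)
      have hi : ∀ u ∈ Set.Icc (R j) (R (j + 1)), K₁ (inTime N j u) = K₂ (inTime N j u) :=
        fun u hu => by exact_mod_cast hin j u (hRj u hu)
      refine ⟨L₁', L₂', i1, j1, fun t ht h => ?_⟩
      by_cases htab : t ∈ Set.Icc (outTime N j (R j)) (inTime N j (R j))
      · rcases le_or_gt t (outTime N j (R (j + 1))) with g1 | g1
        · rw [i3 t (Or.inl ⟨htab.1, g1⟩), j3 t (Or.inl ⟨htab.1, g1⟩), ho _ l0, hi _ l0]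
          obtain ⟨u, hu, rfl⟩ := exists_eq_outTime hN j ⟨htab.1, g1⟩
          rw [ho u hu]
        rcases le_or_gt (inTime N j (R (j + 1))) t with g2 | g2
        · rw [i3 t (Or.inr ⟨g2, htab.2⟩), j3 t (Or.inr ⟨g2, htab.2⟩), ho _ l0, hi _ l0]
          obtain ⟨u, hu, rfl⟩ := exists_eq_inTime hN j ⟨g2, htab.2⟩
          rw [hi u hu]
        · rw [i4 t ⟨g1.le, g2.le⟩, j4 t ⟨g1.le, g2.le⟩, ho _ l0, hi _ l0, ho _ l1, hi _ l1]
      · rw [i2 t ht htab, j2 t ht htab]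
        refine hL t ht fun k hk1 hk2 hk3 => ?_
        rcases hk1.eq_or_lt with rfl | hk1
        · have := outTime_lt_outTime hN j (hR1 j (by omega))
          have := inTime_lt_inTime hN j (hR1 j (by omega))
          exact htab ⟨by linarith [hk3.1], by linarith [hk3.2]⟩
        · exact h k hk1 hk2 hk3
  obtain ⟨L₁, L₂, hL₁, hL₂, hL⟩ := hind N le_rfl
  have : L₁ = L₂ := Knot.ext_of_Icc fun t ht => hL t ht (by omega)
  exact hL₁.isotopic.trans (this ▸ hL₂.isotopic.symm)

/-! ### Diagrams with a small petal -/

/-- Interpolation of a sequence by a continuous function that is constant near the integers. -/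
theorem exists_plateau (y : ℤ → ℝ) (N : ℕ) (C : ℝ) (hy : ∀ k, y (k + N) = y k + C) :
    ∃ G : ℝ → ℝ, Continuous G ∧ (∀ u, G (u + N) = G u + C) ∧
      (∀ (k : ℤ) (u : ℝ), |u - k| ≤ 1 / 4 → G u = y k) := by
  let f : ℤ → Unit → ℝ → ℝ := fun k _ u =>
    y k + (y (k + 1) - y k) * ramp (k + 1 / 4) (k + 3 / 4) u
  have hk : ∀ k : ℤ, (k + 1 / 4 : ℝ) < k + 3 / 4 := fun k => by linarith
  obtain ⟨g, hg, hgf⟩ := exists_glue (x := fun k : ℤ => (k : ℝ)) Int.cast_strictMono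
    exists_mem_Ico_intCast f
    (fun k => by
      have : Continuous fun p : Unit × ℝ => ramp (k + 1 / 4) (k + 3 / 4) p.2 :=
        (continuous_ramp _ _).comp continuous_snd
      exact continuous_const.add (continuous_const.mul this))
    (fun k p => by
      have h1 := hk (k + 1)
      simp only [f]
      rw [ramp_of_ge (hk k) (by push_cast; linarith), ramp_of_le h1 (by linarith)]
      ring)
  refine ⟨g (), hg.comp (f := fun u : ℝ => ((), u)) (by fun_prop), fun u => ?_, fun k u hu => ?_⟩
  · obtain ⟨k, hk1⟩ := exists_mem_Ico_intCast u
    rw [hgf k () u (Set.Ico_subset_Icc_self hk1), hgf (k + N) () (u + N)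
      (by
        obtain ⟨h1, h2⟩ := hk1
        push_cast at h2 ⊢
        constructor <;> linarith)]
    have e : k + N + 1 = k + 1 + (N : ℤ) := by ring
    simp only [f, e, hy]
    have e2 : ramp (((k + N : ℤ) : ℝ) + 1 / 4) (((k + N : ℤ) : ℝ) + 3 / 4) (u + N)
        = ramp (k + 1 / 4) (k + 3 / 4) u := by
      simp only [ramp]
      push_cast
      congr 3 <;> ring
    rw [e2]
    ring
  · rw [abs_le] at hu
    rcases le_total (k : ℝ) u with h | h
    · rw [hgf k () u ⟨h, by push_cast; linarith⟩]
      simp only [f]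
      rw [ramp_of_le (hk k) (by linarith)]
      ring
    · rw [hgf (k - 1) () u ⟨by push_cast; linarith, by push_cast; linarith⟩]
      simp only [f]
      rw [ramp_of_ge (hk _) (by push_cast; linarith), sub_add_cancel]
      ring

theorem neg_one_zpow_sq (k : ℤ) : ((-1 : ℝ) ^ k) ^ 2 = 1 := by
  rw [← zpow_natCast, ← zpow_mul, mul_comm, zpow_mul]
  simp

theorem two_mul_abs_le_abs_sin {u : ℝ} (hu : |u| ≤ 1 / 2) : 2 * |u| ≤ |Real.sin (Real.pi * u)| := by
  have h := Real.mul_le_sin (x := Real.pi * |u|) (by positivity)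
    (by nlinarith [Real.pi_pos])
  have e : |Real.sin (Real.pi * u)| = |Real.sin (Real.pi * |u|)| := by
    rcases abs_cases u with ⟨h, _⟩ | ⟨h, _⟩ <;> rw [h]
    rw [mul_neg, Real.sin_neg, abs_neg]
  rw [e]
  refine le_trans (le_of_eq ?_) (h.trans (le_abs_self _))
  field_simp

theorem abs_sub_round_le_abs_sin (t : ℝ) :
    2 * |t - round t| ≤ |Real.sin (Real.pi * t)| := by
  have h := two_mul_abs_le_abs_sin (abs_sub_round t)
  rwa [mul_sub, mul_comm Real.pi (round t : ℝ), Real.sin_sub_int_mul_pi, abs_mul, abs_zpow,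
    abs_neg, abs_one, one_zpow, one_mul] at h

/-- The signed radius of a polar curve with `N + 2` petals, one of them of size `e`, between two
strands that are close to each other. -/
noncomputable def fingerRadius (N : ℕ) (e t : ℝ) : ℝ :=
  Real.cos (N * Real.pi * t) * (Real.sin (Real.pi * t) ^ 2 - e)

/-- The displacement that removes the small petal of `fingerRadius`. -/
noncomputable def fingerShift (e t : ℝ) : ℝ :=
  max 0 (2 * e - Real.sin (Real.pi * t) ^ 2) * Real.cos (Real.pi * t)

section finger

variable {N : ℕ} {e : ℝ}

theorem continuous_fingerRadius : Continuous (fingerRadius N e) := by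
  unfold fingerRadius
  fun_prop

theorem continuous_fingerShift : Continuous (fingerShift e) := by
  unfold fingerShift
  fun_prop

theorem fingerShift_add_one (t : ℝ) : fingerShift e (t + 1) = -fingerShift e t := by
  simp only [fingerShift, mul_add, mul_one, Real.sin_add_pi, Real.cos_add_pi, neg_sq]
  ring

theorem cos_mul_pi_add_one (hN : Odd N) (t : ℝ) :
    Real.cos (N * Real.pi * (t + 1)) = -Real.cos (N * Real.pi * t) := by
  rw [mul_add, mul_one, Real.cos_add_nat_mul_pi, hN.neg_one_pow]
  ring

theorem fingerRadius_add_one (hN : Odd N) (t : ℝ) :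
    fingerRadius N e (t + 1) = -fingerRadius N e t := by
  rw [fingerRadius, fingerRadius, cos_mul_pi_add_one hN, mul_add, mul_one, Real.sin_add_pi, neg_sq]
  ring

theorem fingerShift_eq_zero {t : ℝ} (h : 2 * e ≤ Real.sin (Real.pi * t) ^ 2) :
    fingerShift e t = 0 := by
  rw [fingerShift, max_eq_left (by linarith), zero_mul]

theorem abs_fingerShift_le (he : 0 ≤ e) (t : ℝ) : |fingerShift e t| ≤ 2 * e := by
  rw [fingerShift, abs_mul]
  have h1 : |max 0 (2 * e - Real.sin (Real.pi * t) ^ 2)| ≤ 2 * e := by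
    rw [abs_of_nonneg (le_max_left _ _)]
    exact max_le (by linarith) (by nlinarith [sq_nonneg (Real.sin (Real.pi * t))])
  calc _ ≤ 2 * e * 1 := mul_le_mul h1 (Real.abs_cos_le_one _) (abs_nonneg _) (by linarith)
    _ = 2 * e := mul_one _

/-- Where the cosine factor of `fingerRadius` is small, the time is close to a half-integer
multiple of `1 / N`. -/
theorem exists_int_of_abs_cos_lt {t : ℝ} (h : |Real.cos (N * Real.pi * t)| < 1 / 2) :
    ∃ k : ℤ, |N * t - 1 / 2 - k| ≤ 1 / 4 := by
  refine ⟨round (N * t - 1 / 2), ?_⟩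
  have h1 := abs_sub_round_le_abs_sin (N * t - 1 / 2)
  have e : Real.sin (Real.pi * (N * t - 1 / 2)) = -Real.cos (N * Real.pi * t) := by
    rw [← Real.sin_sub_pi_div_two]
    congr 1
    ring
  rw [e, abs_neg] at h1
  linarith

theorem le_abs_sin_of_abs_le (hN : 0 < N) {t : ℝ} {k : ℤ} (h : |N * t - 1 / 2 - k| ≤ 1 / 4) :
    1 / (2 * N) ≤ |Real.sin (Real.pi * t)| := by
  have hN' : (0 : ℝ) < N := by exact_mod_cast hN
  refine le_trans ?_ (abs_sub_round_le_abs_sin t)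
  set j : ℤ := N * round t - k with hj
  have e : (N : ℝ) * (t - round t) = (N * t - 1 / 2 - k) + (1 / 2 - j) := by
    rw [hj]; push_cast; ring
  have h1 : 1 / 4 ≤ |(N : ℝ) * (t - round t)| := by
    rw [e]
    have h2 : 1 / 2 ≤ |(1 / 2 - j : ℝ)| := by
      rcases le_or_gt j 0 with h | h
      · have : (j : ℝ) ≤ 0 := by exact_mod_cast h
        exact le_trans (by linarith) (le_abs_self _)
      · have : (1 : ℝ) ≤ j := by exact_mod_cast h
        exact le_trans (by linarith) (neg_le_abs _)
    have h3 := abs_sub_abs_le_abs_add (1 / 2 - j : ℝ) (N * t - 1 / 2 - k)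
    rw [add_comm] at h3
    linarith
  rw [abs_mul, abs_of_pos hN'] at h1
  rw [div_le_iff₀ (by positivity)]
  nlinarith

theorem cos_half_int (hN : 0 < N) (k : ℤ) : Real.cos (N * Real.pi * ((k + 1 / 2) / N)) = 0 := by
  have hN' : (N : ℝ) ≠ 0 := by exact_mod_cast hN.ne'
  rw [Real.cos_eq_zero_iff]
  refine ⟨k, ?_⟩
  field_simp

theorem exists_int_of_cos_eq_zero (hN : 0 < N) {t : ℝ} (h : Real.cos (N * Real.pi * t) = 0) :
    ∃ k : ℤ, t = (k + 1 / 2) / N := by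
  have hN' : (N : ℝ) ≠ 0 := by exact_mod_cast hN.ne'
  obtain ⟨k, hk⟩ := Real.cos_eq_zero_iff.1 h
  refine ⟨k, ?_⟩
  have hpi := Real.pi_ne_zero
  field_simp
  apply mul_left_cancel₀ hpi
  linarith

theorem one_div_le_abs_sin (hN : 0 < N) (k : ℤ) :
    1 / (2 * N) ≤ |Real.sin (Real.pi * ((k + 1 / 2) / N))| := by
  have hN' : (N : ℝ) ≠ 0 := by exact_mod_cast hN.ne'
  refine le_abs_sin_of_abs_le hN (k := k) ?_
  have : (N : ℝ) * ((k + 1 / 2) / N) - 1 / 2 - k = 0 := by field_simp; ring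
  rw [this]
  norm_num

/-- The derivative of `fingerRadius`. -/
theorem hasDerivAt_fingerRadius (t : ℝ) : HasDerivAt (fingerRadius N e)
    (-(N * Real.pi) * Real.sin (N * Real.pi * t) * (Real.sin (Real.pi * t) ^ 2 - e)
      + Real.cos (N * Real.pi * t) *
        (2 * Real.pi * Real.sin (Real.pi * t) * Real.cos (Real.pi * t))) t := by
  have h1 : HasDerivAt (fun t : ℝ => N * Real.pi * t) (N * Real.pi) t := by
    simpa using (hasDerivAt_id t).const_mul (N * Real.pi)
  have h2 : HasDerivAt (fun t : ℝ => Real.pi * t) Real.pi t := by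
    simpa using (hasDerivAt_id t).const_mul Real.pi
  refine HasDerivAt.congr_deriv (h1.cos.mul ((h2.sin.pow 2).sub_const e)) ?_
  simp
  ring

theorem contDiff_fingerRadius : ContDiff ℝ 1 (fingerRadius N e) := by
  unfold fingerRadius
  fun_prop

theorem sin_half_int (hN : 0 < N) (k : ℤ) :
    Real.sin (N * Real.pi * ((k + 1 / 2) / N)) = (-1) ^ k := by
  have hN' : (N : ℝ) ≠ 0 := by exact_mod_cast hN.ne'
  have : (N : ℝ) * Real.pi * ((k + 1 / 2) / N) = Real.pi / 2 + k * Real.pi := by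
    field_simp
    ring
  rw [this, Real.sin_add_int_mul_pi, Real.sin_pi_div_two, mul_one]

theorem exists_hasDerivAt_half_int (hN : 0 < N) (he : e < 1 / (2 * N) ^ 2) (k : ℤ) :
    ∃ d : ℝ, 0 < d ∧ HasDerivAt (fingerRadius N e) (-((-1) ^ k * d)) ((k + 1 / 2) / N) := by
  have hN' : (0 : ℝ) < N := by exact_mod_cast hN
  have h1 := one_div_le_abs_sin hN k
  have h2 : 1 / (2 * N : ℝ) ^ 2 ≤ Real.sin (Real.pi * ((k + 1 / 2) / N)) ^ 2 := by
    rw [← sq_abs (Real.sin _)]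
    have : 1 / (2 * N : ℝ) ^ 2 = (1 / (2 * N)) ^ 2 := by rw [div_pow, one_pow]
    rw [this]
    gcongr
  refine ⟨N * Real.pi * (Real.sin (Real.pi * ((k + 1 / 2) / N)) ^ 2 - e),
    mul_pos (by positivity) (by linarith), ?_⟩
  refine (hasDerivAt_fingerRadius _).congr_deriv ?_
  rw [sin_half_int hN, cos_half_int hN]
  ring

theorem cos_pos_of_abs_lt (hN : 0 < N) {u : ℝ} (hu : |u| < 1 / (2 * N)) :
    0 < Real.cos (N * Real.pi * u) := by
  have hN' : (0 : ℝ) < N := by exact_mod_cast hN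
  have h1 : |N * Real.pi * u| < Real.pi / 2 := by
    rw [abs_mul, abs_of_pos (by positivity)]
    rw [lt_div_iff₀ (by positivity)] at hu
    nlinarith [Real.pi_pos]
  rw [abs_lt] at h1
  exact Real.cos_pos_of_mem_Ioo ⟨by linarith, h1.2⟩

/-- Removing the small petal makes the radius positive near the time `0`. -/
theorem fingerRadius_add_fingerShift_pos (hN : 0 < N) (he : 0 < e) {u : ℝ}
    (hu : |u| < 1 / (2 * N)) (hs : Real.sin (Real.pi * u) ^ 2 < 2 * e) :
    0 < fingerRadius N e u + fingerShift e u := by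
  have hN' : (1 : ℝ) ≤ N := by exact_mod_cast hN
  have hc := cos_pos_of_abs_lt hN hu
  have hpi := Real.pi_pos
  have h0 : N * |u| < 1 / 2 := by
    rw [lt_div_iff₀ (by positivity)] at hu
    linarith
  have hcc : Real.cos (N * Real.pi * u) ≤ Real.cos (Real.pi * u) := by
    rw [← Real.cos_abs (N * Real.pi * u), ← Real.cos_abs (Real.pi * u), abs_mul, abs_mul, abs_mul,
      abs_of_pos hpi, abs_of_pos (by linarith : (0 : ℝ) < N)]
    apply Real.cos_le_cos_of_nonneg_of_le_pi (by positivity)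
    · nlinarith
    · have := abs_nonneg u
      nlinarith [mul_nonneg hpi.le this]
  rw [fingerRadius, fingerShift, max_eq_right (by linarith)]
  rcases le_or_gt (Real.sin (Real.pi * u) ^ 2) e with h | h
  · nlinarith
  · nlinarith [mul_pos hc (sub_pos.2 h), mul_pos (hc.trans_le hcc) (sub_pos.2 hs)]

theorem fingerRadius_add_fingerShift_eq_zero_iff (hN : 0 < N) (hodd : Odd N) (he : 0 < e)
    (he' : 2 * e ≤ 1 / (2 * N) ^ 2) {t : ℝ} :
    fingerRadius N e t + fingerShift e t = 0 ↔ ∃ k : ℤ, t = (k + 1 / 2) / N := by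
  have hN' : (0 : ℝ) < N := by exact_mod_cast hN
  constructor
  · intro h
    apply exists_int_of_cos_eq_zero hN
    rcases lt_or_ge (Real.sin (Real.pi * t) ^ 2) (2 * e) with hs | hs
    · exfalso
      have hr : ∀ t, (fun t => fingerRadius N e t + fingerShift e t) (t + 1)
          = -(fun t => fingerRadius N e t + fingerShift e t) t := fun t => by
        simp only [fingerRadius_add_one hodd, fingerShift_add_one]
        ring
      have hanti := eq_add_int_mul_of_antiperiodic
        (r := fun t => fingerRadius N e t + fingerShift e t) hr (t - round t) (round t)
      simp only [sub_add_cancel] at hanti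
      rw [h] at hanti
      have hlt : |Real.sin (Real.pi * t)| < 1 / (2 * N) := by
        apply lt_of_pow_lt_pow_left₀ 2 (by positivity)
        rw [sq_abs, div_pow, one_pow]
        linarith
      have := fingerRadius_add_fingerShift_pos hN he (u := t - round t)
        (by
          have := abs_sub_round_le_abs_sin t
          have := abs_nonneg (t - round t)
          linarith)
        (by
          rwa [mul_sub, mul_comm Real.pi (round t : ℝ), Real.sin_sub_int_mul_pi, mul_pow,
            neg_one_zpow_sq, one_mul])
      have hz : (-1 : ℝ) ^ round t ≠ 0 := zpow_ne_zero _ (by norm_num)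
      rcases mul_eq_zero.1 hanti.symm with h1 | h1
      · exact hz h1
      · linarith
    · rw [fingerShift_eq_zero hs, add_zero, fingerRadius] at h
      exact (mul_eq_zero.1 h).resolve_right (by linarith)
  · rintro ⟨k, rfl⟩
    rw [fingerRadius, cos_half_int hN, zero_mul, zero_add]
    apply fingerShift_eq_zero
    refine he'.trans ?_
    rw [← sq_abs (Real.sin _)]
    have := one_div_le_abs_sin hN k
    have e1 : 1 / (2 * N : ℝ) ^ 2 = (1 / (2 * N)) ^ 2 := by rw [div_pow, one_pow]
    rw [e1]
    gcongr

/-- The small petal of `fingerRadius` lies between the times `-fingerTime e` and `fingerTime e`. -/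
noncomputable def fingerTime (e : ℝ) : ℝ := Real.arcsin (Real.sqrt e) / Real.pi

theorem sin_fingerTime (he1 : e ≤ 1) :
    Real.sin (Real.pi * fingerTime e) = Real.sqrt e := by
  have : Real.sqrt e ≤ 1 := Real.sqrt_le_one.2 he1
  rw [fingerTime, mul_div_cancel₀ _ Real.pi_ne_zero,
    Real.sin_arcsin (by linarith [Real.sqrt_nonneg e]) this]

theorem fingerTime_pos (he : 0 < e) : 0 < fingerTime e :=
  div_pos (Real.arcsin_pos.2 (Real.sqrt_pos.2 he)) Real.pi_pos

theorem fingerTime_le_half : fingerTime e ≤ 1 / 2 := by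
  rw [fingerTime, div_le_iff₀ Real.pi_pos]
  linarith [Real.arcsin_le_pi_div_two (Real.sqrt e)]

theorem two_mul_fingerTime_le (he : 0 < e) (he1 : e ≤ 1) : 2 * fingerTime e ≤ Real.sqrt e := by
  have h := two_mul_abs_le_abs_sin (u := fingerTime e)
    (by rw [abs_of_pos (fingerTime_pos he)]; exact fingerTime_le_half)
  rwa [sin_fingerTime he1, abs_of_pos (fingerTime_pos he),
    abs_of_nonneg (Real.sqrt_nonneg e)] at h

theorem fingerRadius_eq_zero_iff (hN : 0 < N) (he : 0 < e) (he1 : e ≤ 1) {t : ℝ} :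
    fingerRadius N e t = 0 ↔ (∃ k : ℤ, t = (k + 1 / 2) / N) ∨
      ∃ q : ℤ, t = q - fingerTime e ∨ t = q + fingerTime e := by
  have hcos : Real.cos (N * Real.pi * t) = 0 ↔ ∃ k : ℤ, t = (k + 1 / 2) / N :=
    ⟨exists_int_of_cos_eq_zero hN, by rintro ⟨k, rfl⟩; exact cos_half_int hN k⟩
  rw [fingerRadius, mul_eq_zero, hcos]
  refine or_congr_right ?_
  have hse : Real.sin (Real.pi * fingerTime e) ^ 2 = e := by
    rw [sin_fingerTime he1, Real.sq_sqrt he.le]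
  rw [sub_eq_zero]
  conv_lhs => rw [← hse]
  have hpi := Real.pi_ne_zero
  have h2 : ∀ x y : ℝ, Real.sin x ^ 2 = Real.sin y ^ 2 ↔
      ∃ q : ℤ, x = q * Real.pi - y ∨ x = q * Real.pi + y := by
    intro x y
    constructor
    · intro h
      have hprod : Real.sin (x + y) * Real.sin (x - y) = 0 := by
        rw [Real.sin_add, Real.sin_sub]
        nlinarith [Real.sin_sq_add_cos_sq x, Real.sin_sq_add_cos_sq y]
      rcases mul_eq_zero.1 hprod with h | h
      · obtain ⟨q, hq⟩ := Real.sin_eq_zero_iff.1 h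
        exact ⟨q, Or.inl (by linarith)⟩
      · obtain ⟨q, hq⟩ := Real.sin_eq_zero_iff.1 h
        exact ⟨q, Or.inr (by linarith)⟩
    · rintro ⟨q, rfl | rfl⟩
      · rw [Real.sin_int_mul_pi_sub, neg_sq, mul_pow, neg_one_zpow_sq, one_mul]
      · rw [add_comm, Real.sin_add_int_mul_pi, mul_pow, neg_one_zpow_sq, one_mul]
  rw [h2]
  refine exists_congr fun q => or_congr ?_ ?_
  · rw [mul_comm (q : ℝ), ← mul_sub, mul_right_inj' hpi]
  · rw [mul_comm (q : ℝ), ← mul_add, mul_right_inj' hpi]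

/-- The derivative of `fingerRadius` at the two ends of the small petal. -/
theorem exists_hasDerivAt_fingerTime (hN : 0 < N) (he : 0 < e) (he' : Real.sqrt e < 1 / (2 * N)) :
    ∃ d : ℝ, 0 < d ∧ HasDerivAt (fingerRadius N e) (-d) (-fingerTime e) ∧
      HasDerivAt (fingerRadius N e) d (fingerTime e) := by
  have hN' : (1 : ℝ) ≤ N := by exact_mod_cast hN
  have he1 : e ≤ 1 := by
    rw [← Real.sqrt_le_one]
    refine he'.le.trans ?_
    rw [div_le_one (by positivity)]
    linarith
  have hpos := fingerTime_pos he
  have h2 := two_mul_fingerTime_le he he1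
  have hc := cos_pos_of_abs_lt hN (u := fingerTime e) (by rw [abs_of_pos hpos]; linarith)
  have hc1 : 0 < Real.cos (Real.pi * fingerTime e) := by
    have := cos_pos_of_abs_lt (N := 1) one_pos (u := fingerTime e) (by
      rw [abs_of_pos hpos]
      have : 1 / (2 * N : ℝ) ≤ 1 / (2 * (1 : ℕ)) := by
        push_cast
        gcongr
      linarith)
    simpa using this
  have hs := sin_fingerTime he1
  refine ⟨Real.cos (N * Real.pi * fingerTime e) * (2 * Real.pi * Real.sqrt e *
    Real.cos (Real.pi * fingerTime e)), ?_, ?_, ?_⟩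
  · have := Real.sqrt_pos.2 he
    have := Real.pi_pos
    positivity
  · refine (hasDerivAt_fingerRadius _).congr_deriv ?_
    simp only [mul_neg, Real.sin_neg, Real.cos_neg, hs, neg_sq, Real.sq_sqrt he.le]
    ring
  · refine (hasDerivAt_fingerRadius _).congr_deriv ?_
    rw [hs, Real.sq_sqrt he.le]
    ring

/-- The height function for a polar knot with a small petal: it interpolates the heights given by
`G` at the zeros of the cosine, and runs through a short interval around `s₀` near the small
petal. -/
noncomputable def fingerHeight (N : ℕ) (G : ℝ → ℝ) (s₀ c t : ℝ) : ℝ :=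
  max 0 (min 1 (2 - 4 * N * |Real.sin (Real.pi * t)|)) * (s₀ + c * Real.sin (2 * Real.pi * t)) +
    (1 - max 0 (min 1 (2 - 4 * N * |Real.sin (Real.pi * t)|))) * G (N * t - 1 / 2)

theorem continuous_fingerHeight {G : ℝ → ℝ} (hG : Continuous G) (s₀ c : ℝ) :
    Continuous (fingerHeight N G s₀ c) := by
  unfold fingerHeight
  fun_prop

theorem fingerHeight_add_one {G : ℝ → ℝ} (hG : ∀ u, G (u + N) = G u) (s₀ c t : ℝ) :
    fingerHeight N G s₀ c (t + 1) = fingerHeight N G s₀ c t := by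
  have e1 : (N : ℝ) * (t + 1) - 1 / 2 = N * t - 1 / 2 + N := by ring
  have e2 : 2 * Real.pi * (t + 1) = 2 * Real.pi * t + 2 * Real.pi := by ring
  rw [fingerHeight, fingerHeight, e1, hG, e2, Real.sin_add_two_pi, mul_add Real.pi, mul_one,
    Real.sin_add_pi, abs_neg]

theorem fingerHeight_of_near (hN : 0 < N) {G : ℝ → ℝ} (s₀ c : ℝ) {t : ℝ}
    (ht : |Real.sin (Real.pi * t)| ≤ 1 / (4 * N)) :
    fingerHeight N G s₀ c t = s₀ + c * Real.sin (2 * Real.pi * t) := by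
  have hN' : (0 : ℝ) < N := by exact_mod_cast hN
  rw [le_div_iff₀ (by positivity)] at ht
  rw [fingerHeight, min_eq_left (by linarith), max_eq_right zero_le_one]
  ring

theorem fingerHeight_of_abs_le (hN : 0 < N) {G : ℝ → ℝ} (s₀ c : ℝ) {t : ℝ} {k : ℤ}
    (ht : |N * t - 1 / 2 - k| ≤ 1 / 4) :
    fingerHeight N G s₀ c t = G (N * t - 1 / 2) := by
  have hN' : (0 : ℝ) < N := by exact_mod_cast hN
  have h := le_abs_sin_of_abs_le hN ht
  rw [div_le_iff₀ (by positivity)] at h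
  rw [fingerHeight, max_eq_left ((min_le_right _ _).trans (by linarith))]
  ring

/-- The small petal is removed by pushing the point at each level near `s₀` across the origin.
The rest of the knot is not moved, since at these levels it is far from the origin.  The value of
`e` makes `√e = 1 / (12 N)` small compared to the time between strands. -/
theorem exists_isotopic_of_finger (hN : 0 < N) (hodd : Odd N) (he : e = 1 / (144 * N ^ 2))
    {G : ℝ → ℝ} (s₀ : ℝ) {c : ℝ} (hc : c ≠ 0)
    {y : ℤ → ℝ} (hGy : ∀ (k : ℤ) (u : ℝ), |u - k| ≤ 1 / 4 → G u = y k) (hy : ∀ k, |c| ≤ |y k - s₀|)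
    {K : Knot} (hK : ∀ t, K t = (polarCurve (fingerRadius N e) t, fingerHeight N G s₀ c t)) :
    ∃ K' : Knot, K.Isotopic K' ∧ ∀ t, K' t =
      (polarCurve (fun t => fingerRadius N e t + fingerShift e t) t,
        fingerHeight N G s₀ c t) := by
  have hN' : (1 : ℝ) ≤ N := by exact_mod_cast hN
  have he0 : 0 < e := by rw [he]; positivity
  have hes : 9 * e ≤ (1 / (4 * N)) ^ 2 := by
    rw [he, div_pow, one_pow, mul_one_div, div_le_div_iff₀ (by positivity) (by positivity)]
    nlinarith [sq_nonneg (N : ℝ)]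
  have hN4 : 1 / (4 * N : ℝ) ≤ 1 / 4 := by
    gcongr
    linarith
  have hpi := Real.pi_pos
  let τ : ℝ → ℝ := fun x => Real.arcsin ((x - s₀) / c) / (2 * Real.pi)
  have hτc : Continuous τ := by
    have := Real.continuous_arcsin
    fun_prop
  have hpc : Continuous (polarCurve (fingerRadius N e)) := by
    have := continuous_fingerRadius (N := N) (e := e)
    unfold polarCurve
    fun_prop
  let v : ℝ → ℂ := fun x => polarCurve (fingerShift e) (τ x)
  have hvc : Continuous v := by
    have := continuous_fingerShift (e := e)
    simp only [v]
    unfold polarCurve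
    fun_prop
  obtain ⟨K', hK', hK't⟩ := K.exists_map (isotopicToId_push (c := fun x =>
    polarCurve (fingerRadius N e) (τ x)) (v := v) (hpc.comp hτc) hvc (R := 3 * e) (by linarith)
    (q := 2 / 3) (by norm_num) (fun x => by
      simp only [v]
      rw [norm_polarCurve]
      linarith [abs_fingerShift_le he0.le (τ x)]))
  refine ⟨K', hK', fun t => ?_⟩
  -- it suffices to consider one period around `0`
  have hper : ∀ u : ℝ, |u| ≤ 1 / 2 → K' u =
      (polarCurve (fun t => fingerRadius N e t + fingerShift e t) u,
        fingerHeight N G s₀ c u) := by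
    intro u hu
    rw [hK't, hK]
    ext1
    swap
    · rfl
    simp only
    have hsum : polarCurve (fun t => fingerRadius N e t + fingerShift e t) u
        = polarCurve (fingerRadius N e) u + polarCurve (fingerShift e) u := by
      simp only [polarCurve]
      push_cast
      ring
    rw [hsum]
    have hu2 := two_mul_abs_le_abs_sin hu
    have hτ : |Real.sin (Real.pi * u)| ≤ 1 / (4 * N) → τ (fingerHeight N G s₀ c u) = u := by
      intro h
      simp only [τ]
      have h8 : |u| ≤ 1 / 4 := by linarith [abs_nonneg u]
      rw [abs_le] at h8
      rw [fingerHeight_of_near hN _ _ h, add_sub_cancel_left, mul_div_cancel_left₀ _ hc,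
        Real.arcsin_sin (by nlinarith) (by nlinarith)]
      field_simp
    rcases lt_or_ge (Real.sin (Real.pi * u) ^ 2) (2 * e) with hs | hs
    · have hs' : |Real.sin (Real.pi * u)| ≤ 1 / (4 * N) := by
        apply le_of_sq_le_sq _ (by positivity)
        rw [sq_abs]
        linarith
      rw [hτ hs', sub_self, norm_zero, zero_div, sub_zero, max_eq_right zero_le_one]
      simp only [v, hτ hs', Complex.ofReal_one, one_mul]
    · have hz : polarCurve (fingerShift e) u = 0 := by
        rw [polarCurve_eq_zero_iff]
        exact fingerShift_eq_zero hs
      rw [hz, add_zero]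
      set x := fingerHeight N G s₀ c u with hx
      rcases le_or_gt (2 * e) (Real.sin (Real.pi * τ x) ^ 2) with hv | hv
      · have : v x = 0 := by
          simp only [v]
          rw [polarCurve_eq_zero_iff]
          exact fingerShift_eq_zero hv
        rw [this, mul_zero, add_zero]
      · have h1 : 1 / (4 * N) < |Real.sin (Real.pi * u)| := by
          by_contra h
          rw [hτ (not_lt.1 h)] at hv
          linarith
        have h2 : 1 / 2 ≤ |Real.cos (N * Real.pi * u)| := by
          by_contra h
          obtain ⟨k, hk⟩ := exists_int_of_abs_cos_lt (not_le.1 h)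
          have hxy : x = y k := by
            rw [hx, fingerHeight_of_abs_le hN _ _ hk, hGy k _ hk]
          -- at such a level, the inverse sine takes one of its extreme values
          have hsin : Real.sin (Real.pi * τ x) ^ 2 = 1 / 2 := by
            have habs : 1 ≤ |(x - s₀) / c| := by
              rw [abs_div, le_div_iff₀ (abs_pos.2 hc), one_mul, hxy]
              exact hy k
            have hq : Real.sin (Real.pi / 4) ^ 2 = 1 / 2 := by
              rw [Real.sin_pi_div_four, div_pow, Real.sq_sqrt (by norm_num)]
              norm_num
            rcases le_abs.1 habs with h | h
            · have : Real.pi * τ x = Real.pi / 4 := by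
                simp only [τ]
                rw [Real.arcsin_of_one_le h]
                field_simp
                norm_num
              rw [this, hq]
            · have : Real.pi * τ x = -(Real.pi / 4) := by
                simp only [τ]
                rw [Real.arcsin_of_le_neg_one (by linarith)]
                field_simp
                norm_num
              rw [this, Real.sin_neg, neg_sq, hq]
          have : (1 / (4 * N : ℝ)) ^ 2 ≤ (1 / 4) ^ 2 := by gcongr
          linarith
        have h3 : 4 * e ≤ |fingerRadius N e u| := by
          have h4 : (1 / (4 * N : ℝ)) ^ 2 ≤ Real.sin (Real.pi * u) ^ 2 := by
            rw [← sq_abs (Real.sin _)]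
            gcongr
          rw [fingerRadius, abs_mul]
          have h5 : 8 * e ≤ |Real.sin (Real.pi * u) ^ 2 - e| :=
            le_trans (by linarith) (le_abs_self _)
          nlinarith
        have h4 : |fingerRadius N e (τ x)| ≤ e := by
          rw [fingerRadius, abs_mul]
          have h5 : |Real.sin (Real.pi * τ x) ^ 2 - e| ≤ e := by
            rw [abs_le]
            constructor <;> nlinarith [sq_nonneg (Real.sin (Real.pi * τ x))]
          calc _ ≤ 1 * e := mul_le_mul (Real.abs_cos_le_one _) h5 (abs_nonneg _) zero_le_one
            _ = e := one_mul e
        have h5 : 3 * e ≤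
            ‖polarCurve (fingerRadius N e) u - polarCurve (fingerRadius N e) (τ x)‖ := by
          have := norm_sub_norm_le (polarCurve (fingerRadius N e) u)
            (polarCurve (fingerRadius N e) (τ x))
          rw [norm_polarCurve, norm_polarCurve] at this
          linarith
        have h6 : 1 ≤ ‖polarCurve (fingerRadius N e) u
            - polarCurve (fingerRadius N e) (τ x)‖ / (3 * e) := by
          rw [le_div_iff₀ (by linarith)]
          linarith
        rw [max_eq_left (by linarith), Complex.ofReal_zero, zero_mul, add_zero]
  have hanti : ∀ t, (fun t => fingerRadius N e t + fingerShift e t) (t + 1)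
      = -(fun t => fingerRadius N e t + fingerShift e t) t := fun t => by
    simp only [fingerRadius_add_one hodd, fingerShift_add_one]
    ring
  have hpol : polarCurve (fun t => fingerRadius N e t + fingerShift e t) (t - round t)
      = polarCurve (fun t => fingerRadius N e t + fingerShift e t) t := by
    have h1 := eq_add_int_mul_of_antiperiodic
      (r := fun t => fingerRadius N e t + fingerShift e t) hanti (t - round t) (round t)
    have h2 := exp_pi_mul_add_int (t - round t) (round t)
    rw [sub_add_cancel] at h1 h2
    rw [polarCurve, polarCurve, h1, h2]
    push_cast
    have h3 : ((-1 : ℂ) ^ round t) * (-1) ^ round t = 1 := by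
      rw [← mul_zpow]
      simp
    linear_combination (-(fingerRadius N e (t - round t) + fingerShift e (t - round t) : ℂ)
      * Complex.exp (Real.pi * (t - round t) * Complex.I)) * h3
  have e1 : K' (t - round t) = K' t := by
    have := K'.periodic_int (t - round t) (round t)
    rw [sub_add_cancel] at this
    exact this.symm
  have e2 : fingerHeight N G s₀ c (t - round t) = fingerHeight N G s₀ c t := by
    have h1 := congrArg Prod.snd (K.periodic_int (t - round t) (round t))
    rw [sub_add_cancel, hK, hK] at h1
    exact h1.symm
  rw [← e1, hper _ (abs_sub_round t), hpol, e2]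

end finger

/-! ### Trivial petal additions -/

/-- The value at `k` of the periodic sequence with period `l`. -/
def periodicList (l : List ℕ) (k : ℤ) : ℕ := l.getD (k % l.length).toNat 0

theorem periodicList_add_mul (l : List ℕ) (k q : ℤ) :
    periodicList l (k + q * l.length) = periodicList l k := by
  rw [periodicList, Int.add_mul_emod_self_right, periodicList]

theorem periodicList_natCast (l : List ℕ) {i : ℕ} (hi : i < l.length) :
    periodicList l i = l[i] := by
  rw [periodicList, Int.emod_eq_of_lt (by omega) (by omega), Int.toNat_natCast,
    List.getD_eq_getElem _ _ hi]

theorem exists_eq_natCast_add_mul {M : ℕ} (hM : 0 < M) (k : ℤ) :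
    ∃ (i : ℕ) (q : ℤ), i < M ∧ k = i + q * M := by
  have h1 := Int.emod_nonneg k (b := M) (by omega)
  have h2 := Int.emod_lt_of_pos k (b := M) (by omega)
  refine ⟨(k % M).toNat, k / M, by omega, ?_⟩
  rw [Int.toNat_of_nonneg h1, mul_comm]
  exact (Int.emod_add_mul_ediv k M).symm

theorem periodicList_injective {l : List ℕ} (hl : l.Nodup) (h0 : 0 < l.length) {j k : ℤ}
    (h : periodicList l j = periodicList l k) : ∃ q : ℤ, k = j + q * l.length := by
  obtain ⟨i, q, hi, rfl⟩ := exists_eq_natCast_add_mul h0 j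
  obtain ⟨i', q', hi', rfl⟩ := exists_eq_natCast_add_mul h0 k
  rw [periodicList_add_mul, periodicList_add_mul, periodicList_natCast l hi,
    periodicList_natCast l hi'] at h
  obtain rfl := (hl.getElem_inj_iff).1 h
  exact ⟨q' - q, by ring⟩

theorem map_periodicList_range (l : List ℕ) :
    (List.range l.length).map (fun k : ℕ => periodicList l k) = l := by
  apply List.ext_getElem
  · simp
  · intro i h1 h2
    simp only [List.getElem_map, List.getElem_range]
    exact periodicList_natCast l h2

/-- A polar knot whose radius has simple zeros, and whose heights there are ordered like a list of
distinct labels, has a petal diagram with these labels. -/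
theorem exists_polarKnot_of_labels {r h : ℝ → ℝ} (hrc : Continuous r) (hhc : Continuous h)
    (hr : ∀ t, r (t + 1) = -r t) (hh : ∀ t, h (t + 1) = h t) {n : ℕ}
    {time : ℤ → ℝ} (htime : StrictMono time) (hper : ∀ k, time (k + (2 * n + 1)) = time k + 1)
    (hzero : ∀ t, r t = 0 ↔ ∃ k, t = time k) (hC : ∀ k, ContDiffAt ℝ 1 r (time k))
    (hderiv : ∀ k, ∃ d : ℝ, 0 < d ∧ HasDerivAt r (-((-1) ^ k * d)) (time k))
    {l : List ℕ} (hl : l.Nodup) (hlen : l.length = 2 * n + 1) {g : ℕ → ℝ} (hg : StrictAnti g)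
    (hht : ∀ k, h (time k) = g (periodicList l k)) :
    ∃ K : Knot, (∀ t, K t = (polarCurve r t, h t)) ∧
      ∃ D : PetalDiagram K n, D.labels = (l : Cycle ℕ) := by
  have htp : ∀ (q k : ℤ), time (k + q * (2 * n + 1)) = time k + q := by
    intro q k
    have hp : Function.Periodic (fun q : ℤ => time (k + q * (2 * n + 1)) - q) 1 := fun q => by
      have := hper (k + q * (2 * n + 1))
      have e : k + (q + 1) * (2 * n + 1) = k + q * (2 * n + 1) + (2 * n + 1 : ℤ) := by ring
      simp only [e, this]
      push_cast
      ring
    have := hp.int_mul q 0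
    simp only [mul_one, zero_add, zero_mul, Int.cast_zero, sub_zero, Int.cast_id, add_zero] at this
    linarith
  have hinj : ∀ s t, r s = 0 → r t = 0 → h s = h t → ∃ k : ℤ, t = s + k := by
    intro s t hs ht hst
    obtain ⟨j, rfl⟩ := (hzero s).1 hs
    obtain ⟨k, rfl⟩ := (hzero t).1 ht
    rw [hht, hht] at hst
    obtain ⟨q, rfl⟩ := periodicList_injective hl (by omega) (hg.injective hst)
    refine ⟨q, ?_⟩
    rw [hlen]
    push_cast
    exact htp q j
  obtain ⟨D, hD⟩ := exists_petalDiagram_polarKnot hrc hhc hr hh hinj htime hper hzero hC hderiv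
    (label := periodicList l) (fun j k => by rw [hht, hht, hg.lt_iff_gt])
  refine ⟨polarKnot r h hrc hhc hr hh hinj, fun t => rfl, D, ?_⟩
  rw [PetalDiagram.labels, hD, ← hlen, map_periodicList_range]

theorem labelShift_strictMono (m : ℕ) : StrictMono (labelShift m) := by
  intro a b hab
  unfold labelShift
  split_ifs <;> omega

theorem labelShift_ne (m a : ℕ) : labelShift m a ≠ m ∧ labelShift m a ≠ m + 1 := by
  unfold labelShift
  split_ifs <;> omega

/-- The height of the strand with label `a`, if the strands with the labels `m` and `m + 1` are at
a small distance `κ` from their middle. -/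
noncomputable def strandHeight (m : ℕ) (κ : ℝ) (a : ℕ) : ℝ :=
  if a = m then -(m + 1 / 2) + κ else if a = m + 1 then -(m + 1 / 2) - κ else -a

theorem strandHeight_strictAnti (m : ℕ) {κ : ℝ} (h0 : 0 < κ) (h1 : κ < 1) :
    StrictAnti (strandHeight m κ) := by
  refine strictAnti_nat_of_succ_lt fun a => ?_
  unfold strandHeight
  rcases lt_trichotomy (a + 1) m with h | h | h
  · rw [if_neg (by omega), if_neg (by omega), if_neg (by omega), if_neg (by omega)]
    push_cast
    linarith
  · rw [if_pos h, if_neg (by omega), if_neg (by omega), ← h]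
    push_cast
    linarith
  · rcases (by omega : a = m ∨ a = m + 1 ∨ m + 1 < a) with rfl | rfl | h'
    · rw [if_neg (by omega), if_pos rfl, if_pos rfl]
      linarith
    · rw [if_neg (by omega), if_neg (by omega), if_neg (by omega), if_pos rfl]
      push_cast
      linarith
    · rw [if_neg (by omega), if_neg (by omega), if_neg (by omega), if_neg (by omega)]
      push_cast
      linarith

/-- The `i`-th strand time in the period from `-t₀`, for a knot with `N` strands at half-integer
multiples of `1 / N` and two strands at `-t₀` and `t₀`. -/
noncomputable def baseTime (N : ℕ) (t₀ : ℝ) (i : ℕ) : ℝ :=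
  if i = 0 then -t₀ else if i = 1 then t₀ else ((i - 2 : ℤ) + 1 / 2) / N

/-- The strand times of a knot with `N` strands at half-integer multiples of `1 / N` and two
strands at `-t₀` and `t₀` modulo the period. -/
noncomputable def strandTime (N : ℕ) (t₀ : ℝ) (k : ℤ) : ℝ :=
  baseTime N t₀ (k % (N + 2)).toNat + (k / (N + 2) : ℤ)

section strandTime

variable {N : ℕ} {t₀ : ℝ}

theorem eq_zero_or_eq_one_or_eq_add_two (i : ℕ) : i = 0 ∨ i = 1 ∨ ∃ j, i = j + 2 := by
  rcases i with _ | _ | j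
  · exact Or.inl rfl
  · exact Or.inr (Or.inl rfl)
  · exact Or.inr (Or.inr ⟨j, rfl⟩)

theorem strandTime_eq {i : ℕ} (hi : i < N + 2) (q : ℤ) :
    strandTime N t₀ (i + q * (N + 2)) = baseTime N t₀ i + q := by
  rw [strandTime, Int.add_mul_emod_self_right, Int.emod_eq_of_lt (by omega) (by omega),
    Int.toNat_natCast, Int.add_mul_ediv_right _ _ (by omega),
    Int.ediv_eq_zero_of_lt (by omega) (by omega), zero_add]

theorem strandTime_add (k : ℤ) : strandTime N t₀ (k + (N + 2)) = strandTime N t₀ k + 1 := by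
  rw [strandTime, Int.add_emod_right, Int.add_ediv_of_dvd_right (dvd_refl _),
    Int.ediv_self (by omega), strandTime]
  push_cast
  ring

theorem strandTime_strictMono (hN : 0 < N) (h0 : 0 < t₀) (h1 : t₀ < 1 / (2 * N)) :
    StrictMono (strandTime N t₀) := by
  have hN' : (0 : ℝ) < N := by exact_mod_cast hN
  refine strictMono_int_of_lt_succ fun k => ?_
  obtain ⟨i, q, hi, rfl⟩ := exists_eq_natCast_add_mul (M := N + 2) (by omega) k
  push_cast
  rw [strandTime_eq hi]
  have h2 : 1 / (2 * N : ℝ) = 1 / 2 / N := by field_simp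
  rw [h2] at h1
  rcases (by omega : i + 1 < N + 2 ∨ i + 1 = N + 2) with h | h
  · have e : (i : ℤ) + q * (N + 2) + 1 = ((i + 1 : ℕ) : ℤ) + q * (N + 2) := by push_cast; ring
    rw [e, strandTime_eq h]
    gcongr
    unfold baseTime
    rcases (by omega : i = 0 ∨ i = 1 ∨ 2 ≤ i) with rfl | rfl | h'
    · simp only [if_true]
      norm_num
      linarith
    · norm_num
      rw [lt_div_iff₀ hN'] at h1 ⊢
      linarith
    · rw [if_neg (by omega), if_neg (by omega), if_neg (by omega), if_neg (by omega)]
      gcongr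
      omega
  · have e : (i : ℤ) + q * (N + 2) + 1 = ((0 : ℕ) : ℤ) + (q + 1) * (N + 2) := by
      push_cast
      have : (i : ℤ) + 1 = N + 2 := by exact_mod_cast h
      linear_combination this
    rw [e, strandTime_eq (by omega)]
    unfold baseTime
    rw [if_neg (by omega), if_neg (by omega), if_pos rfl]
    have h3 : (((i - 2 : ℤ) : ℝ) + 1 / 2) / N = 1 - 1 / 2 / N := by
      have : (i : ℤ) - 2 = N - 1 := by omega
      rw [this]
      push_cast
      field_simp
      ring
    rw [h3]
    push_cast
    linarith

theorem baseTime_add_two (hN : 0 < N) {i : ℕ} (q : ℤ) :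
    baseTime N t₀ (i + 2) + q = (((i + q * N : ℤ) : ℝ) + 1 / 2) / N := by
  have hN' : (N : ℝ) ≠ 0 := by exact_mod_cast hN.ne'
  rw [baseTime, if_neg (by omega), if_neg (by omega)]
  push_cast
  field_simp
  ring

theorem exists_eq_strandTime_iff (hN : 0 < N) {t : ℝ} :
    (∃ k, t = strandTime N t₀ k) ↔
      (∃ k : ℤ, t = (k + 1 / 2) / N) ∨ ∃ q : ℤ, t = q - t₀ ∨ t = q + t₀ := by
  constructor
  · rintro ⟨k, rfl⟩
    obtain ⟨i, q, hi, rfl⟩ := exists_eq_natCast_add_mul (M := N + 2) (by omega) k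
    push_cast
    rw [strandTime_eq hi]
    rcases eq_zero_or_eq_one_or_eq_add_two i with rfl | rfl | ⟨j, rfl⟩
    · refine Or.inr ⟨q, Or.inl ?_⟩
      simp only [baseTime, if_true]
      ring
    · refine Or.inr ⟨q, Or.inr ?_⟩
      simp only [baseTime, one_ne_zero, if_false, if_true]
      ring
    · exact Or.inl ⟨_, baseTime_add_two hN q⟩
  · rintro (⟨k, rfl⟩ | ⟨q, rfl | rfl⟩)
    · obtain ⟨i, q, hi, rfl⟩ := exists_eq_natCast_add_mul hN k
      refine ⟨((i + 2 : ℕ) : ℤ) + q * (N + 2), ?_⟩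
      rw [strandTime_eq (by omega), baseTime_add_two hN]
    · refine ⟨((0 : ℕ) : ℤ) + q * (N + 2), ?_⟩
      rw [strandTime_eq (by omega)]
      simp only [baseTime, if_true]
      ring
    · refine ⟨((1 : ℕ) : ℤ) + q * (N + 2), ?_⟩
      rw [strandTime_eq (by omega)]
      simp only [baseTime, one_ne_zero, if_false, if_true]
      ring

end strandTime

theorem HasDerivAt.of_antiperiodic {r : ℝ → ℝ} (hr : ∀ t, r (t + 1) = -r t) {d t : ℝ}
    (h : HasDerivAt r d t) (q : ℤ) : HasDerivAt r ((-1) ^ q * d) (t + q) := by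
  have h1 : HasDerivAt (fun s : ℝ => s - q) 1 (t + q) := (hasDerivAt_id _).sub_const _
  have h2 : HasDerivAt (fun s => (-1 : ℝ) ^ q * r (s - q)) ((-1) ^ q * (d * 1)) (t + q) := by
    refine (HasDerivAt.comp (t + q) (h₂ := r) ?_ h1).const_mul _
    rwa [add_sub_cancel_right]
  rw [mul_one] at h2
  refine h2.congr_of_eventuallyEq (Filter.Eventually.of_forall fun s => ?_)
  have := eq_add_int_mul_of_antiperiodic hr (s - q) q
  rwa [sub_add_cancel] at this

/-- Words that differ by the insertion of `m` and `m + 1`, in either order, are the labels of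
isotopic polar knots. -/
theorem exists_isotopic_of_labels {n m : ℕ} {w l : List ℕ} (hw : w.Nodup)
    (hwl : w.length = 2 * n + 1)
    (hl : l = m :: (m + 1) :: w.map (labelShift m) ∨ l = (m + 1) :: m :: w.map (labelShift m)) :
    ∃ K K' : Knot, K'.Isotopic K ∧ (∃ D : PetalDiagram K n, D.labels = (w : Cycle ℕ)) ∧
      ∃ D : PetalDiagram K' (n + 1), D.labels = (l : Cycle ℕ) := by
  set N : ℕ := 2 * n + 1 with hNdef
  have hN : 0 < N := by omega
  have hodd : Odd N := ⟨n, hNdef⟩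
  have hN' : (1 : ℝ) ≤ N := by exact_mod_cast hN
  set e : ℝ := 1 / (144 * N ^ 2) with he
  have he0 : 0 < e := by positivity
  have hsq : Real.sqrt e = 1 / (12 * N) := by
    rw [Real.sqrt_eq_iff_mul_self_eq he0.le (by positivity), he]
    field_simp
    norm_num
  have hsq' : Real.sqrt e < 1 / (2 * N) := by
    rw [hsq]
    gcongr
    norm_num
  have he1 : e ≤ 1 := by
    rw [← Real.sqrt_le_one, hsq, div_le_one (by positivity)]
    linarith
  have he2 : 2 * e ≤ 1 / (2 * N) ^ 2 := by
    rw [he, mul_one_div, div_le_div_iff₀ (by positivity) (by positivity)]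
    nlinarith [sq_nonneg (N : ℝ)]
  have hllen : l.length = 2 * (n + 1) + 1 := by
    rcases hl with rfl | rfl <;> simp [hwl, hNdef] <;> ring
  have hnod : l.Nodup := by
    have h1 : (w.map (labelShift m)).Nodup := hw.map (labelShift_strictMono m).injective
    have h2 : ∀ x ∈ w, labelShift m x ≠ m := fun x _ => (labelShift_ne m x).1
    have h3 : ∀ x ∈ w, labelShift m x ≠ m + 1 := fun x _ => (labelShift_ne m x).2
    rcases hl with rfl | rfl
    · simpa [h1] using ⟨h2, h3⟩
    · simpa [h1] using ⟨h3, h2⟩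
  set t₀ := fingerTime e with ht₀
  have ht₀0 : 0 < t₀ := fingerTime_pos he0
  have ht₀1 : 2 * t₀ ≤ 1 / (12 * N) := by
    have := two_mul_fingerTime_le he0 he1
    rwa [hsq] at this
  have hN12 : 1 / (12 * N : ℝ) ≤ 1 / 12 := by
    gcongr
    linarith
  set κ := 1 / 4 * Real.sin (2 * Real.pi * t₀) with hκ
  have hpi := Real.pi_pos
  have hκ0 : 0 < κ := by
    have : 0 < Real.sin (2 * Real.pi * t₀) :=
      Real.sin_pos_of_pos_of_lt_pi (by positivity) (by nlinarith)
    positivity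
  have hκ1 : κ < 1 := by
    have := Real.sin_le_one (2 * Real.pi * t₀)
    linarith
  obtain ⟨c, hc, hcl⟩ : ∃ c : ℝ, |c| = 1 / 4 ∧
      (-(m + 1 / 2) - c * Real.sin (2 * Real.pi * t₀) = strandHeight m κ (periodicList l (0 : ℕ)) ∧
      -(m + 1 / 2) + c * Real.sin (2 * Real.pi * t₀)
        = strandHeight m κ (periodicList l (1 : ℕ))) := by
    have p0 := periodicList_natCast l (i := 0) (by omega)
    have p1 := periodicList_natCast l (i := 1) (by omega)
    rw [p0, p1]
    rcases hl with rfl | rfl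
    · refine ⟨-(1 / 4), by norm_num, ?_⟩
      simp [strandHeight, hκ]
      ring
    · refine ⟨1 / 4, by norm_num, ?_⟩
      simp [strandHeight, hκ]
  let y : ℤ → ℝ := fun k => -(labelShift m (periodicList w k) : ℝ)
  have hyp : ∀ k q : ℤ, y (k + q * N) = y k := fun k q => by
    simp only [y]
    rw [← hwl, periodicList_add_mul]
  obtain ⟨G, hGc, hGp, hGy⟩ := exists_plateau y N 0 (fun k => by
    have := hyp k 1
    rw [one_mul] at this
    rw [this, add_zero])
  simp only [add_zero] at hGp
  set s₀ : ℝ := -(m + 1 / 2) with hs₀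
  have hyc : ∀ k, |c| ≤ |y k - s₀| := by
    intro k
    obtain ⟨h1, h2⟩ := labelShift_ne m (periodicList w k)
    simp only [y, hs₀]
    rw [hc]
    rcases (by omega : labelShift m (periodicList w k) < m ∨
      m + 1 < labelShift m (periodicList w k)) with h | h
    · have : (labelShift m (periodicList w k) : ℝ) < m := by exact_mod_cast h
      exact le_trans (by linarith) (le_abs_self _)
    · have : (m + 1 : ℝ) < labelShift m (periodicList w k) := by exact_mod_cast h
      exact le_trans (by linarith) (neg_le_abs _)
  have hc0 : c ≠ 0 := by
    rintro rfl
    norm_num at hc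
  have hhalf : ∀ k : ℤ, fingerHeight N G s₀ c ((k + 1 / 2) / N) = y k := by
    intro k
    have e1 : (N : ℝ) * ((k + 1 / 2) / N) - 1 / 2 = k := by field_simp; ring
    have e2 : |(k : ℝ) - k| ≤ 1 / 4 := by norm_num
    rw [fingerHeight_of_abs_le hN s₀ c (k := k) (by rw [e1]; exact e2), e1]
    exact hGy k k e2
  have hfh := fingerHeight_add_one (N := N) hGp s₀ c
  have hhp : ∀ (x : ℝ) (q : ℤ), fingerHeight N G s₀ c (x + q) = fingerHeight N G s₀ c x := by
    intro x q
    have hp : Function.Periodic (fingerHeight N G s₀ c) 1 := hfh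
    simpa using hp.int_mul q x
  have hnear : ∀ x : ℝ, |Real.sin (Real.pi * x)| = Real.sqrt e →
      fingerHeight N G s₀ c x = s₀ + c * Real.sin (2 * Real.pi * x) := by
    intro x hx
    apply fingerHeight_of_near hN
    rw [hx, hsq]
    gcongr
    norm_num
  have hsin := sin_fingerTime he1
  -- the knot with the small petal
  obtain ⟨K', hK't, hD'⟩ := exists_polarKnot_of_labels (n := n + 1)
    (continuous_fingerRadius (N := N) (e := e)) (continuous_fingerHeight hGc s₀ c)
    (fingerRadius_add_one hodd) hfh
    (time := strandTime N t₀) (strandTime_strictMono hN ht₀0 (by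
      linarith [show 1 / (12 * N : ℝ) ≤ 1 / (2 * N) by gcongr; norm_num]))
    (fun k => by
      rw [← strandTime_add, hNdef]
      push_cast
      ring_nf)
    (fun t => by rw [exists_eq_strandTime_iff hN, fingerRadius_eq_zero_iff hN he0 he1])
    (fun k => contDiff_fingerRadius.contDiffAt)
    (fun k => by
      obtain ⟨i, q, hi, rfl⟩ := exists_eq_natCast_add_mul (M := N + 2) (by omega) k
      have hsign : (-1 : ℝ) ^ (i + q * ((N + 2 : ℕ) : ℤ)) = (-1) ^ q * (-1) ^ i := by
        have h2 : Odd (N + 2) := hodd.add_even even_two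
        rw [zpow_add₀ (by norm_num), mul_comm q, zpow_mul, zpow_natCast, zpow_natCast,
          h2.neg_one_pow, mul_comm]
      rw [hsign]
      push_cast
      rw [strandTime_eq hi]
      obtain ⟨d, hd, hd1, hd2⟩ := exists_hasDerivAt_fingerTime hN he0 hsq'
      rcases eq_zero_or_eq_one_or_eq_add_two i with rfl | rfl | ⟨j, rfl⟩
      · refine ⟨d, hd, ?_⟩
        simp only [baseTime, if_true]
        refine (hd1.of_antiperiodic (fingerRadius_add_one hodd) q).congr_deriv ?_
        simp
      · refine ⟨d, hd, ?_⟩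
        simp only [baseTime, one_ne_zero, if_false, if_true]
        refine (hd2.of_antiperiodic (fingerRadius_add_one hodd) q).congr_deriv ?_
        simp
      · obtain ⟨d', hd', hd3⟩ := exists_hasDerivAt_half_int hN (e := e) (by linarith) j
        refine ⟨d', hd', ?_⟩
        have e1 := baseTime_add_two (t₀ := t₀) hN (i := j) 0
        push_cast at e1
        rw [add_zero, zero_mul, add_zero] at e1
        rw [e1]
        refine (hd3.of_antiperiodic (fingerRadius_add_one hodd) q).congr_deriv ?_
        rw [pow_add]
        simp [mul_assoc])
    hnod hllen (strandHeight_strictAnti m hκ0 hκ1)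
    (fun k => by
      obtain ⟨i, q, hi, rfl⟩ := exists_eq_natCast_add_mul (M := N + 2) (by omega) k
      have e1 : ((N + 2 : ℕ) : ℤ) = (l.length : ℤ) := by rw [hllen, hNdef]; push_cast; ring
      rw [e1, periodicList_add_mul, ← e1]
      push_cast
      rw [strandTime_eq hi]
      rcases eq_zero_or_eq_one_or_eq_add_two i with rfl | rfl | ⟨j, rfl⟩
      · rw [hhp, ← hcl.1]
        simp only [baseTime, if_true]
        rw [hnear _ (by
          rw [mul_neg, Real.sin_neg, abs_neg, hsin, abs_of_nonneg (Real.sqrt_nonneg e)]),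
          mul_neg, Real.sin_neg]
        ring
      · rw [hhp, ← hcl.2]
        simp only [baseTime, one_ne_zero, if_false, if_true]
        rw [hnear _ (by rw [hsin, abs_of_nonneg (Real.sqrt_nonneg e)])]
      · rw [baseTime_add_two hN, hhalf, hyp]
        have hj : j < w.length := by omega
        have e2 : periodicList l ((j + 2 : ℕ) : ℤ) = labelShift m w[j] := by
          rw [periodicList_natCast l (by omega)]
          rcases hl with rfl | rfl <;> simp
        have e3 := periodicList_natCast w hj
        obtain ⟨h1, h2⟩ := labelShift_ne m w[j]
        simp only [y]
        rw [e2, e3, strandHeight, if_neg h1, if_neg h2])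
  -- the knot without it
  obtain ⟨K, hiso, hKt⟩ := exists_isotopic_of_finger hN hodd he s₀ hc0 hGy hyc hK't
  have hev : ∀ k : ℤ, (fun t => fingerRadius N e t + fingerShift e t)
      =ᶠ[𝓝 ((k + 1 / 2) / N : ℝ)] fingerRadius N e := by
    intro k
    have hopen : IsOpen {t : ℝ | 2 * e < Real.sin (Real.pi * t) ^ 2} :=
      isOpen_lt (by fun_prop) (by fun_prop)
    have hmem : ((k + 1 / 2) / N : ℝ) ∈ {t : ℝ | 2 * e < Real.sin (Real.pi * t) ^ 2} := by
      have h1 := one_div_le_abs_sin hN k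
      have h2 : (1 / (2 * N : ℝ)) ^ 2 ≤ Real.sin (Real.pi * ((k + 1 / 2) / N)) ^ 2 := by
        rw [← sq_abs (Real.sin _)]
        gcongr
      refine lt_of_lt_of_le ?_ h2
      rw [he, div_pow, one_pow, mul_one_div, div_lt_div_iff₀ (by positivity) (by positivity)]
      nlinarith
    filter_upwards [hopen.mem_nhds hmem] with t ht
    rw [fingerShift_eq_zero (le_of_lt ht), add_zero]
  obtain ⟨K₀, hK₀t, hD⟩ := exists_polarKnot_of_labels (n := n)
    (r := fun t => fingerRadius N e t + fingerShift e t)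
    (continuous_fingerRadius.add continuous_fingerShift) (continuous_fingerHeight hGc s₀ c)
    (fun t => by rw [fingerRadius_add_one hodd, fingerShift_add_one]; ring) hfh
    (time := fun k => (k + 1 / 2) / N)
    (fun j k hjk => by
      have : (j : ℝ) < k := by exact_mod_cast hjk
      simp only
      gcongr)
    (fun k => by
      have : (N : ℝ) = 2 * n + 1 := by rw [hNdef]; push_cast; ring
      push_cast
      rw [← this]
      field_simp
      ring)
    (fun t => fingerRadius_add_fingerShift_eq_zero_iff hN hodd he0 he2)
    (fun k => contDiff_fingerRadius.contDiffAt.congr_of_eventuallyEq (hev k))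
    (fun k => by
      obtain ⟨d, hd, hd1⟩ := exists_hasDerivAt_half_int hN (e := e) (by linarith) k
      exact ⟨d, hd, hd1.congr_of_eventuallyEq (hev k)⟩)
    hw hwl (g := fun a => -(labelShift m a : ℝ))
    (fun a b hab => by
      have : (labelShift m a : ℝ) < labelShift m b := by
        exact_mod_cast labelShift_strictMono m hab
      simp only
      linarith)
    hhalf
  have hKK : K = K₀ := Knot.ext_of_Icc fun t _ => by rw [hKt, hK₀t]
  exact ⟨K, K', hiso, hKK ▸ hD, hD'⟩

/-- If `σ'` is obtained from `σ` by a trivial petal addition, then both are petal permutations of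
knots, and some of these knots are isotopic. -/
theorem IsTrivialPetalAddition.exists_isotopic {n : ℕ} {σ : PetalPermutation n}
    {σ' : PetalPermutation (n + 1)} (h : IsTrivialPetalAddition σ σ') :
    ∃ K K' : Knot, K'.Isotopic K ∧ (∃ D : PetalDiagram K n, D.labels = σ.cycle) ∧
      ∃ D : PetalDiagram K' (n + 1), D.labels = σ'.cycle := by
  obtain ⟨m, u, v, -, hσ, hσ'⟩ := h
  have hrot : ((u ++ v : List ℕ) : Cycle ℕ) = ((v ++ u : List ℕ) : Cycle ℕ) :=
    Cycle.coe_eq_coe.2 List.isRotated_append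
  rw [hrot] at hσ
  have hm := σ.toMultiset_cycle
  rw [hσ, Cycle.coe_toMultiset] at hm
  have hnd : (v ++ u).Nodup := by
    rw [← Multiset.coe_nodup, hm]
    exact Multiset.nodup_range _
  have hlen : (v ++ u).length = 2 * n + 1 := by
    rw [← Multiset.coe_card, hm, Multiset.card_range]
  have hrot' : ∀ a b : ℕ, ((u.map (labelShift m) ++ [a, b] ++ v.map (labelShift m) : List ℕ) :
      Cycle ℕ) = ((a :: b :: (v ++ u).map (labelShift m) : List ℕ) : Cycle ℕ) := by
    intro a b
    rw [List.append_assoc]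
    refine Cycle.coe_eq_coe.2 (List.isRotated_append.trans ?_)
    simp [List.IsRotated.refl]
  rw [hrot', hrot'] at hσ'
  rw [hσ]
  rcases hσ' with hσ' | hσ' <;> rw [hσ']
  · exact exists_isotopic_of_labels hnd hlen (Or.inl rfl)
  · exact exists_isotopic_of_labels hnd hlen (Or.inr rfl)

/-! ### The strands near the crossing point -/

/-- A property that holds eventually for each member of a periodic sequence holds eventually for all
of them at once. -/
theorem eventually_forall_of_periodic {α : Type*} {l : Filter α} {P : ℤ → α → Prop} {M : ℕ}
    (hM : 0 < M) (h : ∀ m, ∀ᶠ x in l, P m x) (hP : ∀ m x, P (m + M) x ↔ P m x) :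
    ∀ᶠ x in l, ∀ m, P m x := by
  have h1 : ∀ᶠ x in l, ∀ i ∈ Finset.range M, P (i : ℕ) x :=
    (Filter.eventually_all_finset _).2 fun i _ => h i
  filter_upwards [h1] with x hx m
  have hq : ∀ (q : ℤ) (i : ℤ), P (i + q * M) x ↔ P i x := by
    intro q i
    induction q with
    | zero => simp
    | succ q ih =>
      have e : i + ((q : ℤ) + 1) * M = i + q * M + M := by ring
      rw [e, hP, ih]
    | pred q ih =>
      have e : i + (-(q : ℤ)) * M = i + (-(q : ℤ) - 1) * M + M := by ring
      rw [e, hP] at ih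
      exact ih
  obtain ⟨i, q, hi, rfl⟩ := exists_eq_natCast_add_mul hM m
  rw [hq]
  exact hx i (Finset.mem_range.2 hi)

/-- Near a zero at which it is regular, a `C¹` curve moves away from the origin. -/
theorem eventually_strictMonoOn_norm {q : ℝ → ℂ} (hC : ContDiffAt ℝ 1 q 0) (h0 : q 0 = 0) {w : ℂ}
    (hw : w ≠ 0) (hd : HasDerivAt q w 0) :
    ∀ᶠ η in 𝓝[>] (0 : ℝ), StrictMonoOn (fun s => ‖q s‖) (Set.Icc 0 η) := by
  obtain ⟨f', u, hu, hf'c, hf'⟩ := contDiffAt_one_iff.1 hC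
  have hf'0 : f' 0 1 = w := by
    have h1 := (hf' 0 (mem_of_mem_nhds hu)).hasDerivAt
    exact h1.unique hd
  have hds : ContinuousAt (dslope q 0) 0 := continuousAt_dslope_same.2 hd.differentiableAt
  have hinner : ContinuousAt (fun s => inner ℝ (dslope q 0 s) (f' s 1)) 0 := by
    have h1 : ContinuousAt f' 0 := hf'c.continuousAt hu
    exact hds.inner (𝕜 := ℝ) (h1.clm_apply continuousAt_const)
  have hpos : 0 < inner ℝ (dslope q 0 0) (f' 0 1) := by
    rw [dslope_same, hd.deriv, hf'0]
    exact real_inner_self_pos.2 hw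
  obtain ⟨δ, hδ, hball⟩ := Metric.mem_nhds_iff.1
    (Filter.inter_mem hu (hinner.eventually (lt_mem_nhds hpos)))
  filter_upwards [Ioo_mem_nhdsGT hδ] with η hη
  have hmem : ∀ s ∈ Set.Icc 0 η, s ∈ Metric.ball (0 : ℝ) δ := fun s hs => by
    rw [Metric.mem_ball, Real.dist_eq, sub_zero, abs_of_nonneg hs.1]
    exact hs.2.trans_lt hη.2
  have hderiv : ∀ s ∈ Set.Icc 0 η, HasDerivAt (fun s => ‖q s‖ ^ 2)
      (2 * inner ℝ (q s) (f' s 1)) s := fun s hs => by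
    have h1 := (hf' s (hball (hmem s hs)).1).hasDerivAt
    exact h1.norm_sq
  have hsq : StrictMonoOn (fun s => ‖q s‖ ^ 2) (Set.Icc 0 η) := by
    apply strictMonoOn_of_deriv_pos (convex_Icc 0 η)
    · exact fun s hs => (hderiv s hs).continuousAt.continuousWithinAt
    · intro s hs
      rw [interior_Icc] at hs
      have hs' := Set.Ioo_subset_Icc_self hs
      rw [(hderiv s hs').deriv]
      have h2 : q s = s • dslope q 0 s := by
        have := sub_smul_dslope q 0 s
        rw [sub_zero, h0, sub_zero] at this
        exact this.symm
      have h3 : 0 < inner ℝ (dslope q 0 s) (f' s 1) := (hball (hmem s hs')).2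
      rw [h2, real_inner_smul_left]
      have := hs.1
      positivity
  intro s hs t ht hst
  exact lt_of_pow_lt_pow_left₀ 2 (norm_nonneg _) (hsq hs ht hst)

/-- The angle of the point `q s` of a curve that starts from the origin in the direction `θ`, as a
continuous function with the value `θ` at `0`.  The quotient `dslope q 0 s` has the same direction
as `q s`, and does not vanish at `s = 0`. -/
noncomputable def branchAngle (q : ℝ → ℂ) (θ s : ℝ) : ℝ :=
  θ + (dslope q 0 s * Complex.exp (-(θ * Complex.I))).arg

theorem branchAngle_add_two_pi (q : ℝ → ℂ) (θ s : ℝ) :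
    branchAngle q (θ + 2 * Real.pi) s = branchAngle q θ s + 2 * Real.pi := by
  have : Complex.exp (-(((θ + 2 * Real.pi : ℝ) : ℂ) * Complex.I))
      = Complex.exp (-(θ * Complex.I)) := by
    rw [Complex.exp_neg, Complex.exp_neg,
      (exp_mul_I_eq_iff (x := θ + 2 * Real.pi) (y := θ)).2 ⟨1, by simp⟩]
  rw [branchAngle, branchAngle, this]
  ring

/-- On a short initial piece of a curve that starts from the origin with velocity `r * exp (θ i)`,
the angle is continuous and close to `θ`. -/
theorem eventually_branchAngle {q : ℝ → ℂ} (hq : Continuous q) (h0 : q 0 = 0) {r θ : ℝ}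
    (hr : 0 < r) (hd : HasDerivAt q (r * Complex.exp (θ * Complex.I)) 0) {κ : ℝ} (hκ : 0 < κ) :
    ∀ᶠ η in 𝓝[>] (0 : ℝ), ∀ s ∈ Set.Icc 0 η, ContinuousAt (branchAngle q θ) s ∧
      |branchAngle q θ s - θ| < κ ∧
      q s = ‖q s‖ * Complex.exp (branchAngle q θ s * Complex.I) := by
  have hds : ∀ s, ContinuousAt (dslope q 0) s := by
    intro s
    by_cases hs : s = 0
    · rw [hs]
      exact continuousAt_dslope_same.2 hd.differentiableAt
    · exact (continuousAt_dslope_of_ne hs).2 hq.continuousAt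
  set D : ℝ → ℂ := fun s => dslope q 0 s * Complex.exp (-(θ * Complex.I)) with hD
  have hDc : Continuous D := continuous_iff_continuousAt.2 fun s => (hds s).mul continuousAt_const
  have hexp : Complex.exp (θ * Complex.I) * Complex.exp (-(θ * Complex.I)) = 1 := by
    rw [← Complex.exp_add, add_neg_cancel, Complex.exp_zero]
  have hD0 : D 0 = r := by
    simp only [hD]
    rw [dslope_same, hd.deriv, mul_assoc, hexp, mul_one]
  have hslit : D 0 ∈ Complex.slitPlane := by
    rw [hD0]
    exact Complex.ofReal_mem_slitPlane.2 hr
  have harg : (D 0).arg = 0 := by rw [hD0, Complex.arg_ofReal_of_nonneg hr.le]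
  have h1 : ∀ᶠ s in 𝓝 (0 : ℝ), D s ∈ Complex.slitPlane :=
    hDc.continuousAt.eventually (Complex.isOpen_slitPlane.mem_nhds hslit)
  have h2 : ∀ᶠ s in 𝓝 (0 : ℝ), |(D s).arg| < κ := by
    have hc : ContinuousAt (fun s => |(D s).arg|) 0 :=
      (ContinuousAt.comp (g := Complex.arg) (Complex.continuousAt_arg hslit)
        hDc.continuousAt).abs
    have h3 : |(D 0).arg| < κ := by rwa [harg, abs_zero]
    exact hc.eventually_lt continuousAt_const h3
  obtain ⟨δ, hδ, hball⟩ := Metric.mem_nhds_iff.1 (h1.and h2)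
  filter_upwards [Ioo_mem_nhdsGT hδ] with η hη s hs
  have hmem : s ∈ Metric.ball (0 : ℝ) δ := by
    rw [Metric.mem_ball, Real.dist_eq, sub_zero, abs_of_nonneg hs.1]
    exact hs.2.trans_lt hη.2
  obtain ⟨g1, g2⟩ := hball hmem
  refine ⟨?_, ?_, ?_⟩
  · have : ContinuousAt (fun s => (D s).arg) s :=
      ContinuousAt.comp (g := Complex.arg) (Complex.continuousAt_arg g1) hDc.continuousAt
    exact continuousAt_const.add this
  · simpa [branchAngle] using g2
  · have e1 : q s = s * D s * Complex.exp (θ * Complex.I) := by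
      have := sub_smul_dslope q 0 s
      rw [sub_zero, h0, sub_zero, Complex.real_smul] at this
      simp only [hD]
      linear_combination -this - s * dslope q 0 s * hexp
    have e2 : ‖q s‖ = s * ‖D s‖ := by
      rw [e1, norm_mul, norm_mul, Complex.norm_exp_ofReal_mul_I, mul_one, Complex.norm_real,
        Real.norm_of_nonneg hs.1]
    rw [e2]
    conv_lhs => rw [e1, ← Complex.norm_mul_exp_arg_mul_I (D s)]
    simp only [branchAngle]
    push_cast
    rw [add_mul, Complex.exp_add]
    ring

/-! ### Normalizing the parametrization -/

/-- The time at which a normal knot with `N` petals is at distance `r` from the origin on the ray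
`m`.  The rays are numbered counterclockwise, the even ones being run through outwards and the odd
ones inwards. -/
noncomputable def rayTime (N : ℕ) (m : ℤ) (r : ℝ) : ℝ := (m + (-1) ^ m * (r / 4)) / N

/-- The parametrization of a petal between the times `a` and `b` by which the distance `f` to the
origin grows linearly up to `e` at the time `a'`, and decreases linearly from the time `b'` on. -/
noncomputable def petalParam (f : ℝ → ℝ) (e a a' b' b t : ℝ) : ℝ :=
  f (max a (min a' t)) / e / 4 + ramp a' b' t / 2 + (1 - f (max b' (min b t)) / e) / 4

theorem continuous_petalParam {f : ℝ → ℝ} {e a a' b' b : ℝ} (hf : Continuous f) :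
    Continuous (petalParam f e a a' b' b) := by
  have := continuous_ramp a' b'
  unfold petalParam
  fun_prop

theorem petalParam_of_le {f : ℝ → ℝ} {e a a' b' b : ℝ} (he : 0 < e) (hab : a' < b')
    (hb : b' < b) (hb' : f b' = e) {t : ℝ} (ht : t ∈ Set.Icc a a') :
    petalParam f e a a' b' b t = f t / e / 4 := by
  rw [petalParam, min_eq_right ht.2, max_eq_right ht.1, ramp_of_le hab ht.2,
    min_eq_right (by linarith [ht.2]), max_eq_left (by linarith [ht.2]), hb', div_self he.ne']
  ring

theorem petalParam_of_mem {f : ℝ → ℝ} {e a a' b' b : ℝ} (he : 0 < e) (ha : a < a')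
    (hb : b' < b) (ha' : f a' = e) (hb' : f b' = e) {t : ℝ} (ht : t ∈ Set.Icc a' b') :
    petalParam f e a a' b' b t = 1 / 4 + ramp a' b' t / 2 := by
  rw [petalParam, min_eq_left ht.1, max_eq_right ha.le, ha', min_eq_right (by linarith [ht.2]),
    max_eq_left ht.2, hb', div_self he.ne']
  ring

theorem petalParam_of_ge {f : ℝ → ℝ} {e a a' b' b : ℝ} (he : 0 < e) (ha : a < a')
    (hab : a' < b') (ha' : f a' = e) {t : ℝ} (ht : t ∈ Set.Icc b' b) :
    petalParam f e a a' b' b t = 1 - f t / e / 4 := by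
  rw [petalParam, min_eq_left (by linarith [ht.1]), max_eq_right ha.le, ha', ramp_of_ge hab ht.1,
    min_eq_right ht.2, max_eq_right ht.1, div_self he.ne']
  ring

theorem petalParam_strictMonoOn {f : ℝ → ℝ} {e a a' b' b : ℝ} (he : 0 < e) (ha : a < a')
    (hab : a' < b') (hb : b' < b) (ha' : f a' = e) (hb' : f b' = e)
    (hfa : StrictMonoOn f (Set.Icc a a')) (hfb : StrictAntiOn f (Set.Icc b' b)) :
    StrictMonoOn (petalParam f e a a' b' b) (Set.Icc a b) := by
  have h1 : StrictMonoOn (petalParam f e a a' b' b) (Set.Icc a a') := fun s hs t ht hst => by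
    rw [petalParam_of_le he hab hb hb' hs, petalParam_of_le he hab hb hb' ht]
    have := hfa hs ht hst
    gcongr
  have h2 : StrictMonoOn (petalParam f e a a' b' b) (Set.Icc a' b') := fun s hs t ht hst => by
    rw [petalParam_of_mem he ha hb ha' hb' hs, petalParam_of_mem he ha hb ha' hb' ht,
      ramp_of_mem hab hs, ramp_of_mem hab ht]
    have : 0 < b' - a' := by linarith
    gcongr
  have h3 : StrictMonoOn (petalParam f e a a' b' b) (Set.Icc b' b) := fun s hs t ht hst => by
    rw [petalParam_of_ge he ha hab ha' hs, petalParam_of_ge he ha hab ha' ht]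
    have := hfb hs ht hst
    gcongr
  have h12 := h1.union h2 (c := a') (isGreatest_Icc ha.le) (isLeast_Icc hab.le)
  rw [Set.Icc_union_Icc_eq_Icc ha.le hab.le] at h12
  have h123 := h12.union h3 (c := b') (isGreatest_Icc (by linarith)) (isLeast_Icc hb.le)
  rwa [Set.Icc_union_Icc_eq_Icc (by linarith) hb.le] at h123

theorem map_add_int_mul_one {x : ℤ → ℝ} {N : ℤ} (hN : ∀ k, x (k + N) = x k + 1) (k q : ℤ) :
    x (k + q * N) = x k + q := by
  induction q with
  | zero => simp
  | succ q ih =>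
    rw [add_mul, one_mul, ← add_assoc, hN, ih]
    push_cast
    ring
  | pred q ih =>
    have h := hN (k + (-(q : ℤ) - 1) * N)
    have e : k + (-(q : ℤ) - 1) * N + N = k + -(q : ℤ) * N := by ring
    rw [e, ih] at h
    push_cast at h ⊢
    linarith

/-- If a continuous periodic function on the line vanishes only at given times, then it is bounded
away from `0` at positive distance from these times. -/
theorem exists_pos_lt_of_forall_le {f : ℝ → ℝ} (hf : Continuous f) (hf1 : Function.Periodic f 1)
    (hf0 : ∀ t, 0 ≤ f t) {x : ℤ → ℝ} {N : ℤ} (hN : ∀ k, x (k + N) = x k + 1)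
    (hz : ∀ t, f t = 0 → ∃ k, t = x k) {η : ℝ} (hη : 0 < η) :
    ∃ ε, 0 < ε ∧ ∀ t, (∀ k, η ≤ |t - x k|) → ε < f t := by
  have hS : IsCompact (Set.Icc (0 : ℝ) 1 ∩ {t | ∀ k, η ≤ |t - x k|}) := by
    apply isCompact_Icc.inter_right
    rw [Set.ofPred_forall]
    exact isClosed_iInter fun k => isClosed_le continuous_const (by fun_prop)
  obtain ⟨c, hc, hcf⟩ := hS.exists_forall_le' hf.continuousOn (a := 0) fun t ht => by
    refine (hf0 t).lt_of_ne' fun h0 => ?_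
    obtain ⟨k, rfl⟩ := hz t h0
    have := ht.2 k
    rw [sub_self, abs_zero] at this
    linarith
  refine ⟨c / 2, by linarith, fun t ht => ?_⟩
  have h1 : f (Int.fract t) = f t := by simpa using hf1.sub_int_mul_eq ⌊t⌋ (x := t)
  have := hcf (Int.fract t) ⟨⟨Int.fract_nonneg t, (Int.fract_lt_one t).le⟩, fun k => ?_⟩
  · linarith
  · have h2 := ht (k + ⌊t⌋ * N)
    rw [map_add_int_mul_one hN] at h2
    rwa [Int.fract, sub_sub, add_comm (⌊t⌋ : ℝ)]

theorem petalParam_add_one {f : ℝ → ℝ} (hf : Function.Periodic f 1) (e a a' b' b t : ℝ) :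
    petalParam f e (a + 1) (a' + 1) (b' + 1) (b + 1) (t + 1) = petalParam f e a a' b' b t := by
  unfold petalParam ramp
  rw [min_add_add_right, min_add_add_right, max_add_add_right, max_add_add_right, hf, hf]
  congr 6 <;> ring

/-- A closed curve whose distance `f` to the origin grows strictly on both sides of each passage
through the origin can be reparametrized so that `f` is linear near these passages. -/
theorem exists_isReparametrization_radial {f : ℝ → ℝ} (hf : Continuous f)
    (hf1 : Function.Periodic f 1) (hf0 : ∀ t, 0 ≤ f t) {x : ℤ → ℝ} (hx : StrictMono x) {N : ℕ}
    (hN0 : 0 < N) (hN : ∀ k, x (k + N) = x k + 1) (hz : ∀ t, f t = 0 ↔ ∃ k, t = x k) {η : ℝ}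
    (hη : 0 < η) (hηx : ∀ k, 2 * η < x (k + 1) - x k)
    (hout : ∀ k, StrictMonoOn f (Set.Icc (x k) (x k + η)))
    (hin : ∀ k, StrictAntiOn f (Set.Icc (x k - η) (x k))) :
    ∃ φ, IsReparametrization φ ∧ ∃ ε, 0 < ε ∧
      (∀ k : ℤ, ∀ r ∈ Set.Icc (0 : ℝ) 1, φ (outTime N k r) ∈ Set.Icc (x k) (x k + η) ∧
        f (φ (outTime N k r)) = ε * r) ∧
      (∀ k : ℤ, ∀ r ∈ Set.Icc (0 : ℝ) 1,
        φ (inTime N k r) ∈ Set.Icc (x (k + 1) - η) (x (k + 1)) ∧ f (φ (inTime N k r)) = ε * r) ∧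
      ∀ k : ℤ, ∀ t ∈ Set.Ioo (outTime N k 1) (inTime N k 1), ε < f (φ t) := by
  have hNR : (0 : ℝ) < N := by exact_mod_cast hN0
  obtain ⟨ε, hε, hεf⟩ := exists_pos_lt_of_forall_le hf hf1 hf0 hN (fun t => (hz t).1) hη
  have hfx : ∀ k, f (x k) = 0 := fun k => (hz _).2 ⟨k, rfl⟩
  have hgap : ∀ k, ∀ t ∈ Set.Icc (x k + η) (x (k + 1) - η), ε < f t := by
    intro k t ht
    refine hεf t fun j => ?_
    rcases le_or_gt j k with hj | hj
    · have := hx.monotone hj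
      exact le_trans (by linarith [ht.1]) (le_abs_self _)
    · have := hx.monotone (show k + 1 ≤ j by omega)
      exact le_trans (by linarith [ht.2]) (neg_le_abs _)
  have ha' : ∀ k, ∃ a' ∈ Set.Ioo (x k) (x k + η), f a' = ε := by
    intro k
    have h1 := intermediate_value_Ioo (show x k ≤ x k + η by linarith) hf.continuousOn
    obtain ⟨a', h2, h3⟩ := h1 (show ε ∈ Set.Ioo (f (x k)) (f (x k + η)) by
      rw [hfx]
      exact ⟨hε, hgap k _ ⟨le_rfl, by linarith [hηx k]⟩⟩)
    exact ⟨a', h2, h3⟩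
  have hb' : ∀ k, ∃ b' ∈ Set.Ioo (x (k + 1) - η) (x (k + 1)), f b' = ε := by
    intro k
    have h1 := intermediate_value_Ioo' (show x (k + 1) - η ≤ x (k + 1) by linarith)
      hf.continuousOn
    obtain ⟨b', h2, h3⟩ := h1 (show ε ∈ Set.Ioo (f (x (k + 1))) (f (x (k + 1) - η)) by
      rw [hfx]
      exact ⟨hε, hgap k _ ⟨by linarith [hηx k], le_rfl⟩⟩)
    exact ⟨b', h2, h3⟩
  choose a' ha' hfa' using ha'
  choose b' hb' hfb' using hb'
  have hab : ∀ k, a' k < b' k := fun k => by linarith [hηx k, (ha' k).2, (hb' k).1]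
  have hfa : ∀ k, StrictMonoOn f (Set.Icc (x k) (a' k)) := fun k =>
    (hout k).mono (Set.Icc_subset_Icc_right (ha' k).2.le)
  have hfb : ∀ k, StrictAntiOn f (Set.Icc (b' k) (x (k + 1))) := fun k =>
    (hin (k + 1)).mono (Set.Icc_subset_Icc_left (hb' k).1.le)
  have haN : ∀ k, a' (k + N) = a' k + 1 := fun k => by
    refine (hout (k + N)).injOn (Set.Ioo_subset_Icc_self (ha' _)) ?_ ?_
    · rw [hN]
      exact ⟨by linarith [(ha' k).1], by linarith [(ha' k).2]⟩
    · rw [hf1, hfa', hfa']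
  have hxN : ∀ k, x (k + N + 1) = x (k + 1) + 1 := fun k => by rw [← hN, add_right_comm]
  have hbN : ∀ k, b' (k + N) = b' k + 1 := fun k => by
    refine (hin (k + N + 1)).injOn (Set.Ioo_subset_Icc_self (hb' _)) ?_ ?_
    · rw [hxN]
      exact ⟨by linarith [(hb' k).1], by linarith [(hb' k).2]⟩
    · rw [hf1, hfb', hfb']
  have hcov := exists_mem_Ico_of_periodic hx hN
  -- The new time as a function `g` of the old one is given by `petalParam` on each petal; the
  -- reparametrization is its inverse.
  set P : ℤ → ℝ → ℝ := fun k => petalParam f ε (x k) (a' k) (b' k) (x (k + 1)) with hP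
  have hPle : ∀ k, ∀ t ∈ Set.Icc (x k) (a' k), P k t = f t / ε / 4 := fun k t ht =>
    petalParam_of_le hε (hab k) (hb' k).2 (hfb' k) ht
  have hPge : ∀ k, ∀ t ∈ Set.Icc (b' k) (x (k + 1)), P k t = 1 - f t / ε / 4 := fun k t ht =>
    petalParam_of_ge hε (ha' k).1 (hab k) (hfa' k) ht
  have hPmono : ∀ k, StrictMonoOn (P k) (Set.Icc (x k) (x (k + 1))) := fun k =>
    petalParam_strictMonoOn hε (ha' k).1 (hab k) (hb' k).2 (hfa' k) (hfb' k) (hfa k) (hfb k)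
  have hxx : ∀ k, x k < x (k + 1) := fun k => hx (by omega)
  obtain ⟨g, hgc, hg⟩ := exists_glue (X := Unit) hx hcov (fun k _ t => (k + P k t) / N)
    (fun k => by
      have := continuous_petalParam (e := ε) (a := x k) (a' := a' k) (b' := b' k)
        (b := x (k + 1)) hf
      change Continuous fun p : Unit × ℝ => (k + P k p.2) / N
      fun_prop)
    (fun k _ => by
      rw [hPge k _ (Set.right_mem_Icc.2 (hb' k).2.le),
        hPle (k + 1) _ (Set.left_mem_Icc.2 (ha' _).1.le), hfx]
      push_cast
      ring)
  have hψg : ∀ k, ∀ t ∈ Set.Icc (x k) (x (k + 1)), g () t = (k + P k t) / N := fun k => hg k ()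
  have hψ : IsReparametrization (g ()) := by
    refine ⟨hgc.comp (Continuous.prodMk_right ()), ?_, fun t => ?_⟩
    · refine strictMono_of_strictMonoOn_Icc hx hcov fun k s hs t ht hst => ?_
      rw [hψg k s hs, hψg k t ht]
      have := hPmono k hs ht hst
      gcongr
    · obtain ⟨k, hk⟩ := hcov t
      rw [hψg k t (Set.Ico_subset_Icc_self hk), hψg (k + N) (t + 1) ⟨by
        rw [hN]; linarith [hk.1], by rw [hxN]; linarith [hk.2]⟩]
      simp only [hP]
      rw [hN, haN, hbN, hxN, petalParam_add_one hf1]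
      push_cast
      field_simp
      ring
  obtain ⟨φ, hφ, hψφ⟩ := hψ.exists_inverse
  have hψx : ∀ k, g () (x k) = k / N := fun k => by
    rw [hψg k _ (Set.left_mem_Icc.2 (hxx k).le), hPle k _ (Set.left_mem_Icc.2 (ha' k).1.le), hfx]
    simp
  have hψa : ∀ k, g () (a' k) = (k + 1 / 4) / N := fun k => by
    rw [hψg k _ ⟨(ha' k).1.le, ((hab k).trans (hb' k).2).le⟩,
      hPle k _ (Set.right_mem_Icc.2 (ha' k).1.le), hfa', div_self hε.ne']
  have hψb : ∀ k, g () (b' k) = (k + 1 - 1 / 4) / N := fun k => by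
    rw [hψg k _ ⟨((ha' k).1.trans (hab k)).le, (hb' k).2.le⟩,
      hPge k _ (Set.left_mem_Icc.2 (hb' k).2.le), hfb', div_self hε.ne']
    ring
  refine ⟨φ, hφ, ε, hε, fun k r hr => ?_, fun k r hr => ?_, fun k t ht => ?_⟩
  · have h1 : φ (outTime N k r) ∈ Set.Icc (x k) (a' k) := by
      constructor <;> rw [← hψ.2.1.le_iff_le, hψφ]
      · rw [hψx, outTime]
        gcongr
        linarith [hr.1]
      · rw [hψa, outTime]
        gcongr
        exact hr.2
    refine ⟨⟨h1.1, h1.2.trans (ha' k).2.le⟩, ?_⟩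
    have h2 := hψφ (outTime N k r)
    rw [hψg k _ ⟨h1.1, h1.2.trans ((hab k).trans (hb' k).2).le⟩, hPle k _ h1] at h2
    generalize f (φ (outTime N k r)) = y at h2 ⊢
    rw [outTime] at h2
    field_simp at h2
    linarith
  · have h1 : φ (inTime N k r) ∈ Set.Icc (b' k) (x (k + 1)) := by
      constructor <;> rw [← hψ.2.1.le_iff_le, hψφ]
      · rw [hψb, inTime]
        gcongr
        exact hr.2
      · rw [hψx, inTime]
        push_cast
        gcongr
        linarith [hr.1]
    refine ⟨⟨(hb' k).1.le.trans h1.1, h1.2⟩, ?_⟩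
    have h2 := hψφ (inTime N k r)
    rw [hψg k _ ⟨((ha' k).1.trans (hab k)).le.trans h1.1, h1.2⟩, hPge k _ h1] at h2
    generalize f (φ (inTime N k r)) = y at h2 ⊢
    rw [inTime] at h2
    field_simp at h2
    linarith
  · have h1 : a' k < φ t := by
      rw [← hψ.2.1.lt_iff_lt, hψφ, hψa]
      exact ht.1
    have h2 : φ t < b' k := by
      rw [← hψ.2.1.lt_iff_lt, hψφ, hψb]
      exact ht.2
    rcases le_or_gt (φ t) (x k + η) with h3 | h3
    · rw [← hfa' k]
      exact hout k (Set.Ioo_subset_Icc_self (ha' k)) ⟨by linarith [(ha' k).1], h3⟩ h1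
    · rcases le_or_gt (φ t) (x (k + 1) - η) with h4 | h4
      · exact hgap k _ ⟨h3.le, h4⟩
      · rw [← hfb' k]
        exact hin (k + 1) ⟨h4.le, by linarith [(hb' k).2]⟩ (Set.Ioo_subset_Icc_self (hb' k)) h2

/-! ### The rays of a petal diagram -/

section Rays

variable {K : Knot} {n : ℕ} (D : PetalDiagram K n)

theorem PetalDiagram.time_add (k : ℤ) : D.time (k + (2 * n + 1 : ℕ)) = D.time k + 1 := by
  have := D.time_periodic k
  push_cast
  exact this

theorem PetalDiagram.time_add_two_mul (k : ℤ) :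
    D.time (k + (2 * (2 * n + 1) : ℕ)) = D.time k + 2 := by
  have e : k + ((2 * (2 * n + 1) : ℕ) : ℤ) = k + (2 * n + 1 : ℕ) + (2 * n + 1 : ℕ) := by
    push_cast; ring
  rw [e, D.time_add, D.time_add]
  ring

theorem PetalDiagram.angle_add_two_mul (k : ℤ) :
    D.angle (k + (2 * (2 * n + 1) : ℕ)) = D.angle k + 2 * Real.pi := by
  have e : k + ((2 * (2 * n + 1) : ℕ) : ℤ) = k + (2 * n + 1) + (2 * n + 1) := by
    push_cast; ring
  rw [e, D.angle_periodic, D.angle_periodic]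
  ring

theorem neg_one_zpow_add_two_mul {R : Type*} [DivisionRing R] (m : ℤ) (N : ℕ) :
    (-1 : R) ^ (m + (2 * N : ℕ)) = (-1) ^ m := by
  rw [zpow_add₀ (by simp), zpow_natCast, pow_mul]
  simp

theorem neg_one_zpow_add_odd {R : Type*} [DivisionRing R] (m : ℤ) (n : ℕ) :
    (-1 : R) ^ (m + (2 * n + 1 : ℕ)) = -(-1) ^ m := by
  rw [zpow_add₀ (by simp), zpow_natCast, pow_succ, pow_mul]
  simp

/-- The half strand of a petal diagram that leaves the crossing point, taken as the origin, in the
direction `angle m`.  It belongs to strand `m` and is run through from the crossing point: in the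
sense of the knot if `m` is even, against it if `m` is odd. -/
noncomputable def PetalDiagram.ray (m : ℤ) (s : ℝ) : ℂ :=
  K.proj (D.time m + (-1) ^ m * s) - D.center

theorem Knot.continuous_proj (K : Knot) : Continuous K.proj :=
  continuous_fst.comp K.continuous_toFun

theorem Knot.proj_add_one (K : Knot) (t : ℝ) : K.proj (t + 1) = K.proj t := by
  rw [Knot.proj, K.periodic, Knot.proj]

theorem PetalDiagram.continuous_ray (m : ℤ) : Continuous (D.ray m) := by
  have := K.continuous_proj
  unfold PetalDiagram.ray
  fun_prop

theorem PetalDiagram.ray_zero (m : ℤ) : D.ray m 0 = 0 := by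
  rw [ray, mul_zero, add_zero, sub_eq_zero]
  exact (D.proj_eq_center_iff _).2 ⟨m, rfl⟩

theorem PetalDiagram.ray_add (m : ℤ) : D.ray (m + (2 * (2 * n + 1) : ℕ)) = D.ray m := by
  ext1 s
  rw [ray, ray, D.time_add_two_mul, neg_one_zpow_add_two_mul]
  have e : D.time m + 2 + (-1) ^ m * s = D.time m + (-1) ^ m * s + 1 + 1 := by ring
  rw [e, K.proj_add_one, K.proj_add_one]

theorem PetalDiagram.exists_ray_out (k : ℤ) :
    ∃ m, ∀ s, D.ray m s = K.proj (D.time k + s) - D.center := by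
  rcases Int.even_or_odd k with hk | hk
  · refine ⟨k, fun s => ?_⟩
    rw [ray, hk.neg_one_zpow, one_mul]
  · refine ⟨k + (2 * n + 1 : ℕ), fun s => ?_⟩
    rw [ray, D.time_add, neg_one_zpow_add_odd, hk.neg_one_zpow, neg_neg, one_mul, add_right_comm,
      K.proj_add_one]

theorem PetalDiagram.exists_ray_in (k : ℤ) :
    ∃ m, ∀ s, D.ray m s = K.proj (D.time k - s) - D.center := by
  rcases Int.even_or_odd k with hk | hk
  · refine ⟨k + (2 * n + 1 : ℕ), fun s => ?_⟩
    rw [ray, D.time_add, neg_one_zpow_add_odd, hk.neg_one_zpow, add_right_comm, K.proj_add_one,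
      neg_one_mul, sub_eq_add_neg (D.time k)]
  · refine ⟨k, fun s => ?_⟩
    rw [ray, hk.neg_one_zpow, neg_one_mul, sub_eq_add_neg (D.time k)]

theorem PetalDiagram.contDiffAt_ray (m : ℤ) : ContDiffAt ℝ 1 (D.ray m) 0 := by
  have h1 : ContDiffAt ℝ 1 (fun s : ℝ => D.time m + (-1) ^ m * s) 0 := by fun_prop
  have h2 : ContDiffAt ℝ 1 K.proj (D.time m + (-1) ^ m * 0) := by
    rw [mul_zero, add_zero]
    exact D.contDiffAt_proj m
  exact (h2.comp (0 : ℝ) h1).sub contDiffAt_const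

theorem PetalDiagram.hasDerivAt_ray (m : ℤ) : ∃ r : ℝ, 0 < r ∧
    HasDerivAt (D.ray m) (r * Complex.exp (D.angle m * Complex.I)) 0 := by
  obtain ⟨r, hr, hd⟩ := D.hasDerivAt_proj m
  refine ⟨r, hr, ?_⟩
  have h1 : HasDerivAt (fun s : ℝ => D.time m + (-1) ^ m * s) ((-1) ^ m) 0 := by
    simpa using ((hasDerivAt_id (0 : ℝ)).const_mul ((-1) ^ m)).const_add (D.time m)
  have h2 : HasDerivAt K.proj (r * ((-1) ^ m * Complex.exp (D.angle m * Complex.I)))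
      (D.time m + (-1) ^ m * 0) := by
    rw [mul_zero, add_zero]
    exact hd
  have h3 := (h2.scomp (0 : ℝ) h1).sub_const D.center
  have e : ((-1 : ℝ) ^ m) • ((r : ℂ) * ((-1) ^ m * Complex.exp (D.angle m * Complex.I)))
      = r * Complex.exp (D.angle m * Complex.I) := by
    rw [Complex.real_smul]
    rcases Int.even_or_odd m with hm | hm <;> simp [hm.neg_one_zpow]
  rwa [e] at h3

/-- The rays of a petal diagram behave like line segments up to some distance from the crossing
point, the same for all of them. -/
theorem PetalDiagram.exists_uniform : ∃ η, 0 < η ∧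
    (∀ k, 2 * η < D.time (k + 1) - D.time k) ∧
    (∀ m, StrictMonoOn (fun s => ‖D.ray m s‖) (Set.Icc 0 η)) ∧
    (∀ m, ∀ s ∈ Set.Icc 0 η, ContinuousAt (branchAngle (D.ray m) (D.angle m)) s) ∧
    (∀ m, ∀ s ∈ Set.Icc 0 η, ∀ s' ∈ Set.Icc 0 η,
      branchAngle (D.ray m) (D.angle m) s < branchAngle (D.ray (m + 1)) (D.angle (m + 1)) s') ∧
    ∀ m, ∀ s ∈ Set.Icc 0 η, D.ray m s =
      ‖D.ray m s‖ * Complex.exp (branchAngle (D.ray m) (D.angle m) s * Complex.I) := by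
  have hsmall : ∀ x : ℝ, 0 < x → ∀ᶠ κ in 𝓝[>] (0 : ℝ), 2 * κ < x := fun x hx => by
    filter_upwards [Ioo_mem_nhdsGT (show 0 < x / 2 by linarith)] with κ hκ
    linarith [hκ.2]
  -- Angles that differ from those of the tangents by less than `κ` are in the same order.
  have h1 : ∀ᶠ κ in 𝓝[>] (0 : ℝ), ∀ m, 2 * κ < D.angle (m + 1) - D.angle m := by
    refine eventually_forall_of_periodic (M := 2 * (2 * n + 1)) (by omega) (fun m => ?_)
      fun m κ => ?_
    · exact hsmall _ (sub_pos.2 (D.angle_strictMono (by omega)))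
    · rw [add_right_comm, D.angle_add_two_mul, D.angle_add_two_mul, add_sub_add_right_eq_sub]
  obtain ⟨κ, hκ0, hκ⟩ := (eventually_mem_nhdsWithin.and h1).exists
  have h2 : ∀ᶠ η in 𝓝[>] (0 : ℝ), ∀ m, 2 * η < D.time (m + 1) - D.time m := by
    refine eventually_forall_of_periodic (M := 2 * (2 * n + 1)) (by omega) (fun m => ?_)
      fun m η => ?_
    · exact hsmall _ (sub_pos.2 (D.time_strictMono (by omega)))
    · rw [add_right_comm, D.time_add_two_mul, D.time_add_two_mul, add_sub_add_right_eq_sub]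
  have h3 : ∀ᶠ η in 𝓝[>] (0 : ℝ), ∀ m, StrictMonoOn (fun s => ‖D.ray m s‖) (Set.Icc 0 η) := by
    refine eventually_forall_of_periodic (M := 2 * (2 * n + 1)) (by omega) (fun m => ?_)
      fun m η => by rw [D.ray_add]
    obtain ⟨r, hr, hd⟩ := D.hasDerivAt_ray m
    refine eventually_strictMonoOn_norm (D.contDiffAt_ray m) (D.ray_zero m) ?_ hd
    exact mul_ne_zero (by exact_mod_cast hr.ne') (Complex.exp_ne_zero _)
  have h4 : ∀ᶠ η in 𝓝[>] (0 : ℝ), ∀ m, ∀ s ∈ Set.Icc 0 η,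
      ContinuousAt (branchAngle (D.ray m) (D.angle m)) s ∧
      |branchAngle (D.ray m) (D.angle m) s - D.angle m| < κ ∧
      D.ray m s = ‖D.ray m s‖ *
        Complex.exp (branchAngle (D.ray m) (D.angle m) s * Complex.I) := by
    refine eventually_forall_of_periodic (M := 2 * (2 * n + 1)) (by omega) (fun m => ?_)
      fun m η => ?_
    · obtain ⟨r, hr, hd⟩ := D.hasDerivAt_ray m
      exact eventually_branchAngle (D.continuous_ray m) (D.ray_zero m) hr hd hκ0
    · have e : branchAngle (D.ray m) (D.angle m + 2 * Real.pi)
          = fun s => branchAngle (D.ray m) (D.angle m) s + 2 * Real.pi :=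
        funext fun s => branchAngle_add_two_pi _ _ _
      have e2 : ∀ x : ℝ, Complex.exp (((x + 2 * Real.pi : ℝ) : ℂ) * Complex.I)
          = Complex.exp (x * Complex.I) := fun x => exp_mul_I_eq_iff.2 ⟨1, by push_cast; ring⟩
      rw [D.ray_add, D.angle_add_two_mul, e]
      simp only [e2, add_sub_add_right_eq_sub]
      refine forall₂_congr fun s _ => and_congr_left fun _ => ⟨fun h => ?_, fun h => ?_⟩
      · have := h.sub (continuousAt_const (y := 2 * Real.pi))
        simpa [Pi.sub_def] using this
      · exact h.add continuousAt_const
  obtain ⟨η, hη0, h2, h3, h4⟩ := (eventually_mem_nhdsWithin.and (h2.and (h3.and h4))).exists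
  refine ⟨η, hη0, h2, h3, fun m s hs => (h4 m s hs).1, fun m s hs s' hs' => ?_,
    fun m s hs => (h4 m s hs).2.2⟩
  have h5 := abs_lt.1 (h4 m s hs).2.1
  have h6 := abs_lt.1 (h4 (m + 1) s' hs').2.1
  linarith [hκ m, h5.2, h6.1]

end Rays

theorem rayTime_of_even {m : ℤ} (hm : Even m) (N : ℕ) (r : ℝ) : rayTime N m r = outTime N m r := by
  rw [rayTime, hm.neg_one_zpow, one_mul, outTime]

theorem rayTime_of_odd {m : ℤ} (hm : Odd m) (N : ℕ) (r : ℝ) :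
    rayTime N m r = inTime N ((m - 1 : ℤ) : ℝ) r := by
  rw [rayTime, hm.neg_one_zpow, inTime]
  push_cast
  ring

theorem continuous_rayTime (N : ℕ) (m : ℤ) : Continuous (rayTime N m) := by
  unfold rayTime
  fun_prop

theorem rayTime_add {N : ℕ} (hN : 0 < N) (m : ℤ) (r : ℝ) :
    rayTime N (m + (2 * N : ℕ)) r = rayTime N m r + 2 := by
  have : (0 : ℝ) < N := by exact_mod_cast hN
  rw [rayTime, rayTime, neg_one_zpow_add_two_mul]
  push_cast
  field_simp
  ring

/-- A knot with a petal diagram can be moved and reparametrized so that its projection passes the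
origin at the multiples of `1 / N`, moves with constant radial speed for a quarter of the time
before and after that, with the angle `A m r` at the distance `r`, and is outside the unit disc
otherwise. -/
theorem PetalDiagram.exists_radial {K : Knot} {n N : ℕ} (hN : N = 2 * n + 1)
    (D : PetalDiagram K n) : ∃ (K' : Knot) (A : ℤ → ℝ → ℝ), K.Isotopic K' ∧
      (∀ m, Continuous (A m)) ∧ (∀ m r, A (m + (2 * N : ℕ)) r = A m r + 2 * Real.pi) ∧
      (∀ m r, A m r < A (m + 1) r) ∧
      (∀ m, ∀ r ∈ Set.Icc (0 : ℝ) 1,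
        (K' (rayTime N m r)).1 = r * Complex.exp (A m r * Complex.I)) ∧
      (∀ k : ℤ, ∀ t ∈ Set.Ioo (outTime N k 1) (inTime N k 1), 1 < ‖(K' t).1‖) ∧
      (∀ s t, (K' s).1 = (K' t).1 → (K' s).1 ≠ 0 → ∃ k : ℤ, t = s + k) ∧
      (∀ t, (K' t).1 = 0 → ∃ k : ℤ, t = k / N) ∧
      ∀ k : ℤ, (K' (k / N)).2 = K.height (D.time k) := by
  subst hN
  obtain ⟨η, hη, hηt, hmono, hAc, hAlt, hray⟩ := D.exists_uniform
  set f : ℝ → ℝ := fun t => ‖K.proj t - D.center‖ with hf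
  have hfc : Continuous f := (K.continuous_proj.sub continuous_const).norm
  have hfz : ∀ t, f t = 0 ↔ ∃ k, t = D.time k := fun t => by
    rw [hf, norm_eq_zero, sub_eq_zero, D.proj_eq_center_iff]
  obtain ⟨φ, hφ, ε, hε, hout, hin, hside⟩ := exists_isReparametrization_radial hfc
    (fun t => by simp only [hf, K.proj_add_one]) (fun t => norm_nonneg _) D.time_strictMono
    (by omega) D.time_add hfz hη hηt
    (fun k s hs t ht hst => by
      obtain ⟨m, hm⟩ := D.exists_ray_out k
      have := hmono m (a := s - D.time k) ⟨by linarith [hs.1], by linarith [hs.2]⟩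
        (b := t - D.time k) ⟨by linarith [ht.1], by linarith [ht.2]⟩ (by linarith)
      simpa [hm] using this)
    (fun k s hs t ht hst => by
      obtain ⟨m, hm⟩ := D.exists_ray_in k
      have := hmono m (a := D.time k - t) ⟨by linarith [ht.2], by linarith [ht.1]⟩
        (b := D.time k - s) ⟨by linarith [hs.2], by linarith [hs.1]⟩ (by linarith)
      simpa [hm] using this)
  set N := 2 * n + 1 with hN
  obtain ⟨K₁, hK₁, hK₁φ⟩ := K.exists_reparam hφ
  obtain ⟨K₂, hK₂, hK₂p⟩ := K₁.exists_map (isotopicToId_planar D.center (inv_pos.2 hε))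
  have hK₂' : ∀ t, (K₂ t).1 = ((ε⁻¹ : ℝ) : ℂ) * (K.proj (φ t) - D.center) := fun t => by
    rw [hK₂p, hK₁φ, Knot.proj]
  have hK₂n : ∀ t, ‖(K₂ t).1‖ = ε⁻¹ * f (φ t) := fun t => by
    rw [hK₂', norm_mul, Complex.norm_real, Real.norm_of_nonneg (inv_pos.2 hε).le]
  have hφk : ∀ k : ℤ, φ (k / N) = D.time k := fun k => by
    obtain ⟨h1, h2⟩ := hout k 0 ⟨le_rfl, zero_le_one⟩
    rw [outTime, zero_div, add_zero] at h1 h2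
    rw [mul_zero] at h2
    obtain ⟨j, hj⟩ := (hfz _).1 h2
    rw [hj] at h1 ⊢
    have h3 : j < k + 1 := by
      rw [← D.time_strictMono.lt_iff_lt]
      linarith [h1.2, hηt k]
    have h4 : k ≤ j := D.time_strictMono.le_iff_le.1 h1.1
    rw [show j = k by omega]
  set S : ℤ → ℝ → ℝ := fun m r =>
    (-1) ^ m * (φ (rayTime N m (max 0 (min 1 r))) - D.time m) with hS
  have hSmem : ∀ m, ∀ r ∈ Set.Icc (0 : ℝ) 1,
      (-1) ^ m * (φ (rayTime N m r) - D.time m) ∈ Set.Icc 0 η ∧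
      f (φ (rayTime N m r)) = ε * r := by
    intro m r hr
    rcases Int.even_or_odd m with hm | hm
    · rw [hm.neg_one_zpow, rayTime_of_even hm]
      obtain ⟨h1, h2⟩ := hout m r hr
      exact ⟨⟨by linarith [h1.1], by linarith [h1.2]⟩, h2⟩
    · rw [hm.neg_one_zpow, rayTime_of_odd hm]
      obtain ⟨h1, h2⟩ := hin (m - 1) r hr
      rw [sub_add_cancel] at h1
      exact ⟨⟨by linarith [h1.2], by linarith [h1.1]⟩, h2⟩
  have hclamp : ∀ r : ℝ, max 0 (min 1 r) ∈ Set.Icc (0 : ℝ) 1 := fun r =>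
    ⟨le_max_left _ _, max_le zero_le_one (min_le_left _ _)⟩
  have hSm : ∀ m r, S m r ∈ Set.Icc 0 η := fun m r => (hSmem m _ (hclamp r)).1
  refine ⟨K₂, fun m r => branchAngle (D.ray m) (D.angle m) (S m r), hK₁.trans hK₂, fun m => ?_,
    fun m r => ?_, fun m r => hAlt m _ (hSm m r) _ (hSm _ r), fun m r hr => ?_, fun k t ht => ?_,
    fun s t hst hs => ?_, fun t ht => ?_, fun k => ?_⟩
  · have hSc : Continuous (S m) := by
      have h1 := hφ.1
      have h2 := continuous_rayTime N m
      simp only [hS]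
      fun_prop
    exact continuous_iff_continuousAt.2 fun r =>
      ContinuousAt.comp (g := branchAngle (D.ray m) (D.angle m)) (hAc m _ (hSm m r))
        hSc.continuousAt
  · have e : S (m + (2 * N : ℕ)) r = S m r := by
      simp only [hS]
      rw [neg_one_zpow_add_two_mul, rayTime_add (by omega), D.time_add_two_mul]
      have := hφ.map_int_add (rayTime N m (max 0 (min 1 r))) 2
      push_cast at this
      rw [this]
      ring
    simp only
    rw [e, D.ray_add, D.angle_add_two_mul, branchAngle_add_two_pi]
  · obtain ⟨h1, h2⟩ := hSmem m r hr
    have e : S m r = (-1) ^ m * (φ (rayTime N m r) - D.time m) := by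
      simp only [hS]
      rw [min_eq_right hr.2, max_eq_right hr.1]
    have e2 : D.ray m (S m r) = K.proj (φ (rayTime N m r)) - D.center := by
      rw [PetalDiagram.ray, e, ← mul_assoc, ← sq, neg_one_zpow_sq, one_mul, add_sub_cancel]
    have h3 := hray m _ (hSm m r)
    have h4 : ‖D.ray m (S m r)‖ = ε * r := by rw [e2]; exact h2
    rw [h4, e2] at h3
    rw [hK₂', h3]
    have : (ε : ℂ) ≠ 0 := by exact_mod_cast hε.ne'
    push_cast
    field_simp
  · rw [hK₂n, ← div_eq_inv_mul, one_lt_div hε]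
    exact hside k t ht
  · have hε' : ((ε⁻¹ : ℝ) : ℂ) ≠ 0 := by exact_mod_cast (inv_pos.2 hε).ne'
    rw [hK₂', hK₂'] at hst
    rw [hK₂'] at hs
    have h1 := sub_left_injective (mul_left_cancel₀ hε' hst)
    obtain ⟨k, hk⟩ := D.proj_injective _ _ h1 (sub_ne_zero.1 (right_ne_zero_of_mul hs))
    refine ⟨k, hφ.2.1.injective ?_⟩
    rw [hk, hφ.map_int_add]
  · have h1 : f (φ t) = 0 := by
      have := hK₂n t
      rw [ht, norm_zero] at this
      exact (mul_eq_zero.1 this.symm).resolve_left (inv_pos.2 hε).ne'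
    obtain ⟨k, hk⟩ := (hfz _).1 h1
    exact ⟨k, hφ.2.1.injective (by rw [hk, hφk])⟩
  · rw [hK₂p, hK₁φ, hφk, Knot.height]

/-! ### The normal form of a petal diagram -/

/-- A family of continuous functions of `ρ`, increasing with the index and growing by `2 π` in `M`
steps, can be interpolated by a family of increasing functions that commute with the translation by
`2 π`. -/
theorem exists_angle_interpolation {A : ℤ → ℝ → ℝ} (hc : ∀ m, Continuous (A m)) {M : ℕ}
    (hM : 0 < M) (hp : ∀ m ρ, A (m + M) ρ = A m ρ + 2 * Real.pi)
    (hlt : ∀ m ρ, A m ρ < A (m + 1) ρ) :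
    ∃ L : ℝ → ℝ → ℝ, Continuous (Function.uncurry L) ∧ (∀ ρ, StrictMono (L ρ)) ∧
      (∀ ρ x, L ρ (x + 2 * Real.pi) = L ρ x + 2 * Real.pi) ∧
      ∀ (m : ℤ) ρ, L ρ (m * (2 * Real.pi / M)) = A m ρ := by
  have hM' : (0 : ℝ) < M := by exact_mod_cast hM
  have hx : StrictMono fun k : ℤ => (k : ℝ) := Int.cast_strictMono
  obtain ⟨g, hgc, hg⟩ := exists_glue hx exists_mem_Ico_intCast
    (fun k ρ u => A k ρ + (u - k) * (A (k + 1) ρ - A k ρ))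
    (fun k => by
      have h1 := hc k
      have h2 := hc (k + 1)
      change Continuous fun p : ℝ × ℝ => A k p.1 + (p.2 - k) * (A (k + 1) p.1 - A k p.1)
      fun_prop)
    (fun k ρ => by push_cast; ring)
  have hgmono : ∀ ρ, StrictMono (g ρ) := fun ρ =>
    strictMono_of_strictMonoOn_Icc hx exists_mem_Ico_intCast fun k s hs t ht hst => by
      rw [hg k ρ s hs, hg k ρ t ht]
      have := sub_pos.2 (hlt k ρ)
      gcongr
  have hgM : ∀ ρ u, g ρ (u + M) = g ρ u + 2 * Real.pi := fun ρ u => by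
    obtain ⟨k, hk⟩ := exists_mem_Ico_intCast u
    rw [hg k ρ u (Set.Ico_subset_Icc_self hk), hg (k + M) ρ (u + M) ⟨by
      push_cast; linarith [hk.1], by have := hk.2; push_cast at this ⊢; linarith⟩,
      add_right_comm k, hp, hp]
    push_cast
    ring
  have hpi := Real.two_pi_pos
  refine ⟨fun ρ x => g ρ (x * (M / (2 * Real.pi))), ?_, fun ρ s t hst => hgmono ρ ?_, fun ρ x => ?_,
    fun m ρ => ?_⟩
  · exact hgc.comp (continuous_fst.prodMk (continuous_snd.mul continuous_const))
  · have : 0 < M / (2 * Real.pi) := by positivity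
    gcongr
  · rw [← hgM]
    field_simp
  · have e : (m : ℝ) * (2 * Real.pi / M) * (M / (2 * Real.pi)) = m := by field_simp
    simp only
    rw [e, hg m ρ m ⟨le_rfl, by push_cast; linarith⟩, sub_self, zero_mul, add_zero]

/-- An order automorphism of the line that is the identity below `y` and linear above it. -/
theorem exists_orderIso_eq_self_of_le {y p q : ℝ} (hp : y < p) (hq : y < q) :
    ∃ ψ : ℝ ≃o ℝ, (∀ u ≤ y, ψ u = u) ∧ ψ p = q := by
  set c := (q - y) / (p - y) with hc
  have hpy : 0 < p - y := sub_pos.2 hp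
  have hc0 : 0 < c := div_pos (sub_pos.2 hq) hpy
  have h1 : ∀ u ≤ y, u + (c - 1) * max 0 (u - y) = u := fun u hu => by
    rw [max_eq_left (by linarith)]
    ring
  have h2 : ∀ u, y ≤ u → u + (c - 1) * max 0 (u - y) = y + c * (u - y) := fun u hu => by
    rw [max_eq_right (by linarith)]
    ring
  have hmono : StrictMono fun u => u + (c - 1) * max 0 (u - y) := by
    intro u v huv
    simp only
    rcases le_or_gt v y with hv | hv
    · rwa [h1 v hv, h1 u (by linarith)]
    · rw [h2 v hv.le]
      have := mul_pos hc0 (sub_pos.2 hv)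
      rcases le_or_gt u y with hu | hu
      · rw [h1 u hu]
        linarith
      · rw [h2 u hu.le]
        gcongr
  refine ⟨hmono.orderIsoOfSurjective _ fun v => ?_, fun u hu => h1 u hu, ?_⟩
  · rcases le_or_gt v y with hv | hv
    · exact ⟨v, h1 v hv⟩
    · have : 0 < (v - y) / c := div_pos (sub_pos.2 hv) hc0
      refine ⟨y + (v - y) / c, ?_⟩
      simp only
      rw [h2 _ (by linarith)]
      field_simp
      ring
  · change p + (c - 1) * max 0 (p - y) = q
    rw [h2 p hp.le, hc]
    field_simp
    ring

/-- Any two finite families of real numbers in the same order are related by an order automorphism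
of the real line. -/
theorem exists_orderIso_forall_eq {ι : Type*} [DecidableEq ι] (s : Finset ι) (a b : ι → ℝ)
    (h : ∀ i ∈ s, ∀ j ∈ s, a i < a j ↔ b i < b j) : ∃ ψ : ℝ ≃o ℝ, ∀ i ∈ s, ψ (a i) = b i := by
  induction s using Finset.induction_on_max_value b with
  | empty => exact ⟨OrderIso.refl ℝ, by simp⟩
  | insert i s _ hmax ih =>
    obtain ⟨ψ, hψ⟩ := ih fun j hj k hk =>
      h j (Finset.mem_insert_of_mem hj) k (Finset.mem_insert_of_mem hk)
    have hi := Finset.mem_insert_self i s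
    by_cases hex : ∃ j ∈ s, b j = b i
    · obtain ⟨j, hj, hji⟩ := hex
      have hj' := Finset.mem_insert_of_mem (b := i) hj
      have h1 : ¬ a j < a i := by rw [h j hj' i hi, hji]; exact lt_irrefl _
      have h2 : ¬ a i < a j := by rw [h i hi j hj', hji]; exact lt_irrefl _
      refine ⟨ψ, fun k hk => ?_⟩
      rcases Finset.mem_insert.1 hk with rfl | hk
      · rw [le_antisymm (not_lt.1 h1) (not_lt.1 h2), hψ j hj, hji]
      · exact hψ k hk
    · push Not at hex
      have hlt : ∀ j ∈ s, b j < b i := fun j hj => (hmax j hj).lt_of_ne (hex j hj)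
      have hψlt : ∀ j ∈ s, b j < ψ (a i) := fun j hj => by
        rw [← hψ j hj, ψ.lt_iff_lt]
        exact (h j (Finset.mem_insert_of_mem hj) i hi).2 (hlt j hj)
      have hev : ∀ᶠ y in 𝓝[<] (min (ψ (a i)) (b i)), ∀ j ∈ s, b j < y :=
        (Filter.eventually_all_finset s).2 fun j hj =>
          (lt_mem_nhds (lt_min (hψlt j hj) (hlt j hj))).filter_mono nhdsWithin_le_nhds
      obtain ⟨y, hy, hys⟩ := (eventually_mem_nhdsWithin.and hev).exists
      obtain ⟨χ, hχ, hχi⟩ := exists_orderIso_eq_self_of_le (lt_min_iff.1 hy).1 (lt_min_iff.1 hy).2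
      refine ⟨ψ.trans χ, fun k hk => ?_⟩
      rw [OrderIso.trans_apply]
      rcases Finset.mem_insert.1 hk with rfl | hk
      · exact hχi
      · rw [hψ k hk, hχ _ (hys k hk).le]

/-- The beginning of each petal is on a ray.  The odd rays are run through inwards, so for odd `k`
it is the ray opposite to the ray `k`. -/
theorem Knot.exists_apply_outTime (n : ℕ) (k : ℤ) : ∃ m : ℤ, ∀ (K : Knot) (r : ℝ),
    K (outTime (2 * n + 1 : ℕ) k r) = K (rayTime (2 * n + 1) m r) := by
  rcases Int.even_or_odd k with hk | hk
  · exact ⟨k, fun K r => by rw [rayTime_of_even hk]⟩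
  · refine ⟨k + (2 * n + 1 : ℕ), fun K r => ?_⟩
    rw [rayTime, neg_one_zpow_add_odd, hk.neg_one_zpow, neg_neg, one_mul, outTime, ← K.periodic]
    congr 1
    push_cast
    field_simp
    ring

theorem Knot.exists_apply_inTime (n : ℕ) (k : ℤ) : ∃ m : ℤ, ∀ (K : Knot) (r : ℝ),
    K (inTime (2 * n + 1 : ℕ) k r) = K (rayTime (2 * n + 1) m r) := by
  rcases Int.even_or_odd (k + 1) with hk | hk
  · refine ⟨k + 1 + (2 * n + 1 : ℕ), fun K r => ?_⟩
    rw [rayTime, neg_one_zpow_add_odd, hk.neg_one_zpow, neg_one_mul, inTime, ← K.periodic]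
    congr 1
    push_cast
    field_simp
    ring
  · exact ⟨k + 1, fun K r => by rw [rayTime_of_odd hk, add_sub_cancel_right]⟩

theorem PetalDiagram.label_add {K : Knot} {n : ℕ} (D : PetalDiagram K n) (k : ℤ) :
    D.label (k + (2 * n + 1 : ℕ)) = D.label k := by
  have h : K.height (D.time (k + (2 * n + 1 : ℕ))) = K.height (D.time k) := by
    rw [D.time_add, Knot.height, K.periodic, Knot.height]
  have h1 := D.label_lt_iff (k + (2 * n + 1 : ℕ)) k
  have h2 := D.label_lt_iff k (k + (2 * n + 1 : ℕ))
  rw [h] at h1 h2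
  have := lt_irrefl (K.height (D.time k))
  exact le_antisymm (not_lt.1 (mt h2.1 this)) (not_lt.1 (mt h1.1 this))

theorem PetalDiagram.label_add_mul {K : Knot} {n : ℕ} (D : PetalDiagram K n) (k q : ℤ) :
    D.label (k + q * (2 * n + 1 : ℕ)) = D.label k := by
  have : Function.Periodic D.label ((2 * n + 1 : ℕ) : ℤ) := D.label_add
  exact this.int_mul q k

/-- A knot with a petal diagram is isotopic to a normal knot whose strands near the origin depend on
the labels only. -/
theorem PetalDiagram.exists_isNormal {K : Knot} {n : ℕ} (D : PetalDiagram K n) :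
    ∃ K' : Knot, K.Isotopic K' ∧ K'.IsNormal (2 * n + 1) ∧
      ∀ m : ℤ, ∀ r ∈ Set.Icc (0 : ℝ) 1, K' (rayTime (2 * n + 1) m r) =
        (r * Complex.exp ((m * (2 * Real.pi / (2 * (2 * n + 1) : ℕ)) : ℝ) * Complex.I),
          -(D.label m : ℝ)) := by
  obtain ⟨N, hN⟩ : ∃ N, N = 2 * n + 1 := ⟨_, rfl⟩
  have hN0 : 0 < N := by omega
  have hNR : (0 : ℝ) < N := by exact_mod_cast hN0
  obtain ⟨K₁, A, hK₁, hAc, hAp, hAlt, hA, hside, hinj, hzero, hheight⟩ := D.exists_radial hN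
  -- The rays are straightened by rotating each circle about the origin into itself.
  obtain ⟨L, hLc, hLm, hLp, hL⟩ := exists_angle_interpolation hAc (by omega) hAp hAlt
  obtain ⟨g, hg, hgL, hLg⟩ := (isotopicToId_polarMap hLc hLm hLp).exists_inverse
  obtain ⟨K₂, hK₂, hK₂g⟩ := K₁.exists_map hg
  have hLK : ∀ t, (polarMap L (K₂ t).1, (K₂ t).2) = K₁ t := fun t => by rw [hK₂g, hLg]
  have hK₂1 : ∀ t, polarMap L (K₂ t).1 = (K₁ t).1 := fun t => congrArg Prod.fst (hLK t)
  have hK₂2 : ∀ t, (K₂ t).2 = (K₁ t).2 := fun t => by rw [← hLK]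
  have hnorm : ∀ t, ‖(K₂ t).1‖ = ‖(K₁ t).1‖ := fun t => by rw [← hK₂1, norm_polarMap]
  have hK₂0 : ∀ t, (K₂ t).1 = 0 ↔ (K₁ t).1 = 0 := fun t => by
    rw [← norm_eq_zero, hnorm, norm_eq_zero]
  have hinj₂ : ∀ s t, (K₂ s).1 = (K₂ t).1 → (K₂ s).1 ≠ 0 → ∃ k : ℤ, t = s + k :=
    fun s t hst hs => hinj s t (by rw [← hK₂1, hst, hK₂1]) (mt (hK₂0 s).2 hs)
  have hray : ∀ m : ℤ, ∀ r ∈ Set.Icc (0 : ℝ) 1, (K₂ (rayTime N m r)).1 =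
      r * Complex.exp ((m * (2 * Real.pi / (2 * N : ℕ)) : ℝ) * Complex.I) := fun m r hr => by
    have h1 := hgL (r * Complex.exp ((m * (2 * Real.pi / (2 * N : ℕ)) : ℝ) * Complex.I),
      (K₁ (rayTime N m r)).2)
    simp only at h1
    rw [polarMap_polar hLp hr.1, hL, ← hA m r hr] at h1
    rw [hK₂g, h1]
  -- A vertical shear makes the strands horizontal near the origin.
  obtain ⟨W, hWc, hWp, hW⟩ := exists_plateau (fun k => k) N N (fun k => by push_cast; ring)
  have hWk : ∀ k : ℤ, W k = k := fun k => hW k k (by simp)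
  set d : ℝ → ℝ := fun t => (K₂ (W (N * t) / N)).2 - (K₂ t).2 with hd
  have hdc : Continuous d := by
    have h1 : Continuous fun t => (K₂ t).2 := continuous_snd.comp K₂.continuous_toFun
    exact (h1.comp (f := fun t => W (N * t) / N) (by fun_prop)).sub h1
  have hd1 : Function.Periodic d 1 := fun t => by
    simp only [hd]
    rw [mul_add, mul_one, hWp, add_div, div_self hNR.ne', K₂.periodic, K₂.periodic]
  have hdz : ∀ t, (K₂ t).1 = 0 → d t = 0 := fun t ht => by
    obtain ⟨k, rfl⟩ := hzero t ((hK₂0 t).1 ht)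
    simp only [hd]
    rw [mul_div_cancel₀ _ hNR.ne', hWk, sub_self]
  obtain ⟨K₃, hK₃, hK₃d⟩ := K₂.exists_shear hdc (fun s t hst => by
    by_cases hs : (K₂ s).1 = 0
    · rw [hdz s hs, hdz t (by rw [← hst, hs])]
    · obtain ⟨k, rfl⟩ := hinj₂ s t hst hs
      simpa using (hd1.int_mul k s).symm)
  -- An order automorphism of the line brings the strands to the heights given by the labels.
  obtain ⟨ψ, hψ⟩ := exists_orderIso_forall_eq (Finset.range N)
    (fun i => K.height (D.time i)) (fun i => -(D.label i : ℝ)) (fun i _ j _ => by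
      rw [neg_lt_neg_iff, Nat.cast_lt, D.label_lt_iff])
  have hψk : ∀ k, ψ (K.height (D.time k)) = -D.label k := fun k => by
    obtain ⟨i, q, hi, rfl⟩ := exists_eq_natCast_add_mul hN0 k
    have h1 : K.height (D.time (i + q * N)) = K.height (D.time i) := by
      rw [map_add_int_mul_one (x := D.time) (N := N) (by rw [hN]; exact D.time_add),
        Knot.height, K.periodic_int, Knot.height]
    rw [h1, hψ i (Finset.mem_range.2 hi), hN, D.label_add_mul]
  obtain ⟨K₄, hK₄, hK₄ψ⟩ := K₃.exists_map (isotopicToId_height ψ)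
  have hK₄1 : ∀ t, (K₄ t).1 = (K₂ t).1 := fun t => by rw [hK₄ψ, hK₃d]
  have hK₄r : ∀ m : ℤ, ∀ r ∈ Set.Icc (0 : ℝ) 1, K₄ (rayTime N m r) =
      (r * Complex.exp ((m * (2 * Real.pi / (2 * N : ℕ)) : ℝ) * Complex.I), -(D.label m : ℝ)) := by
    intro m r hr
    have h1 : W (N * rayTime N m r) = m := by
      rw [rayTime, mul_div_cancel₀ _ hNR.ne']
      refine hW m _ ?_
      rw [add_sub_cancel_left, abs_mul, abs_zpow, abs_neg, abs_one, one_zpow, one_mul,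
        abs_of_nonneg (by linarith [hr.1])]
      linarith [hr.2]
    rw [hK₄ψ, hK₃d, hray m r hr]
    simp only [hd]
    rw [h1, add_sub_cancel, hK₂2, hheight, hψk]
  have hK₄out : ∀ k : ℤ, ∃ θ : ℝ, ∀ r ∈ Set.Icc (0 : ℝ) 1,
      (K₄ (outTime N k r)).1 = r * Complex.exp (θ * Complex.I) := fun k => by
    subst hN
    obtain ⟨m, hm⟩ := Knot.exists_apply_outTime n k
    exact ⟨_, fun r hr => by rw [hm, hK₄r m r hr]⟩
  have hK₄in : ∀ k : ℤ, ∃ θ : ℝ, ∀ r ∈ Set.Icc (0 : ℝ) 1,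
      (K₄ (inTime N k r)).1 = r * Complex.exp (θ * Complex.I) := fun k => by
    subst hN
    obtain ⟨m, hm⟩ := Knot.exists_apply_inTime n k
    exact ⟨_, fun r hr => by rw [hm, hK₄r m r hr]⟩
  have h01 : (1 : ℝ) ∈ Set.Icc (0 : ℝ) 1 := ⟨zero_le_one, le_rfl⟩
  refine ⟨K₄, hK₁.trans (hK₂.trans (hK₃.trans hK₄)), ?_, hN ▸ hK₄r⟩
  rw [← hN]
  refine ⟨fun k r hr => ?_, fun k r hr => ?_, fun k => ?_, fun k => ?_, fun k t ht => ?_,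
    fun s t => ?_⟩
  · obtain ⟨θ, hθ⟩ := hK₄out k
    rw [hθ r hr, hθ 1 h01, Complex.ofReal_one, one_mul]
  · obtain ⟨θ, hθ⟩ := hK₄in k
    rw [hθ r hr, hθ 1 h01, Complex.ofReal_one, one_mul]
  · obtain ⟨θ, hθ⟩ := hK₄out k
    rw [hθ 1 h01, Complex.ofReal_one, one_mul, Complex.norm_exp_ofReal_mul_I]
  · obtain ⟨θ, hθ⟩ := hK₄in k
    rw [hθ 1 h01, Complex.ofReal_one, one_mul, Complex.norm_exp_ofReal_mul_I]
  · rw [hK₄1, hnorm]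
    exact hside k t ht
  · rw [hK₄1, hK₄1]
    exact hinj₂ s t

/-! ### The knot type represented by a petal permutation -/

/-- The same petal diagram with the numbering of the strands shifted by `c`. -/
noncomputable def PetalDiagram.shift {K : Knot} {n : ℕ} (D : PetalDiagram K n) (c : ℤ) :
    PetalDiagram K n where
  center := D.center
  time k := D.time (k + c)
  time_strictMono _ _ h := D.time_strictMono (by omega)
  time_periodic k := by rw [add_right_comm, D.time_periodic]
  proj_eq_center_iff t := by
    rw [D.proj_eq_center_iff]
    exact ⟨fun ⟨k, hk⟩ => ⟨k - c, by rw [hk, sub_add_cancel]⟩, fun ⟨k, hk⟩ => ⟨_, hk⟩⟩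
  proj_injective := D.proj_injective
  -- The direction `(-1) ^ k * exp (angle k * I)` of a strand does not change with the parity of its
  -- number, so the angle changes by a multiple of `π`.
  angle k := D.angle (k + c) + c * Real.pi
  angle_strictMono _ _ h := add_lt_add_left (D.angle_strictMono (by omega)) _
  angle_periodic k := by rw [add_right_comm, D.angle_periodic]; ring
  contDiffAt_proj k := D.contDiffAt_proj _
  hasDerivAt_proj k := by
    obtain ⟨r, hr, h⟩ := D.hasDerivAt_proj (k + c)
    refine ⟨r, hr, ?_⟩
    have e : Complex.exp (((c : ℝ) * Real.pi : ℝ) * Complex.I) = (-1) ^ c := by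
      have := Complex.exp_int_mul (Real.pi * Complex.I) c
      rw [Complex.exp_pi_mul_I] at this
      rw [← this]
      congr 1
      push_cast
      ring
    rw [zpow_add₀ (by simp), mul_assoc] at h
    rw [Complex.ofReal_add, add_mul, Complex.exp_add, e, mul_comm (Complex.exp _) ((-1) ^ c)]
    exact h
  not_nested j k hjk t ht := by
    have := D.not_nested (j + c) (k + c) (fun h => hjk (Int.ModEq.add_right_cancel' c h)) t
      (by rwa [add_right_comm k] at ht)
    rwa [add_right_comm j] at this
  label k := D.label (k + c)
  label_lt_iff j k := D.label_lt_iff _ _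

theorem PetalDiagram.isotopic_of_label_eq {K K' : Knot} {n : ℕ} (D : PetalDiagram K n)
    (D' : PetalDiagram K' n) (h : ∀ k, D.label k = D'.label k) : K.Isotopic K' := by
  obtain ⟨K₁, hK, hn₁, h₁⟩ := D.exists_isNormal
  obtain ⟨K₂, hK', hn₂, h₂⟩ := D'.exists_isNormal
  refine hK.trans (Knot.Isotopic.trans (hn₁.isotopic (by omega) hn₂ (fun k r hr => ?_)
    fun k r hr => ?_) hK'.symm)
  · obtain ⟨m, hm⟩ := Knot.exists_apply_outTime n k
    rw [hm, hm, h₁ m r hr, h₂ m r hr, h]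
  · obtain ⟨m, hm⟩ := Knot.exists_apply_inTime n k
    rw [hm, hm, h₁ m r hr, h₂ m r hr, h]

/-- A petal permutation represents at most one knot type. -/
theorem PetalDiagram.isotopic_of_labels_eq {K K' : Knot} {n : ℕ} (D : PetalDiagram K n)
    (D' : PetalDiagram K' n) (h : D.labels = D'.labels) : K.Isotopic K' := by
  obtain ⟨c, hc⟩ := Cycle.coe_eq_coe.1 h
  refine (D.shift c).isotopic_of_label_eq D' fun k => ?_
  obtain ⟨i, q, hi, rfl⟩ := exists_eq_natCast_add_mul (show 0 < 2 * n + 1 by omega) k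
  rw [PetalDiagram.label_add_mul, PetalDiagram.label_add_mul]
  have h1 : (List.map (fun k : ℕ => D'.label k) (List.range (2 * n + 1)))[i]'(by simpa using hi)
      = D'.label i := by simp
  rw [← h1]
  simp only [← hc, List.getElem_rotate, List.getElem_map, List.getElem_range, List.length_map,
    List.length_range]
  change D.label (i + c) = _
  have h2 : ((i : ℤ) + c) = ((i + c) % (2 * n + 1) : ℕ)
      + (((i + c) / (2 * n + 1) : ℕ) : ℤ) * (2 * n + 1 : ℕ) := by
    rw [mul_comm (((i + c) / (2 * n + 1) : ℕ) : ℤ)]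
    exact_mod_cast (Nat.mod_add_div (i + c) (2 * n + 1)).symm
  rw [h2, D.label_add_mul]

theorem mainTheorem3 {n : ℕ} (σ : PetalPermutation n) (σ' : PetalPermutation (n + 1))
    (h : IsTrivialPetalAddition σ σ') :
    ∃ T : KnotType, ∀ S : KnotType, (σ.Represents S ↔ S = T) ∧ (σ'.Represents S ↔ S = T) := by
  obtain ⟨K, K', hKK', ⟨D, hD⟩, D', hD'⟩ := h.exists_isotopic
  have hT : (⟦K'⟧ : KnotType) = ⟦K⟧ := Quotient.sound hKK'
  refine ⟨⟦K⟧, fun S => ⟨⟨?_, ?_⟩, ⟨?_, ?_⟩⟩⟩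
  · rintro ⟨K₁, ⟨D₁, h₁⟩, rfl⟩
    exact Quotient.sound (D₁.isotopic_of_labels_eq D (h₁.trans hD.symm))
  · rintro rfl
    exact ⟨K, ⟨D, hD⟩, rfl⟩
  · rintro ⟨K₁, ⟨D₁, h₁⟩, rfl⟩
    rw [← hT]
    exact Quotient.sound (D₁.isotopic_of_labels_eq D' (h₁.trans hD'.symm))
  · rintro rfl
    exact ⟨K', ⟨D', hD'⟩, hT⟩
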